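/- **Setting.** Let $\mathcal A=\{\left[{k\atop d}\right] : k\ge 1,\ d\ge 0\}$, and let $\mathbb Q\langle\mathcal A\rangle$ be the $\mathbb Q$-vector space spanned by the words $\left[{k_1,\dots,k_r\atop d_1,\dots,d_r}\right]$ $(r\ge 0)$ in these letters, with the commutative stuffle product determined by $1*w=w*1=w$ and $$aw*bv=a(w*bv)+b(aw*v)+(a\diamond b)(w*v),\qquad \left[{k_1\atop d_1}\right]\diamond\left[{k_2\atop d_2}\right]=\left[{k_1+k_2\atop d_1+d_2}\right].$$ With $\mathfrak A_r\left({X_1,\dots,X_r\atop Y_1,\dots,Y_r}\right)=\sum \left[{k_1,\dots,k_r\atop d_1,\dots,d_r}\right]\prod_j X_j^{k_j-1}\frac{Y_j^{d_j}}{d_j!}$, the swap $\sigma$ is the linear map on $\mathbb Q\langle\mathcal A\rangle$ that sends the word $\left[{k_1,\dots,k_r\atop d_1,\dots,d_r}\right]$ to the coefficient of $\prod_j X_j^{k_j-1}\frac{Y_j^{d_j}}{d_j!}$ in $\mathfrak A_r\left({Y_1+\dots+Y_r,\,\dots,\,Y_1+Y_2,\,Y_1\atop X_r,\,X_{r-1}-X_r,\,\dots,\,X_1-X_2}\right)$.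 The algebra of formal multiple Eisenstein series is $\mathcal G^f=(\mathbb Q\langle\mathcal A\rangle,*)/\mathfrak S$, where $\mathfrak S$ is the ideal generated by all $\sigma(w)-w$. Write $G^f(w)$ for the class of a word $w$, write $G^f(k)=G^f\left[{k\atop 0}\right]$, and let $\mathcal G^f_k$ be the span of the $G^f(w)$ with $w$ of weight $\sum_j(k_j+d_j)=k$. For even $k\ge2$ put $e^f(k)=-\frac{2\,k!}{B_k}G^f(k)$, with $B_k$ the Bernoulli number. Let $\mathfrak N\subset\mathcal G^f$ be the ideal generated by the classes of all words that are not of the form $\left[{1,\dots,1,k_1,\dots,k_r\atop d_1,\dots,d_s,0,\dots,0}\right]$ $(r,s\ge0)$, and let $\pi:\mathcal G^f\to\mathcal Z^f=\mathcal G^f/\mathfrak N$ be the projection onto the algebra of formal multiple zeta values. On words, let $W$ be multiplication by the weight, and let $D$ send $\left[{k_1,\dots,k_r\atop d_1,\dots,d_r}\right]$ to the sum over $j$ of $k_j$ times the word with $\left[{k_j\atop d_j}\right]$ replaced by $\left[{k_j+1\atop d_j+1}\right]$. Let $\delta$ be the linear map on words given on generating series by $$\delta\mathfrak A_r=\sum_{j=1}^r\Bigl(X_jY_j-\tfrac12(X_j-X_{j+1}+Y_j)\varphi_j^+-\tfrac12(X_{j-1}-X_j+Y_j)\varphi_j^-+\tfrac14(\varphi_j^+)^2-\tfrac14(\varphi_j^-)^2\Bigr)\mathfrak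 A_r$$ (by comparing coefficients of $\prod_j X_j^{k_j-1}Y_j^{d_j}/d_j!$), where $X_{r+1}=Y_{r+1}=0$. For a family of series $f=(f_r)_{r\ge0}$, the depth-$r$ component $\varphi_j^{+}f_r$ (for $1\le j\le r$) is obtained from $f_{r-1}$ by inserting the variables $X_1,\dots,X_r$ with $X_j$ omitted and the variables $Y_1,\dots,Y_r,Y_{r+1}$ with $Y_j,Y_{j+1}$ merged into $Y_j+Y_{j+1}$ (for $j=r$ this just omits $Y_r$). Likewise $\varphi_j^-f_r$ (for $2\le j\le r$) is obtained by omitting $X_j$ and merging $Y_{j-1},Y_j$ into $Y_{j-1}+Y_j$. For all other $j$, $\varphi_j^\pm f_r=0$. **Theorem.** The maps $D,W,\delta$ on words induce (unique) derivations $D,W,\delta$ of the algebra $\mathcal G^f$. Let $\widetilde{\mathcal M}^f$ be the smallest subalgebra of $\mathcal G^f$ that contains $G^f(2)$ and is stable under $D,W,\delta$. Let $\mathcal M^f=\ker\delta|_{\widetilde{\mathcal M}^f}$ and $\mathcal S^f=\ker\pi|_{\mathcal M^f}$ be the spaces of formal modular forms and formal cusp forms, and write $\mathcal M^f_k=\mathcal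 M^f\cap\mathcal G^f_k$ and $\mathcal S^f_k=\mathcal S^f\cap\mathcal G^f_k$. Then: 1. The element $\Delta^f=\dfrac{e^f(4)^3-e^f(6)^2}{1728}$ lies in $\mathcal S^f_{12}$ and satisfies $D\Delta^f=e^f(2)\,\Delta^f$. 2. For every even $k\ge 4$ one has $G^f(k)\neq0$ and $\mathcal M^f_k=\mathbb Q\,G^f(k)\oplus\mathcal S^f_k$. -/

import Mathlib

namespace FormalMES

/-! ### The quasi-shuffle (stuffle) algebra `(ℚ⟨𝒜⟩, *)` -/

/-- The letter with upper index `k ≥ 1` and lower index `d ≥ 0` is the pair `(k, d)`.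
The product `⋄` of letters is the componentwise addition of pairs. -/
abbrev Letter : Type := ℕ+ × ℕ

/-- Words in the letters; the empty word is `[]`. -/
abbrev Word : Type := List Letter

/-- `ℚ⟨𝒜⟩`: the `ℚ`-vector space with basis the words.  Its ring structure below is
the stuffle product, not the concatenation product. -/
def QA : Type := Word →₀ ℚ

namespace QA

noncomputable instance : AddCommGroup QA := inferInstanceAs (AddCommGroup (Word →₀ ℚ))
noncomputable instance : Module ℚ QA := inferInstanceAs (Module ℚ (Word →₀ ℚ))

/-- A word, as an element of `ℚ⟨𝒜⟩`. -/
noncomputable def word (w : Word) : QA := (Finsupp.single w 1 : Word →₀ ℚ)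

/-- The linear map `ℚ⟨𝒜⟩ → M` with prescribed values on words. -/
noncomputable def ofWords {M : Type*} [AddCommGroup M] [Module ℚ M] (f : Word → M) :
    QA →ₗ[ℚ] M :=
  (Finsupp.linearCombination ℚ f : (Word →₀ ℚ) →ₗ[ℚ] M)

@[simp] theorem ofWords_word {M : Type*} [AddCommGroup M] [Module ℚ M] (f : Word → M)
    (w : Word) : ofWords f (word w) = f w := by
  have h := Finsupp.linearCombination_single ℚ (v := f) (1 : ℚ) w
  rw [one_smul] at h
  exact h

theorem hom_ext {M : Type*} [AddCommGroup M] [Module ℚ M] {f g : QA →ₗ[ℚ] M}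
    (h : ∀ w, f (word w) = g (word w)) : f = g :=
  Finsupp.lhom_ext' fun w => LinearMap.ext_ring (h w)

/-- Left concatenation with a letter: `w ↦ a w`. -/
noncomputable def cons (a : Letter) : QA →ₗ[ℚ] QA := ofWords fun w => word (a :: w)

@[simp] theorem cons_word (a : Letter) (w : Word) : cons a (word w) = word (a :: w) :=
  ofWords_word _ _

/-- The stuffle product of two words. -/
noncomputable def stuffle : Word → Word → QA
  | [], v => word v
  | a :: w, [] => word (a :: w)
  | a :: w, b :: v =>
      cons a (stuffle w (b :: v)) + cons b (stuffle (a :: w) v) + cons (a + b) (stuffle w v)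
termination_by w v => w.length + v.length

/-- The bilinear extension of the stuffle product. -/
noncomputable def stuffleMul : QA →ₗ[ℚ] QA →ₗ[ℚ] QA :=
  ofWords fun w => ofWords fun v => stuffle w v

@[simp] theorem stuffleMul_word (w v : Word) :
    stuffleMul (word w) (word v) = stuffle w v := by
  simp [stuffleMul]

theorem stuffleMul_one_left (x : QA) : stuffleMul (word []) x = x := by
  have : stuffleMul (word []) = LinearMap.id := hom_ext fun w => by simp [stuffle]
  rw [this]; rfl

theorem stuffle_nil_right (w : Word) : stuffle w [] = word w := by
  cases w <;> simp [stuffle]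

theorem stuffle_comm (w v : Word) : stuffle w v = stuffle v w := by
  induction h : w.length + v.length using Nat.strong_induction_on generalizing w v with
  | _ n ih =>
    match w, v with
    | [], v => rw [stuffle_nil_right]; simp [stuffle]
    | a :: w, [] => simp [stuffle]
    | a :: w, b :: v =>
      simp only [List.length_cons] at h
      rw [stuffle, stuffle, ih _ (by simp; omega) w (b :: v) rfl,
        ih _ (by simp; omega) (a :: w) v rfl, ih _ (by omega) w v rfl, add_comm a b]
      abel

theorem stuffleMul_comm (x y : QA) : stuffleMul x y = stuffleMul y x := by
  have : stuffleMul = stuffleMul.flip := hom_ext fun w => hom_ext fun v => by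
    simp [stuffle_comm w v]
  conv_lhs => rw [this]
  rfl

theorem stuffleMul_cons (a b : Letter) (x y : QA) :
    stuffleMul (cons a x) (cons b y) = cons a (stuffleMul x (cons b y)) +
      cons b (stuffleMul (cons a x) y) + cons (a + b) (stuffleMul x y) := by
  have : stuffleMul.compl₁₂ (cons a) (cons b) =
      (stuffleMul.compl₁₂ LinearMap.id (cons b)).compr₂ (cons a) +
      (stuffleMul.compl₁₂ (cons a) LinearMap.id).compr₂ (cons b) +
      stuffleMul.compr₂ (cons (a + b)) := hom_ext fun w => hom_ext fun v => by
    simp [stuffle]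
  exact LinearMap.congr_fun (LinearMap.congr_fun this x) y

theorem stuffle_assoc (u v w : Word) :
    stuffleMul (stuffle u v) (word w) = stuffleMul (word u) (stuffle v w) := by
  induction h : u.length + v.length + w.length using Nat.strong_induction_on
    generalizing u v w with
  | _ n ih =>
    match u, v, w with
    | [], v, w => simp [stuffle, stuffleMul_one_left]
    | a :: u, [], w => simp [stuffle]
    | a :: u, b :: v, [] =>
      rw [stuffle_nil_right, stuffleMul_comm, stuffleMul_one_left, stuffleMul_word]
    | a :: u, b :: v, c :: w =>
      simp only [List.length_cons] at h
      have h1 := ih _ (by simp; omega) u (b :: v) (c :: w) rfl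
      have h2 := ih _ (by simp; omega) (a :: u) v (c :: w) rfl
      have h3 := ih _ (by simp; omega) u v (c :: w) rfl
      have h4 := ih _ (by simp; omega) (a :: u) (b :: v) w rfl
      have h5 := ih _ (by simp; omega) u (b :: v) w rfl
      have h6 := ih _ (by simp; omega) (a :: u) v w rfl
      have h7 := ih _ (by omega) u v w rfl
      simp only [← cons_word, ← stuffleMul_word] at h1 h2 h3 h4 h5 h6 h7 ⊢
      rw [stuffleMul_cons b c] at h1
      rw [stuffleMul_cons a b] at h4
      simp only [map_add, LinearMap.add_apply] at h1 h4
      rw [stuffleMul_cons a b, stuffleMul_cons b c]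
      simp only [map_add, LinearMap.add_apply, stuffleMul_cons]
      rw [h1, h2, h3, h5, h6, h7, ← add_assoc a b c]
      have h4' := congrArg (cons c) h4
      simp only [map_add] at h4'
      simp only [map_add]
      rw [← h4']
      abel

theorem stuffleMul_assoc (x y z : QA) :
    stuffleMul (stuffleMul x y) z = stuffleMul x (stuffleMul y z) := by
  have : stuffleMul.compr₂ stuffleMul =
      ((LinearMap.llcomp ℚ QA QA QA).comp stuffleMul).compl₂ stuffleMul :=
    hom_ext fun u => hom_ext fun v => hom_ext fun w => by
      simpa using stuffle_assoc u v w
  exact LinearMap.congr_fun (LinearMap.congr_fun (LinearMap.congr_fun this x) y) z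

noncomputable instance : CommRing QA :=
  { (inferInstance : AddCommGroup QA) with
    mul := fun x y => stuffleMul x y
    one := word []
    left_distrib := fun x y z => map_add (stuffleMul x) y z
    right_distrib := fun x y z => by
      change stuffleMul (x + y) z = stuffleMul x z + stuffleMul y z
      rw [map_add, LinearMap.add_apply]
    zero_mul := fun x => by
      change stuffleMul 0 x = 0
      rw [map_zero, LinearMap.zero_apply]
    mul_zero := fun x => map_zero (stuffleMul x)
    one_mul := stuffleMul_one_left
    mul_one := fun x => (stuffleMul_comm x (word [])).trans (stuffleMul_one_left x)
    mul_comm := stuffleMul_comm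
    mul_assoc := stuffleMul_assoc }

noncomputable instance : Algebra ℚ QA :=
  Algebra.ofModule
    (fun r x y => by
      change stuffleMul (r • x) y = r • stuffleMul x y
      rw [map_smul, LinearMap.smul_apply])
    (fun r x y => map_smul (stuffleMul x) r y)

theorem word_mul_word (w v : Word) : word w * word v = stuffle w v := stuffleMul_word w v

theorem word_nil : word [] = 1 := rfl

end QA

open QA

/-! ### The swap -/

/-- The generating series `𝔄_r`: the coefficient at
`X₁^(k₁-1) ⋯ X_r^(k_r-1) Y₁^d₁ ⋯ Y_r^d_r` is the word `(k₁,d₁) ⋯ (k_r,d_r)` divided by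
`d₁! ⋯ d_r!`. The variables are `X_i = X (Sum.inl i)` and `Y_i = X (Sum.inr i)`. -/
noncomputable def genSeries (r : ℕ) : MvPowerSeries (Fin r ⊕ Fin r) QA := fun e =>
  (∏ i, ((e (Sum.inr i)).factorial : ℚ))⁻¹ •
    word (List.ofFn fun i => ((e (Sum.inl i)).succPNat, e (Sum.inr i)))

/-- The substitution `(X₁, …, X_r; Y₁, …, Y_r) ↦
(Y₁ + ⋯ + Y_r, …, Y₁ + Y₂, Y₁; X_r, X_{r-1} - X_r, …, X₁ - X₂)`. -/
noncomputable def swapVars (r : ℕ) : Fin r ⊕ Fin r → MvPowerSeries (Fin r ⊕ Fin r) QA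
  | Sum.inl i => ∑ j ∈ Finset.univ.filter (fun j => j ≤ i.rev), MvPowerSeries.X (Sum.inr j)
  | Sum.inr i => MvPowerSeries.X (Sum.inl i.rev) -
      if h : (i.rev : ℕ) + 1 < r then MvPowerSeries.X (Sum.inl ⟨(i.rev : ℕ) + 1, h⟩) else 0

theorem hasSubst_swapVars (r : ℕ) : MvPowerSeries.HasSubst (swapVars r) := by
  refine MvPowerSeries.hasSubst_of_constantCoeff_zero ?_
  rintro (i | i)
  · simp [swapVars]
  · simp only [swapVars]
    split_ifs <;> simp

/-- The exponent of the monomial `X₁^(k₁-1) ⋯ X_r^(k_r-1) Y₁^d₁ ⋯ Y_r^d_r` that belongs to the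
word `(k₁,d₁) ⋯ (k_r,d_r)`. -/
noncomputable def wordExponent (w : Word) : Fin w.length ⊕ Fin w.length →₀ ℕ :=
  Finsupp.equivFunOnFinite.symm
    (Sum.elim (fun i => (w.get i).1.natPred) (fun i => (w.get i).2))

/-- The swap of the word `w = (k₁,d₁) ⋯ (k_r,d_r)`: the coefficient of
`X₁^(k₁-1) ⋯ X_r^(k_r-1) (Y₁^d₁/d₁!) ⋯ (Y_r^d_r/d_r!)` in the swapped series `𝔄_r`. -/
noncomputable def swapWord (w : Word) : QA :=
  (∏ i, ((w.get i).2.factorial : ℚ)) •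
    MvPowerSeries.coeff (wordExponent w)
      (MvPowerSeries.subst (swapVars w.length) (genSeries w.length))

/-- The swap `σ : ℚ⟨𝒜⟩ → ℚ⟨𝒜⟩`. -/
noncomputable def swap : QA →ₗ[ℚ] QA := ofWords swapWord

/-! ### Formal multiple Eisenstein series and formal multiple zeta values -/

/-- The ideal of `(ℚ⟨𝒜⟩, *)` generated by all `σ(x) - x`. -/
noncomputable def swapIdeal : Ideal QA := Ideal.span (Set.range fun x : QA => swap x - x)

/-- The algebra of formal multiple Eisenstein series. -/
abbrev FMES : Type := QA ⧸ swapIdeal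

/-- The class in `FMES` of an element of `ℚ⟨𝒜⟩`. -/
noncomputable def cls : QA →ₐ[ℚ] FMES := Ideal.Quotient.mkₐ ℚ swapIdeal

/-- The formal multiple Eisenstein series of a word. -/
noncomputable def G (w : Word) : FMES := cls (word w)

/-- The formal Eisenstein series `G(k)`, the class of the one-letter word `(k, 0)`. -/
noncomputable def eisG (k : ℕ+) : FMES := G [(k, 0)]

/-- The normalised formal Eisenstein series `- (2 k! / B_k) G(k)` (used for even `k`). -/
noncomputable def eis (k : ℕ+) : FMES :=
  (-(2 * ((k : ℕ).factorial : ℚ)) / bernoulli (k : ℕ)) • eisG k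

/-- The weight `k₁ + ⋯ + k_r + d₁ + ⋯ + d_r` of a word. -/
def wt (w : Word) : ℕ := (w.map fun a => (a.1 : ℕ) + a.2).sum

/-- The subspace of `FMES` spanned by the `G(w)` with `w` of weight `k`. -/
noncomputable def weightSpace (k : ℕ) : Submodule ℚ FMES :=
  Submodule.span ℚ {x | ∃ w : Word, wt w = k ∧ G w = x}

/-- Words of the form `(1,d₁) ⋯ (1,d_s) (k₁,0) ⋯ (k_r,0)` with `r, s ≥ 0`. -/
def IsSplitWord (w : Word) : Prop :=
  ∃ u v : Word, w = u ++ v ∧ (∀ a ∈ u, a.1 = 1) ∧ ∀ a ∈ v, a.2 = 0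

/-- The ideal `𝔑` of `FMES` generated by the classes of all words that are not of the form
`(1,d₁) ⋯ (1,d_s) (k₁,0) ⋯ (k_r,0)`. -/
noncomputable def idealN : Ideal FMES := Ideal.span {x | ∃ w : Word, ¬ IsSplitWord w ∧ G w = x}

/-- The algebra of formal multiple zeta values. -/
abbrev FMZV : Type := FMES ⧸ idealN

/-- The projection `π` onto the formal multiple zeta values. -/
noncomputable def proj : FMES →ₐ[ℚ] FMZV := Ideal.Quotient.mkₐ ℚ idealN

/-! ### The operators `D`, `W`, `δ` on words -/

/-- The sum of `u · ρ(v)` over all splittings `w = u v` with `v` non-empty. -/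
noncomputable def splitSum (ρ : Word → QA) : Word → QA
  | [] => 0
  | a :: v => ρ (a :: v) + cons a (splitSum ρ v)

/-- `D` on words: the sum over `j` of `k_j` times the word with its `j`-th letter `(k_j, d_j)`
replaced by `(k_j + 1, d_j + 1)`. -/
noncomputable def wordD : Word → QA :=
  splitSum fun
    | (k, d) :: v => ((k : ℕ) : ℚ) • word ((k + 1, d + 1) :: v)
    | [] => 0

/-- `W` on words: multiplication by the weight. -/
noncomputable def wordW (w : Word) : QA := (wt w : ℚ) • word w

/-- The component `δ¹` of `δ`. -/
noncomputable def wordDelta1 (w : Word) : QA :=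
  splitSum (fun
    | (k, d) :: v => if 1 < k then (d : ℚ) • word ((k - 1, d - 1) :: v) else 0
    | [] => 0) w
  - (1 / 2 : ℚ) • splitSum (fun
    | (k, d) :: (l, e) :: v => if l = 1 then (e : ℚ) • word ((k, d + e - 1) :: v) else 0
    | _ => 0) w
  - (1 / 2 : ℚ) • splitSum (fun
    | (k, d) :: (l, e) :: v => if k = 1 then (d : ℚ) • word ((l, d + e - 1) :: v) else 0
    | _ => 0) w

/-- The component `δ²` of `δ`: removes a final `(2,0)`, or a final `(1,0)(1,0)`. -/
noncomputable def wordDelta2 (w : Word) : QA :=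
  splitSum (fun v => if v = [(2, 0)] then word [] else 0) w
  - (1 / 2 : ℚ) • splitSum (fun v => if v = [(1, 0), (1, 0)] then word [] else 0) w

/-- The component `δ³` of `δ`: removes a final `(1,1)`. -/
noncomputable def wordDelta3 (w : Word) : QA :=
  splitSum (fun v => if v = [(1, 1)] then word [] else 0) w

/-- The component `δ⁴` of `δ`. -/
noncomputable def wordDelta4 (w : Word) : QA :=
  splitSum (fun
    | (k, d) :: (l, e) :: v => if l = 1 ∧ 1 < k then word ((k - 1, d + e) :: v) else 0
    | _ => 0) w
  - splitSum (fun
    | (k, d) :: (l, e) :: v => if k = 1 ∧ 1 < l then word ((l - 1, d + e) :: v) else 0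
    | _ => 0) w

/-- The component `δ⁵` of `δ`. -/
noncomputable def wordDelta5 (w : Word) : QA :=
  splitSum (fun
    | (k, d) :: (l, e) :: v => if k = 2 then word ((l, d + e) :: v) else 0
    | _ => 0) w
  - splitSum (fun
    | (k, d) :: (l, e) :: v => if l = 2 then word ((k, d + e) :: v) else 0
    | _ => 0) w
  + (1 / 2 : ℚ) • splitSum (fun
    | (k, d) :: (l, e) :: (m, f) :: v =>
        if l = 1 ∧ m = 1 then word ((k, d + e + f) :: v) else 0
    | _ => 0) w
  - (1 / 2 : ℚ) • splitSum (fun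
    | (k, d) :: (l, e) :: (m, f) :: v =>
        if k = 1 ∧ l = 1 then word ((m, d + e + f) :: v) else 0
    | _ => 0) w

/-- `δ = δ¹ - (δ² + δ³ + δ⁴ + δ⁵) / 2` on words. -/
noncomputable def wordDelta (w : Word) : QA :=
  wordDelta1 w - (1 / 2 : ℚ) • (wordDelta2 w + wordDelta3 w + wordDelta4 w + wordDelta5 w)

/-- `Θ` is the derivation of `FMES` that is given on the generators `G(w)` by the class of `θ(w)`.
There is at most one such `Θ`, because the `G(w)` span `FMES`. -/
def IsInducedBy (Θ : Derivation ℚ FMES FMES) (θ : Word → QA) : Prop :=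
  ∀ w : Word, Θ (G w) = cls (θ w)

theorem IsInducedBy.unique {Θ Θ' : Derivation ℚ FMES FMES} {θ : Word → QA}
    (h : IsInducedBy Θ θ) (h' : IsInducedBy Θ' θ) : Θ = Θ' := by
  have key : (Θ : FMES →ₗ[ℚ] FMES).comp cls.toLinearMap =
      (Θ' : FMES →ₗ[ℚ] FMES).comp cls.toLinearMap :=
    hom_ext fun w => (h w).trans (h' w).symm
  ext x
  obtain ⟨y, rfl⟩ := Ideal.Quotient.mk_surjective x
  exact LinearMap.congr_fun key y

/-! ### Formal quasimodular, modular and cusp forms -/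

section Forms

variable (D W δ : Derivation ℚ FMES FMES)

/-- Formal quasimodular forms: the smallest subalgebra of `FMES` that contains `G(2)` and is
stable under `D`, `W` and `δ`. -/
noncomputable def quasimodularForms : Subalgebra ℚ FMES :=
  sInf {S | eisG 2 ∈ S ∧ ∀ x ∈ S, D x ∈ S ∧ W x ∈ S ∧ δ x ∈ S}

/-- Formal modular forms: the kernel of `δ` on the formal quasimodular forms. -/
noncomputable def modularForms : Submodule ℚ FMES :=
  (quasimodularForms D W δ).toSubmodule ⊓ LinearMap.ker (δ : FMES →ₗ[ℚ] FMES)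

/-- Formal cusp forms: the kernel of `π` on the formal modular forms. -/
noncomputable def cuspForms : Submodule ℚ FMES :=
  modularForms D W δ ⊓ LinearMap.ker proj.toLinearMap

/-- Formal modular forms of weight `k`. -/
noncomputable def modularFormsOfWeight (k : ℕ) : Submodule ℚ FMES :=
  modularForms D W δ ⊓ weightSpace k

/-- Formal cusp forms of weight `k`. -/
noncomputable def cuspFormsOfWeight (k : ℕ) : Submodule ℚ FMES :=
  cuspForms D W δ ⊓ weightSpace k

end Forms

/-- `Δ = (e(4)³ - e(6)²) / 1728`. -/
noncomputable def formalDelta : FMES := (1 / 1728 : ℚ) • (eis 4 ^ 3 - eis 6 ^ 2)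

end FormalMES

open scoped TensorProduct
namespace FormalMES
open QA

/-! ### Local derivations of the stuffle algebra -/

/-! The proof has three independent ingredients: the operators descend to the quotient, explicit
relations hold between the `G(k)`, and the projection of `G(2)` is not nilpotent.

Descent. With deconcatenation the stuffle algebra is a bialgebra, and an operator that replaces
short blocks of adjacent letters is a derivation as soon as its local part satisfies a Leibniz rule
on letters (`leibniz_of_head`, `headOp_cons_mul_cons`, `deltaLetters_leibniz`). The terms of `δ`
that delete a final block are a derivation for a different reason: they come from a functional that
kills products (`tailOp_mul`). For the swap, the generating series is evaluated at rational points
and parametrised by the `X_j` and the partial sums `S_j` of the `Y_j`. In these coordinates the swap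
reverses the list of points and exchanges the two coordinates (`swap_genCoeff`), and the formula for
`δ` is visibly symmetric (`deltaSum_revSwap`). Dually, evaluating letters at points `(u, v)` turns
the swap into conjugation of partitions (`evalAt_swap`). `W` is homogeneous in this picture, and `D`
becomes multiplication by the conjugation-invariant size `∑ u v`.

Relations. In depth two, the stuffle product and its swapped version each express a sum of two
values of the double series by products and single series. Three relations of each kind contain the
same six double values, so these cancel (`prodPoly_relation`). One specialisation gives a
Ramanujan-type formula for `D G(2m+2)` (`derivation_evenEis`), a second one gives `G(8) = (6/7)
G(4)²` (`evenEis_three`). Hence the quasimodular forms are generated as an algebra by the even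
`G(k)`, and `D Δ = e(2) Δ` is Ramanujan's computation.

Nonvanishing. The words that occur in `D G(k)` for `k ≥ 2` lie in the ideal `𝔑`, so the formula for
`D` becomes a recursion with positive coefficients, and `π G(2m+2)` is a positive multiple of
`π(G(2))^(m+1)`. That no power of `π(G(2))` vanishes is shown analytically. At `q = exp(-1/n)` there
are two families of nested sums: `chi`, multiplicative for the stuffle product, and `phi`, a sum
over partitions and therefore swap invariant by conjugation. They differ by `O(log(5n)^m / n)`, both
grow at most like powers of the logarithm, and `chi` is also `O(log(5n)^m / n)` on every word that
generates `𝔑`. So the preimage of `𝔑` consists of elements on which `chi` tends to zero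
(`mem_negligibleIdeal_of_cls_mem`), while `chi` of the word `(2,0)` stays above `exp(-2)`.

Conclusion. A quasimodular form of weight `k = 2m` has projection in the line spanned by
`π(G(2))^m`. For `k ≥ 4` this line is spanned by `π(G(k))`, and `G(k)` is killed by `δ`. Subtracting
a multiple of `G(k)` from a modular form therefore leaves a cusp form, and no nonzero multiple of
`G(k)` is one. -/

theorem QA.induction_word {P : QA → Prop} (x : QA) (hw : ∀ w, P (word w)) (h0 : P 0)
    (hadd : ∀ x y, P x → P y → P (x + y)) (hsmul : ∀ (c : ℚ) x, P x → P (c • x)) : P x := by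
  induction x using Finsupp.induction_linear with
  | zero => exact h0
  | add f g hf hg => exact hadd f g hf hg
  | single w c =>
    have : (Finsupp.single w c : Word →₀ ℚ) = c • (Finsupp.single w 1 : Word →₀ ℚ) := by
      simp
    rw [this]
    exact hsmul c _ (hw w)

theorem cons_mul_cons (a b : Letter) (x y : QA) :
    cons a x * cons b y = cons a (x * cons b y) + cons b (cons a x * y) + cons (a + b) (x * y) :=
  stuffleMul_cons a b x y

/-- Two linear maps agree as soon as they agree on `1` and on all `cons a (word w)`. -/
theorem hom_ext_cons {M : Type*} [AddCommGroup M] [Module ℚ M] {f g : QA →ₗ[ℚ] M}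
    (h1 : f 1 = g 1) (h : ∀ a w, f (cons a (word w)) = g (cons a (word w))) : f = g :=
  hom_ext fun w => by
    match w with
    | [] => exact h1
    | a :: w => simpa using h a w

/-- Linear combinations of letters; the product is the bilinear extension of `⋄`. -/
abbrev LetterAlg : Type := AddMonoidAlgebra ℚ Letter

/-- Left concatenation with a linear combination of letters. -/
noncomputable def lconc : LetterAlg →ₗ[ℚ] QA →ₗ[ℚ] QA :=
  Finsupp.linearCombination ℚ cons ∘ₗ (AddMonoidAlgebra.coeffLinearEquiv ℚ).toLinearMap

/-- A letter as an element of `LetterAlg`. -/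
noncomputable def letter (a : Letter) : LetterAlg := AddMonoidAlgebra.single a 1

@[simp] theorem lconc_letter (a : Letter) : lconc (letter a) = cons a := by
  simp [lconc, letter]

theorem letter_mul (a b : Letter) : letter a * letter b = letter (a + b) := by
  simp [letter, AddMonoidAlgebra.single_mul_single]

theorem LetterAlg.hom_ext {M : Type*} [AddCommGroup M] [Module ℚ M] {f g : LetterAlg →ₗ[ℚ] M}
    (h : ∀ a, f (letter a) = g (letter a)) : f = g :=
  AddMonoidAlgebra.lhom_ext' fun a => LinearMap.ext_ring (h a)

theorem LetterAlg.mul_comm (x y : LetterAlg) : x * y = y * x := by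
  have : LinearMap.mul ℚ LetterAlg = (LinearMap.mul ℚ LetterAlg).flip :=
    LetterAlg.hom_ext fun a => LetterAlg.hom_ext fun b => by
      simp [letter_mul]
  exact LinearMap.congr_fun (LinearMap.congr_fun this x) y

theorem lconc_mul_cons (l : LetterAlg) (b : Letter) (x y : QA) :
    lconc l x * cons b y = lconc l (x * cons b y) + cons b (lconc l x * y) +
      lconc (l * letter b) (x * y) := by
  have : ((LinearMap.mul ℚ QA).flip (cons b y)).comp (lconc.flip x) =
      lconc.flip (x * cons b y) + (cons b).comp (((LinearMap.mul ℚ QA).flip y).comp (lconc.flip x))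
      + (lconc.flip (x * y)).comp ((LinearMap.mul ℚ LetterAlg).flip (letter b)) :=
    LetterAlg.hom_ext fun a => by
      simp only [LinearMap.add_apply, LinearMap.comp_apply, LinearMap.flip_apply,
        LinearMap.mul_apply', lconc_letter, letter_mul, cons_mul_cons]
  exact LinearMap.congr_fun this l

/-- The coefficient of the empty word. -/
noncomputable def counit : QA →ₗ[ℚ] ℚ := ofWords fun w => if w = [] then 1 else 0

@[simp] theorem counit_one : counit 1 = 1 := by
  rw [← word_nil, counit, ofWords_word]; simp

@[simp] theorem counit_cons (a : Letter) (x : QA) : counit (cons a x) = 0 := by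
  have : counit.comp (cons a) = 0 := hom_ext fun w => by simp [counit]
  exact LinearMap.congr_fun this x

@[simp] theorem counit_word_cons (a : Letter) (w : Word) : counit (word (a :: w)) = 0 := by
  rw [← cons_word, counit_cons]

/-- The component of word length one. -/
noncomputable def letterPart : QA →ₗ[ℚ] LetterAlg := ofWords fun
  | [a] => letter a
  | _ => 0

@[simp] theorem letterPart_one : letterPart 1 = 0 := by
  rw [← word_nil, letterPart, ofWords_word]

@[simp] theorem letterPart_cons (a : Letter) (x : QA) :
    letterPart (cons a x) = counit x • letter a := by
  have : letterPart.comp (cons a) = counit.smulRight (letter a) := hom_ext fun w => by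
    cases w <;> simp [counit, letterPart]
  exact LinearMap.congr_fun this x

/-- Auxiliary recursion for the deconcatenation coproduct. -/
noncomputable def deconcWord : Word → QA ⊗[ℚ] QA
  | [] => 1 ⊗ₜ 1
  | a :: w => 1 ⊗ₜ word (a :: w) + (cons a).rTensor QA (deconcWord w)

/-- The deconcatenation coproduct. -/
noncomputable def deconc : QA →ₗ[ℚ] QA ⊗[ℚ] QA := ofWords deconcWord

theorem deconc_one : deconc 1 = 1 := by
  rw [← word_nil, deconc, ofWords_word, deconcWord]; rfl

theorem deconc_cons (a : Letter) (x : QA) :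
    deconc (cons a x) = 1 ⊗ₜ cons a x + (cons a).rTensor QA (deconc x) := by
  have : deconc.comp (cons a) = (TensorProduct.mk ℚ QA QA 1).comp (cons a) +
      ((cons a).rTensor QA).comp deconc := hom_ext fun w => by
    simp [deconc, deconcWord]
  exact LinearMap.congr_fun this x

/-- Extensionality for maps that are bilinear on `QA ⊗ QA`. -/
theorem tensor_ext₂ {M : Type*} [AddCommGroup M] [Module ℚ M]
    {f g : QA ⊗[ℚ] QA →ₗ[ℚ] QA ⊗[ℚ] QA →ₗ[ℚ] M}
    (h : ∀ x x' y y' : QA, f (x ⊗ₜ x') (y ⊗ₜ y') = g (x ⊗ₜ x') (y ⊗ₜ y')) (s t : QA ⊗[ℚ] QA) :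
    f s t = g s t := by
  have : f = g := TensorProduct.ext' fun x x' => TensorProduct.ext' fun y y' => h x x' y y'
  rw [this]

theorem rTensor_cons_mul_rTensor_cons (a b : Letter) (s t : QA ⊗[ℚ] QA) :
    (cons a).rTensor QA s * (cons b).rTensor QA t =
      (cons a).rTensor QA (s * (cons b).rTensor QA t) +
      (cons b).rTensor QA ((cons a).rTensor QA s * t) +
      (cons (a + b)).rTensor QA (s * t) := by
  let m := LinearMap.mul ℚ (QA ⊗[ℚ] QA)
  refine tensor_ext₂ (f := m.compl₁₂ ((cons a).rTensor QA) ((cons b).rTensor QA))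
    (g := (m.compl₂ ((cons b).rTensor QA)).compr₂ ((cons a).rTensor QA) +
      (m.comp ((cons a).rTensor QA)).compr₂ ((cons b).rTensor QA) +
      m.compr₂ ((cons (a + b)).rTensor QA)) ?_ s t
  intro x x' y y'
  simp [m, cons_mul_cons, TensorProduct.add_tmul]

theorem rTensor_cons_mul_tmul (a : Letter) (s : QA ⊗[ℚ] QA) (y : QA) :
    (cons a).rTensor QA s * (1 ⊗ₜ[ℚ] y) = (cons a).rTensor QA (s * (1 ⊗ₜ[ℚ] y)) := by
  induction s using TensorProduct.induction_on with
  | zero => simp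
  | tmul x x' => simp
  | add s t hs ht => simp only [map_add, add_mul, hs, ht]

theorem word_cons_mul_word_cons (a b : Letter) (w v : Word) :
    word (a :: w) * word (b :: v) = cons a (word w * word (b :: v)) +
      cons b (word (a :: w) * word v) + cons (a + b) (word w * word v) := by
  simp only [← cons_word, cons_mul_cons]

/-- Both sides expand by `deconc (a w) = 1 ⊗ a w + a · deconc w`. The terms with nontrivial left
factor sort by its first letter, which is `a`, `b` or `a + b`, exactly as in the stuffle recursion.
Induction is on the total length. -/
theorem deconc_word_mul_word (w v : Word) :
    deconc (word w * word v) = deconc (word w) * deconc (word v) := by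
  induction h : w.length + v.length using Nat.strong_induction_on generalizing w v with
  | _ n ih =>
    match w, v with
    | [], v => rw [word_nil, deconc_one, one_mul, one_mul]
    | a :: w, [] => rw [word_nil, deconc_one, mul_one, mul_one]
    | a :: w, b :: v =>
      simp only [List.length_cons] at h
      have h1 := ih _ (by simp; omega) w (b :: v) rfl
      have h2 := ih _ (by simp; omega) (a :: w) v rfl
      have h3 := ih _ (by omega) w v rfl
      rw [word_cons_mul_word_cons]
      simp only [map_add, deconc_cons, h1, h2, h3]
      rw [← cons_word a w, ← cons_word b v]
      simp only [deconc_cons]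
      simp only [add_mul, mul_add, Algebra.TensorProduct.tmul_mul_tmul, one_mul,
        rTensor_cons_mul_rTensor_cons, cons_mul_cons, TensorProduct.tmul_add, map_add,
        rTensor_cons_mul_tmul]
      rw [mul_comm (1 ⊗ₜ[ℚ] cons a (word w)) ((cons b).rTensor QA (deconc (word v))),
        rTensor_cons_mul_tmul, mul_comm (deconc (word v))]
      abel

theorem mul_ext₂ {M : Type*} [AddCommGroup M] [Module ℚ M] {f g : QA →ₗ[ℚ] QA →ₗ[ℚ] M}
    (h : ∀ w v, f (word w) (word v) = g (word w) (word v)) (x y : QA) : f x y = g x y := by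
  have : f = g := QA.hom_ext fun w => QA.hom_ext fun v => h w v
  rw [this]

theorem deconc_mul (x y : QA) : deconc (x * y) = deconc x * deconc y :=
  mul_ext₂ (f := (LinearMap.mul ℚ QA).compr₂ deconc)
    (g := (LinearMap.mul ℚ (QA ⊗[ℚ] QA)).compl₁₂ deconc deconc)
    (fun w v => deconc_word_mul_word w v) x y

/-- `∑ p(w₁) w₂` over the deconcatenations of `w`. -/
noncomputable def headOp (p : QA →ₗ[ℚ] LetterAlg) : QA →ₗ[ℚ] QA :=
  (TensorProduct.lift (lconc.comp p)).comp deconc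

/-- `p` satisfies the Leibniz rule in lengths at most one. -/
def IsLocalLeibniz (p : QA →ₗ[ℚ] LetterAlg) : Prop :=
  ∀ w v : Word, w ≠ [] → v ≠ [] → p (word w * word v) =
    p (word w) * letterPart (word v) + letterPart (word w) * p (word v)

/-- The counit terms account for an empty factor, on which the Leibniz rule for nonempty words says
nothing. -/
theorem IsLocalLeibniz.mul {p : QA →ₗ[ℚ] LetterAlg} (h1 : p 1 = 0) (hp : IsLocalLeibniz p)
    (x y : QA) : p (x * y) = p x * letterPart y + letterPart x * p y + counit y • p x +
      counit x • p y := by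
  have := mul_ext₂ (f := (LinearMap.mul ℚ QA).compr₂ p)
    (g := (LinearMap.mul ℚ LetterAlg).compl₁₂ p letterPart +
      (LinearMap.mul ℚ LetterAlg).compl₁₂ letterPart p +
      (LinearMap.lsmul ℚ LetterAlg).flip.compl₁₂ p counit +
      (LinearMap.lsmul ℚ LetterAlg).compl₁₂ counit p) ?_ x y
  · simpa using this
  intro w v
  match w, v with
  | [], v => simp [word_nil, h1]
  | a :: w, [] => simp [word_nil, h1]
  | a :: w, b :: v =>
    have := hp (a :: w) (b :: v) (by simp) (by simp)
    simp [this]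

theorem counit_tensor_deconc (x : QA) :
    TensorProduct.lift ((LinearMap.lsmul ℚ QA).comp counit) (deconc x) = x := by
  have : (TensorProduct.lift ((LinearMap.lsmul ℚ QA).comp counit)).comp deconc =
      LinearMap.id := hom_ext_cons (by simp [deconc_one, Algebra.TensorProduct.one_def])
    fun a w => by
      have h : (TensorProduct.lift ((LinearMap.lsmul ℚ QA).comp counit)).comp
          ((cons a).rTensor QA) = 0 := TensorProduct.ext' fun x y => by simp
      have := LinearMap.congr_fun h (deconc (word w))
      simp only [LinearMap.comp_apply] at this
      rw [LinearMap.comp_apply, deconc_cons, map_add, this]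
      simp
  exact LinearMap.congr_fun this x

theorem tensor_counit_deconc (x : QA) :
    TensorProduct.lift ((LinearMap.lsmul ℚ QA).flip.compl₂ counit) (deconc x) = x := by
  have : (TensorProduct.lift ((LinearMap.lsmul ℚ QA).flip.compl₂ counit)).comp deconc =
      LinearMap.id := hom_ext fun w => by
    induction w with
    | nil => simp [word_nil, deconc_one, Algebra.TensorProduct.one_def]
    | cons a w ih =>
      have h : (TensorProduct.lift ((LinearMap.lsmul ℚ QA).flip.compl₂ counit)).comp
          ((cons a).rTensor QA) =
          (cons a).comp (TensorProduct.lift ((LinearMap.lsmul ℚ QA).flip.compl₂ counit)) :=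
        TensorProduct.ext' fun x y => by simp
      have := LinearMap.congr_fun h (deconc (word w))
      simp only [LinearMap.comp_apply, LinearMap.id_apply] at this ih ⊢
      rw [← cons_word, deconc_cons, map_add, this, ih]
      simp
  exact LinearMap.congr_fun this x

/-- The part of `headOp p (x * cons b v)` in which `p` sees only letters of `x` and possibly `b`. -/
theorem headOp_half (p : QA →ₗ[ℚ] LetterAlg) (t : QA ⊗[ℚ] QA) (b : Letter) (v : QA) :
    TensorProduct.lift (lconc.comp p) (t * (1 ⊗ₜ cons b v)) +
      TensorProduct.lift (lconc.comp ((LinearMap.mul ℚ LetterAlg).flip (letter b) ∘ₗ p))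
        (t * (1 ⊗ₜ v)) =
    TensorProduct.lift (lconc.comp p) t * cons b v -
      cons b (TensorProduct.lift (lconc.comp p) t * v) := by
  induction t using TensorProduct.induction_on with
  | zero => simp
  | tmul x y =>
    simp only [Algebra.TensorProduct.tmul_mul_tmul, mul_one, TensorProduct.lift.tmul,
      LinearMap.comp_apply, lconc_mul_cons, LinearMap.flip_apply, LinearMap.mul_apply']
    abel
  | add s t hs ht =>
    simp only [add_mul, map_add]
    rw [add_add_add_comm, hs, ht]
    abel

/-- The componentwise product on `LetterAlg ⊗ QA`. -/
noncomputable def letterTensorMul :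
    LetterAlg ⊗[ℚ] QA →ₗ[ℚ] LetterAlg ⊗[ℚ] QA →ₗ[ℚ] LetterAlg ⊗[ℚ] QA :=
  TensorProduct.map₂ (LinearMap.mul ℚ LetterAlg) (LinearMap.mul ℚ QA)

/-- The four terms come from `IsLocalLeibniz.mul` on the left tensor factors. A counit means that
the other word contributes nothing to the replaced block, `letterPart` means that it contributes
exactly one letter. -/
theorem lift_mul_expand {p : QA →ₗ[ℚ] LetterAlg} (h1 : p 1 = 0) (hp : IsLocalLeibniz p)
    (s t : QA ⊗[ℚ] QA) :
    TensorProduct.lift (lconc.comp p) (s * t) =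
      TensorProduct.lift (lconc.comp p)
        (s * (1 ⊗ₜ TensorProduct.lift ((LinearMap.lsmul ℚ QA).comp counit) t)) +
      TensorProduct.lift (lconc.comp p)
        (t * (1 ⊗ₜ TensorProduct.lift ((LinearMap.lsmul ℚ QA).comp counit) s)) +
      TensorProduct.lift lconc (letterTensorMul (p.rTensor QA s) (letterPart.rTensor QA t)) +
      TensorProduct.lift lconc (letterTensorMul (letterPart.rTensor QA s) (p.rTensor QA t)) := by
  let m := LinearMap.mul ℚ (QA ⊗[ℚ] QA)
  let m' := letterTensorMul
  let ι : QA →ₗ[ℚ] QA ⊗[ℚ] QA := TensorProduct.mk ℚ QA QA 1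
  let c := TensorProduct.lift ((LinearMap.lsmul ℚ QA).comp counit)
  refine tensor_ext₂ (f := m.compr₂ (TensorProduct.lift (lconc.comp p)))
    (g := (m.compl₂ (ι ∘ₗ c)).compr₂ (TensorProduct.lift (lconc.comp p)) +
      ((m.compl₂ (ι ∘ₗ c)).compr₂ (TensorProduct.lift (lconc.comp p))).flip +
      (m'.compl₁₂ (p.rTensor QA) (letterPart.rTensor QA)).compr₂ (TensorProduct.lift lconc) +
      (m'.compl₁₂ (letterPart.rTensor QA) (p.rTensor QA)).compr₂ (TensorProduct.lift lconc))
    ?_ s t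
  intro x x' y y'
  simp [m, m', c, ι, hp.mul h1, letterTensorMul, mul_comm y' x']
  abel

theorem letterPart_rTensor_deconc_cons (b : Letter) (v : QA) :
    letterPart.rTensor QA (deconc (cons b v)) = letter b ⊗ₜ v := by
  have h : (letterPart.rTensor QA).comp ((cons b).rTensor QA) =
      (TensorProduct.mk ℚ LetterAlg QA (letter b)).comp
        (TensorProduct.lift ((LinearMap.lsmul ℚ QA).comp counit)) :=
    TensorProduct.ext' fun x y => by simp [TensorProduct.smul_tmul]
  have h2 := LinearMap.congr_fun h (deconc v)
  simp only [LinearMap.comp_apply, counit_tensor_deconc] at h2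
  rw [deconc_cons, map_add, h2]
  simp

theorem lift_rTensor_mul_letter (p : QA →ₗ[ℚ] LetterAlg) (s : QA ⊗[ℚ] QA) (b : Letter) (v : QA) :
    TensorProduct.lift lconc (letterTensorMul (p.rTensor QA s) (letter b ⊗ₜ v)) =
      TensorProduct.lift (lconc.comp ((LinearMap.mul ℚ LetterAlg).flip (letter b) ∘ₗ p))
        (s * (1 ⊗ₜ v)) := by
  induction s using TensorProduct.induction_on with
  | zero => simp
  | tmul x y =>
    simp only [letterTensorMul, LinearMap.rTensor_tmul, TensorProduct.map₂_apply_tmul,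
      TensorProduct.map_tmul,
      TensorProduct.lift.tmul, LinearMap.mul_apply', LinearMap.comp_apply, LinearMap.flip_apply,
      Algebra.TensorProduct.tmul_mul_tmul, mul_one]
  | add s t hs ht => simp only [add_mul, map_add, LinearMap.add_apply, hs, ht]

theorem letterTensorMul_comm (s t : LetterAlg ⊗[ℚ] QA) :
    letterTensorMul s t = letterTensorMul t s := by
  have : letterTensorMul = letterTensorMul.flip :=
    TensorProduct.ext' fun x x' => TensorProduct.ext' fun y y' => by
      simp [letterTensorMul, LetterAlg.mul_comm x y, mul_comm x' y']
  exact LinearMap.congr_fun (LinearMap.congr_fun this s) t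

/-- In a product, the replaced initial block stems from one of the two factors, possibly merged with
the first letter of the other. The difference on the right selects precisely the terms of `H(a w) *
b v` that do not begin with the unmerged letter `b`, and symmetrically for the other factor. -/
theorem headOp_cons_mul_cons {p : QA →ₗ[ℚ] LetterAlg} (h1 : p 1 = 0) (hp : IsLocalLeibniz p)
    (a b : Letter) (w v : QA) :
    headOp p (cons a w * cons b v) =
      headOp p (cons a w) * cons b v - cons b (headOp p (cons a w) * v) +
      (cons a w * headOp p (cons b v) - cons a (w * headOp p (cons b v))) := by
  have e1 := headOp_half p (deconc (cons a w)) b v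
  have e2 := headOp_half p (deconc (cons b v)) a w
  simp only [headOp, LinearMap.comp_apply] at *
  rw [deconc_mul, lift_mul_expand h1 hp, counit_tensor_deconc, counit_tensor_deconc,
    letterPart_rTensor_deconc_cons, letterPart_rTensor_deconc_cons, lift_rTensor_mul_letter,
    letterTensorMul_comm, lift_rTensor_mul_letter, mul_comm (cons a w), mul_comm w, ← e1, ← e2]
  abel

/-- A linear map `δ` with `δ(a w) = a δ(w) + H(a w)` is a derivation as soon as `H` has the
property established in `headOp_cons_mul_cons`. -/
theorem leibniz_of_head {δ H : QA →ₗ[ℚ] QA} (h1 : δ 1 = 0)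
    (hδ : ∀ a x, δ (cons a x) = cons a (δ x) + H (cons a x))
    (hH : ∀ a b w v, H (cons a w * cons b v) =
      H (cons a w) * cons b v - cons b (H (cons a w) * v) +
      (cons a w * H (cons b v) - cons a (w * H (cons b v)))) (x y : QA) :
    δ (x * y) = x * δ y + y * δ x := by
  suffices ∀ n, ∀ w v : Word, w.length + v.length = n →
      δ (word w * word v) = word w * δ (word v) + δ (word w) * word v by
    rw [mul_comm y]
    exact mul_ext₂ (f := (LinearMap.mul ℚ QA).compr₂ δ)
      (g := (LinearMap.mul ℚ QA).compl₂ δ + (LinearMap.mul ℚ QA).comp δ)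
      (fun w v => this _ w v rfl) x y
  intro n
  induction n using Nat.strong_induction_on with
  | _ n ih =>
    intro w v h
    match w, v with
    | [], v => simp [word_nil, h1]
    | a :: w, [] => simp [word_nil, h1]
    | a :: w, b :: v =>
      simp only [List.length_cons] at h
      have i1 := ih _ (by simp; omega) w (b :: v) rfl
      have i2 := ih _ (by simp; omega) (a :: w) v rfl
      have i3 := ih _ (by omega) w v rfl
      have hh := hH a b (word w) (word v)
      simp only [← cons_word] at i1 i2 ⊢
      have hh' := hh
      rw [cons_mul_cons] at hh' ⊢
      simp only [map_add, hδ, i1, i2, i3] at hh' ⊢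
      simp only [add_mul, mul_add, map_add, cons_mul_cons] at *
      -- Once all products are expanded by the stuffle recursion, the terms with a prefixed letter
      -- cancel by induction and only the identity for `H` remains.
      linear_combination (exp := 1) hh'

/-- `∑ E(w₂) w₁` over the deconcatenations of `w`. -/
noncomputable def tailOp (E : QA →ₗ[ℚ] ℚ) : QA →ₗ[ℚ] QA :=
  (TensorProduct.lift ((LinearMap.lsmul ℚ QA).flip.compl₂ E)).comp deconc

/-- Such an `E` is an infinitesimal character: `E (x y) = E x ε(y) + ε(x) E y`. Convolving the
identity with it gives a derivation, because deconcatenation is multiplicative and `ε` is its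
counit. -/
theorem tailOp_mul {E : QA →ₗ[ℚ] ℚ} (h1 : E 1 = 0)
    (hE : ∀ w v : Word, w ≠ [] → v ≠ [] → E (word w * word v) = 0) (x y : QA) :
    tailOp E (x * y) = x * tailOp E y + y * tailOp E x := by
  have hE' : ∀ x y, E (x * y) = E x * counit y + counit x * E y := fun x y => by
    have := mul_ext₂ (f := (LinearMap.mul ℚ QA).compr₂ E)
      (g := (LinearMap.mul ℚ ℚ).compl₁₂ E counit + (LinearMap.mul ℚ ℚ).compl₁₂ counit E) ?_ x y
    · simpa using this
    intro w v
    match w, v with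
    | [], v => simp [word_nil, h1]
    | a :: w, [] => simp [word_nil, h1]
    | a :: w, b :: v =>
      have := hE (a :: w) (b :: v) (by simp) (by simp)
      simp only [LinearMap.compr₂_apply, LinearMap.mul_apply', this]
      rw [← cons_word a w, ← cons_word b v]
      simp
  have key : ∀ s t : QA ⊗[ℚ] QA,
      TensorProduct.lift ((LinearMap.lsmul ℚ QA).flip.compl₂ E) (s * t) =
      TensorProduct.lift ((LinearMap.lsmul ℚ QA).flip.compl₂ counit) s *
        TensorProduct.lift ((LinearMap.lsmul ℚ QA).flip.compl₂ E) t +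
      TensorProduct.lift ((LinearMap.lsmul ℚ QA).flip.compl₂ counit) t *
        TensorProduct.lift ((LinearMap.lsmul ℚ QA).flip.compl₂ E) s := by
    intro s t
    let m := LinearMap.mul ℚ QA
    let e := TensorProduct.lift ((LinearMap.lsmul ℚ QA).flip.compl₂ E)
    let c := TensorProduct.lift ((LinearMap.lsmul ℚ QA).flip.compl₂ counit)
    refine tensor_ext₂ (f := (LinearMap.mul ℚ (QA ⊗[ℚ] QA)).compr₂ e)
      (g := m.compl₁₂ c e + (m.compl₁₂ c e).flip) ?_ s t
    intro x x' y y'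
    simp only [LinearMap.compr₂_apply, LinearMap.mul_apply', Algebra.TensorProduct.tmul_mul_tmul,
      TensorProduct.lift.tmul, LinearMap.compl₂_apply, LinearMap.flip_apply,
      LinearMap.lsmul_apply, LinearMap.add_apply, LinearMap.compl₁₂_apply, hE', m, e, c]
    simp only [Algebra.smul_mul_assoc, Algebra.mul_smul_comm, smul_smul, add_smul, mul_comm y x]
    rw [add_comm, mul_comm (counit x')]
  simp only [tailOp, LinearMap.comp_apply, deconc_mul, key, tensor_counit_deconc]


/-! ### The derivations `D`, `W`, `δ` of the stuffle algebra -/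

theorem headOp_cons (p : QA →ₗ[ℚ] LetterAlg) (a : Letter) (x : QA) :
    headOp p (cons a x) = lconc (p 1) (cons a x) + headOp (p.comp (cons a)) x := by
  have h : (TensorProduct.lift (lconc.comp p)).comp ((cons a).rTensor QA) =
      TensorProduct.lift (lconc.comp (p.comp (cons a))) := TensorProduct.ext' fun y z => by simp
  have := LinearMap.congr_fun h (deconc x)
  simp only [headOp, LinearMap.comp_apply] at this ⊢
  rw [deconc_cons, map_add, this]
  simp

theorem headOp_one (p : QA →ₗ[ℚ] LetterAlg) : headOp p 1 = lconc (p 1) 1 := by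
  simp [headOp, deconc_one, Algebra.TensorProduct.one_def]

theorem headOp_zero : headOp 0 = 0 := by
  have h : lconc.comp (0 : QA →ₗ[ℚ] LetterAlg) = 0 := by ext; simp
  have h' : TensorProduct.lift (0 : QA →ₗ[ℚ] QA →ₗ[ℚ] QA) = 0 :=
    TensorProduct.ext' fun y z => by simp
  rw [headOp, h, h', LinearMap.zero_comp]

theorem tailOp_cons (E : QA →ₗ[ℚ] ℚ) (a : Letter) (x : QA) :
    tailOp E (cons a x) = E (cons a x) • (1 : QA) + cons a (tailOp E x) := by
  have h : (TensorProduct.lift ((LinearMap.lsmul ℚ QA).flip.compl₂ E)).comp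
      ((cons a).rTensor QA) = (cons a).comp
        (TensorProduct.lift ((LinearMap.lsmul ℚ QA).flip.compl₂ E)) :=
    TensorProduct.ext' fun y z => by simp
  have := LinearMap.congr_fun h (deconc x)
  simp only [tailOp, LinearMap.comp_apply] at this ⊢
  rw [deconc_cons, map_add, this]
  simp

theorem tailOp_one (E : QA →ₗ[ℚ] ℚ) : tailOp E 1 = E 1 • (1 : QA) := by
  simp [tailOp, deconc_one, Algebra.TensorProduct.one_def]

/-- The span of the words of length at least `n`. -/
noncomputable def longWords (n : ℕ) : Submodule ℚ QA :=
  Submodule.span ℚ (word '' {w | n ≤ w.length})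

theorem word_mem_longWords {n : ℕ} {w : Word} (h : n ≤ w.length) : word w ∈ longWords n :=
  Submodule.subset_span ⟨w, h, rfl⟩

theorem longWords_le_ker {M : Type*} [AddCommGroup M] [Module ℚ M] {f : QA →ₗ[ℚ] M} {n : ℕ}
    (hf : ∀ w : Word, n ≤ w.length → f (word w) = 0) : longWords n ≤ LinearMap.ker f :=
  Submodule.span_le.2 <| by rintro _ ⟨w, hw, rfl⟩; exact hf w hw

theorem cons_mem_longWords {n : ℕ} (a : Letter) {x : QA} (hx : x ∈ longWords n) :
    cons a x ∈ longWords (n + 1) := by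
  have : longWords n ≤ (longWords (n + 1)).comap (cons a) :=
    Submodule.span_le.2 <| by
      rintro _ ⟨w, hw, rfl⟩
      simpa using word_mem_longWords (w := a :: w) (by simpa using hw)
  exact this hx

theorem longWords_anti {m n : ℕ} (h : m ≤ n) : longWords n ≤ longWords m :=
  Submodule.span_mono <| Set.image_mono fun w (hw : n ≤ w.length) => h.trans hw

/-- Merging pairs a letter of one word with a letter of the other, so no term is shorter than either
factor. Local Leibniz rules therefore only need checking in bounded lengths. -/
theorem mul_mem_longWords (w v : Word) : word w * word v ∈ longWords w.length := by
  induction h : w.length + v.length using Nat.strong_induction_on generalizing w v with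
  | _ n ih =>
    match w, v with
    | [], v => exact longWords_anti (Nat.zero_le _) (by simpa [word_nil] using word_mem_longWords le_rfl)
    | a :: w, [] => simpa [word_nil] using word_mem_longWords (w := a :: w) le_rfl
    | a :: w, b :: v =>
      simp only [List.length_cons] at h
      have h1 := ih _ (by simp; omega) w (b :: v) rfl
      have h2 := ih _ (by simp; omega) (a :: w) v rfl
      have h3 := ih _ (by omega) w v rfl
      rw [word_cons_mul_word_cons]
      exact add_mem (add_mem (cons_mem_longWords a h1)
        (longWords_anti (Nat.le_succ _) (cons_mem_longWords b h2))) (cons_mem_longWords _ h3)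

/-- The letter `(k, d)` in `LetterAlg`, and `0` for `k = 0`. -/
noncomputable def lw (k d : ℕ) : LetterAlg := if h : 0 < k then letter (⟨k, h⟩, d) else 0

/-- `e` times the letter `(k, d + e - 1)`. -/
noncomputable def dlw (k d e : ℕ) : LetterAlg := (e : ℚ) • lw k (d + e - 1)

@[simp] theorem lw_zero (d : ℕ) : lw 0 d = 0 := by simp [lw]

theorem letter_eq_lw (a : Letter) : letter a = lw a.1 a.2 := by
  rw [lw, dif_pos a.1.pos]; rfl

theorem lw_mul_letter (k d : ℕ) (a : Letter) :
    lw k d * letter a = if k = 0 then 0 else lw (k + a.1) (d + a.2) := by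
  rcases Nat.eq_zero_or_pos k with rfl | h
  · simp
  · rw [if_neg h.ne', lw, dif_pos h, letter_mul, letter_eq_lw]; rfl

theorem letter_mul_lw (k d : ℕ) (a : Letter) :
    letter a * lw k d = if k = 0 then 0 else lw (k + a.1) (d + a.2) := by
  rw [LetterAlg.mul_comm, lw_mul_letter]

/-- The truncated subtraction in `d + e - 1` is harmless: it only matters for `e = 0`, where the
scalar factor vanishes. -/
theorem dlw_mul_letter (k d e : ℕ) (a : Letter) :
    dlw k d e * letter a = if k = 0 then 0 else dlw (k + a.1) (d + a.2) e := by
  rcases Nat.eq_zero_or_pos e with rfl | h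
  · simp [dlw]
  · simp only [dlw, smul_mul_assoc, lw_mul_letter]
    split_ifs with h0
    · simp
    · congr 2; omega

theorem letter_mul_dlw (k d e : ℕ) (a : Letter) :
    letter a * dlw k d e = if k = 0 then 0 else dlw (k + a.1) (d + a.2) e := by
  rw [LetterAlg.mul_comm, dlw_mul_letter]

theorem dlw_add (k d e f : ℕ) : dlw k d (e + f) = dlw k (d + f) e + dlw k (d + e) f := by
  simp only [dlw]
  rw [show d + f + e - 1 = d + (e + f) - 1 by omega, show d + e + f - 1 = d + (e + f) - 1 by omega,
    ← add_smul]
  push_cast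
  ring_nf

/-! ### Local form of `δ` and its Leibniz rule -/

/-- The local form of `δ`: the letters by which `δ` replaces one, two or three adjacent letters. -/
noncomputable def deltaLetters : Word → LetterAlg
  | [(k, d)] => dlw (k - 1) 0 d
  | [(k, d), (l, e)] =>
      (-(1 / 2) : ℚ) • ((if (l : ℕ) = 1 then dlw k d e else 0) +
        (if (k : ℕ) = 1 then dlw l e d else 0) + (if (k : ℕ) = 2 then lw l (d + e) else 0) -
        (if (l : ℕ) = 2 then lw k (d + e) else 0) +
        (if (l : ℕ) = 1 then lw (k - 1) (d + e) else 0) -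
        (if (k : ℕ) = 1 then lw (l - 1) (d + e) else 0))
  | [(k, d), (l, e), (m, f)] =>
      (1 / 4 : ℚ) • ((if (k : ℕ) = 1 ∧ (l : ℕ) = 1 then lw m (d + e + f) else 0) -
        (if (l : ℕ) = 1 ∧ (m : ℕ) = 1 then lw k (d + e + f) else 0))
  | _ => 0

/-- The constant part of `δ`. -/
noncomputable def deltaConst : Word → ℚ
  | [(k, d)] => -(1 / 2) * ((if k = 2 ∧ d = 0 then 1 else 0) + (if k = 1 ∧ d = 1 then 1 else 0))
  | [(k, d), (l, e)] => if (k = 1 ∧ l = 1) ∧ d = 0 ∧ e = 0 then 1 / 4 else 0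
  | _ => 0

theorem PNat.add_ne_one' (k l : ℕ+) : (k : ℕ) + l ≠ 1 := by
  have := k.pos; have := l.pos; omega

theorem PNat.add_eq_two (k l : ℕ+) : (k : ℕ) + l = 2 ↔ (k : ℕ) = 1 ∧ (l : ℕ) = 1 := by
  have := k.pos; have := l.pos; omega

theorem ofWords_eq_zero_of_long {M : Type*} [AddCommGroup M] [Module ℚ M] {f : Word → M} {n : ℕ}
    (hf : ∀ w : Word, n ≤ w.length → f w = 0) {w : Word} (hw : n ≤ w.length) (v : Word) :
    ofWords f (word w * word v) = 0 :=
  longWords_le_ker (n := n) (fun w h => by simp [hf w h])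
    (longWords_anti hw (mul_mem_longWords w v))

theorem deltaLetters_long (w : Word) (h : 4 ≤ w.length) : deltaLetters w = 0 := by
  match w, h with
  | a :: b :: c :: d :: w, _ => simp [deltaLetters]

theorem deltaConst_long (w : Word) (h : 3 ≤ w.length) : deltaConst w = 0 := by
  match w, h with
  | a :: b :: c :: w, _ => simp [deltaConst]

theorem letterPart_long (w : Word) (h : 2 ≤ w.length) : letterPart (word w) = 0 := by
  match w, h with
  | a :: b :: w, _ => simp [letterPart]

theorem deltaLetters_leibniz11 (k l : ℕ+) (d e : ℕ) :
    ofWords deltaLetters (word [(k, d)] * word [(l, e)]) =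
      deltaLetters [(k, d)] * letterPart (word [(l, e)]) +
        letterPart (word [(k, d)]) * deltaLetters [(l, e)] := by
  obtain ⟨i, hi⟩ := Nat.exists_eq_succ_of_ne_zero k.ne_zero
  obtain ⟨j, hj⟩ := Nat.exists_eq_succ_of_ne_zero l.ne_zero
  rw [word_mul_word]
  simp only [stuffle, cons_word, map_add, ofWords_word, deltaLetters, Prod.mk_add_mk,
    dlw_mul_letter, letter_mul_dlw, dlw_add, PNat.add_coe, zero_add, letterPart, hi, hj,
    Nat.succ_eq_add_one]
  -- The local rule distinguishes only the upper indices 1, 2 and larger ones; here `i` and `j` are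
  -- the upper indices minus one.
  rcases i with - | - | i <;> rcases j with - | - | j <;>
  simp [add_comm, add_left_comm, add_assoc] <;> try module

/-- A merged upper index is never 1, and it is 2 only for `1 + 1`. The merged letters with index 2
enter the two-letter rule with coefficient `1/2`; this is balanced by the two orderings of the
adjacent pair in the three-letter rule, each with coefficient `1/4`. -/
theorem deltaLetters_leibniz12 (k l m : ℕ+) (d e f : ℕ) :
    ofWords deltaLetters (word [(k, d)] * word [(l, e), (m, f)]) =
      deltaLetters [(k, d)] * letterPart (word [(l, e), (m, f)]) +
        letterPart (word [(k, d)]) * deltaLetters [(l, e), (m, f)] := by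
  rw [word_mul_word]
  simp only [stuffle, cons_word, map_add, ofWords_word, deltaLetters, Prod.mk_add_mk,
    PNat.add_coe, letterPart, mul_zero, zero_add, PNat.add_ne_one', PNat.add_eq_two, if_false,
    mul_smul_comm, mul_add, mul_sub, mul_ite, letter_mul_dlw, letter_mul_lw,
    PNat.ne_zero]
  have hk := k.pos
  have hl := l.pos
  have hm := m.pos
  generalize (k : ℕ) = k at *
  generalize (l : ℕ) = l at *
  generalize (m : ℕ) = m at *
  rw [show e + d + f = d + e + f by omega, show e + f + d = d + e + f by omega,
    show e + (d + f) = d + e + f by omega, show d + f = f + d by omega,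
    show d + e = e + d by omega, show k + l = l + k by omega, show k + m = m + k by omega]
  have e1 : l - 1 + k = l + k - 1 := by omega
  have e2 : m - 1 + k = m + k - 1 := by omega
  have e3 : (l - 1 = 0) = (l = 1) := propext (by omega)
  have e4 : (m - 1 = 0) = (m = 1) := propext (by omega)
  simp only [e1, e2, e3, e4]
  by_cases h1 : k = 1 <;> by_cases h2 : l = 1 <;> by_cases h3 : m = 1 <;>
  simp only [h1, h2, h3, if_true, if_false, and_true, and_self, and_false,
    Nat.add_sub_cancel, Nat.add_sub_cancel_left] <;>
  module

theorem deltaLetters_leibniz13 (k l m n : ℕ+) (d e f g : ℕ) :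
    ofWords deltaLetters (word [(k, d)] * word [(l, e), (m, f), (n, g)]) =
      deltaLetters [(k, d)] * letterPart (word [(l, e), (m, f), (n, g)]) +
        letterPart (word [(k, d)]) * deltaLetters [(l, e), (m, f), (n, g)] := by
  rw [word_mul_word]
  simp only [stuffle, cons_word, map_add, ofWords_word, deltaLetters, Prod.mk_add_mk,
    PNat.add_coe, letterPart, mul_zero, zero_add, PNat.add_ne_one', if_false,
    mul_smul_comm, mul_sub, mul_ite, letter_mul_lw, false_and, and_false,
    PNat.ne_zero, add_zero, sub_zero, zero_sub, smul_neg, smul_zero]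
  rw [show d + e + f + g = e + f + g + d by omega, show e + f + (d + g) = e + f + g + d by omega,
    add_comm (k : ℕ) l, add_comm (k : ℕ) n]
  module

theorem deltaLetters_leibniz22 (k l m n : ℕ+) (d e f g : ℕ) :
    ofWords deltaLetters (word [(k, d), (l, e)] * word [(m, f), (n, g)]) =
      deltaLetters [(k, d), (l, e)] * letterPart (word [(m, f), (n, g)]) +
        letterPart (word [(k, d), (l, e)]) * deltaLetters [(m, f), (n, g)] := by
  rw [word_mul_word]
  simp only [stuffle, cons_word, map_add, ofWords_word, deltaLetters, Prod.mk_add_mk,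
    PNat.add_coe, letterPart, mul_zero, PNat.add_ne_one', PNat.add_eq_two, if_false,
    false_and, and_false, add_zero, sub_zero, zero_sub, smul_zero, zero_mul, zero_add]
  rw [show f + d + (e + g) = d + f + (e + g) by omega,
    show d + f + e + g = d + f + (e + g) by omega, show d + f + g + e = d + f + (e + g) by omega]
  simp only [and_comm (a := (m : ℕ) = 1), and_comm (a := (n : ℕ) = 1)]
  module

theorem deltaLetters_leibniz23 (k l m n o : ℕ+) (d e f g h : ℕ) :
    ofWords deltaLetters (word [(k, d), (l, e)] * word [(m, f), (n, g), (o, h)]) =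
      deltaLetters [(k, d), (l, e)] * letterPart (word [(m, f), (n, g), (o, h)]) +
        letterPart (word [(k, d), (l, e)]) * deltaLetters [(m, f), (n, g), (o, h)] := by
  rw [word_mul_word]
  simp only [stuffle, cons_word, map_add, ofWords_word, deltaLetters, Prod.mk_add_mk,
    PNat.add_coe, letterPart, mul_zero, PNat.add_ne_one', if_false,
    false_and, and_false, add_zero, sub_zero, smul_zero, zero_mul]

theorem deltaLetters_leibniz33 (k l m n o i : ℕ+) (d e f g h j : ℕ) :
    ofWords deltaLetters (word [(k, d), (l, e), (m, f)] * word [(n, g), (o, h), (i, j)]) =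
      deltaLetters [(k, d), (l, e), (m, f)] * letterPart (word [(n, g), (o, h), (i, j)]) +
        letterPart (word [(k, d), (l, e), (m, f)]) * deltaLetters [(n, g), (o, h), (i, j)] := by
  rw [word_mul_word]
  simp only [stuffle, cons_word, map_add, ofWords_word, deltaLetters, Prod.mk_add_mk,
    PNat.add_coe, letterPart, mul_zero, PNat.add_ne_one', if_false,
    false_and, add_zero, sub_zero, smul_zero, zero_mul]

theorem deltaLetters_leibniz : IsLocalLeibniz (ofWords deltaLetters) := by
  have symm : ∀ w v : Word, ofWords deltaLetters (word v * word w) =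
      deltaLetters v * letterPart (word w) + letterPart (word v) * deltaLetters w →
      ofWords deltaLetters (word w * word v) =
      deltaLetters w * letterPart (word v) + letterPart (word w) * deltaLetters v := by
    intro w v h
    rw [mul_comm, h, add_comm, LetterAlg.mul_comm, LetterAlg.mul_comm (deltaLetters v)]
  have long : ∀ w v : Word, 4 ≤ w.length → ofWords deltaLetters (word w * word v) =
      deltaLetters w * letterPart (word v) + letterPart (word w) * deltaLetters v := by
    intro w v h
    rw [ofWords_eq_zero_of_long deltaLetters_long h, deltaLetters_long w h,
      letterPart_long w (by omega), zero_mul, zero_mul, add_zero]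
  intro w v hw hv
  simp only [ofWords_word]
  -- By commutativity it suffices to treat a shorter first factor, and a factor of length at least
  -- four makes every term vanish.
  match w, v with
  | [_], [_] => exact deltaLetters_leibniz11 ..
  | [_], [_, _] => exact deltaLetters_leibniz12 ..
  | [_], [_, _, _] => exact deltaLetters_leibniz13 ..
  | [_, _], [_, _] => exact deltaLetters_leibniz22 ..
  | [_, _], [_, _, _] => exact deltaLetters_leibniz23 ..
  | [_, _, _], [_, _, _] => exact deltaLetters_leibniz33 ..
  | [_, _], [_] => exact symm _ _ (deltaLetters_leibniz12 ..)
  | [_, _, _], [_] => exact symm _ _ (deltaLetters_leibniz13 ..)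
  | [_, _, _], [_, _] => exact symm _ _ (deltaLetters_leibniz23 ..)
  | a :: b :: c :: d :: w, v => exact long _ _ (by simp)
  | w, a :: b :: c :: d :: v => exact symm _ _ (long _ _ (by simp))

/-- The only critical product is `(1,0) * (1,0)`: the two copies of `(1,0)(1,0)` contribute `1/4`
each, and the merged letter `(2,0)` contributes `-1/2`. -/
theorem deltaConst_mul (w v : Word) (hw : w ≠ []) (hv : v ≠ []) :
    ofWords deltaConst (word w * word v) = 0 := by
  have two : ∀ (a b c : Letter), ofWords deltaConst (word [a] * word [b, c]) = 0 := by
    rintro ⟨k, d⟩ ⟨l, e⟩ ⟨m, f⟩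
    have h : ∀ k l : ℕ+, k + l ≠ 1 := fun k l h => PNat.add_ne_one' k l (by
      rw [← PNat.add_coe, h]; rfl)
    rw [word_mul_word]
    simp [stuffle, deltaConst, h]
  match w, v with
  | [(k, d)], [(l, e)] =>
    have h : k + l = 2 ↔ k = 1 ∧ l = 1 := by
      rw [← PNat.coe_inj, PNat.add_coe, ← PNat.coe_inj (n := 1), ← PNat.coe_inj (n := 1)]
      exact PNat.add_eq_two k l
    have h' : k + l ≠ 1 := fun h => PNat.add_ne_one' k l (by rw [← PNat.add_coe, h]; rfl)
    rw [word_mul_word]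
    simp only [stuffle, cons_word, map_add, ofWords_word, deltaConst, Prod.mk_add_mk, h, h',
      false_and, if_false, Nat.add_eq_zero_iff]
    by_cases hk : k = 1 <;> by_cases hl : l = 1 <;> by_cases hd : d = 0 <;>
      by_cases he : e = 0 <;> simp [hk, hl, hd, he]
    norm_num
  | [a], [b, c] => exact two a b c
  | [a, b], [c] => rw [mul_comm]; exact two c a b
  | [(k, d), (l, e)], [(m, f), (n, g)] =>
    have h : ∀ k l : ℕ+, k + l ≠ 1 := fun k l h => PNat.add_ne_one' k l (by
      rw [← PNat.add_coe, h]; rfl)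
    rw [word_mul_word]
    simp [stuffle, deltaConst, h]
  | a :: b :: c :: w, v =>
    exact ofWords_eq_zero_of_long deltaConst_long (by simp) _
  | w, a :: b :: c :: v =>
    rw [mul_comm]
    exact ofWords_eq_zero_of_long deltaConst_long (by simp) _

/-- The terms of `δ` in which the first letter takes part. -/
noncomputable def deltaHead (w : Word) : QA :=
  headOp (ofWords deltaLetters) (word w) + deltaConst w • (1 : QA)

theorem ofWords_comp_cons {M : Type*} [AddCommGroup M] [Module ℚ M] (f : Word → M) (a : Letter) :
    (ofWords f).comp (cons a) = ofWords fun w => f (a :: w) := hom_ext fun w => by simp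

theorem deltaHead_one (a : Letter) :
    deltaHead [a] = lconc (deltaLetters [a]) 1 + deltaConst [a] • (1 : QA) := by
  rw [deltaHead, ← cons_word, headOp_cons, ofWords_comp_cons, word_nil, headOp_one, ← word_nil,
    ofWords_word, ofWords_word]
  simp [deltaLetters]

theorem deltaHead_two (a b : Letter) :
    deltaHead [a, b] = lconc (deltaLetters [a]) (word [b]) + lconc (deltaLetters [a, b]) 1 +
      deltaConst [a, b] • (1 : QA) := by
  rw [deltaHead, ← cons_word, headOp_cons, ofWords_comp_cons, ← cons_word b, headOp_cons,
    ofWords_comp_cons, word_nil, headOp_one, ← word_nil]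
  simp [deltaLetters]

theorem deltaHead_cons (a b c : Letter) (w : Word) :
    deltaHead (a :: b :: c :: w) = lconc (deltaLetters [a]) (word (b :: c :: w)) +
      lconc (deltaLetters [a, b]) (word (c :: w)) + lconc (deltaLetters [a, b, c]) (word w) := by
  have hz : ∀ v : Word, headOp (ofWords fun u => deltaLetters (a :: b :: c :: u)) (word v) =
      lconc (deltaLetters [a, b, c]) (word v) := by
    rintro (_ | ⟨d, v⟩)
    · rw [word_nil, headOp_one, ← word_nil, ofWords_word]
    · rw [← cons_word, headOp_cons, ofWords_comp_cons, ← word_nil, ofWords_word]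
      have : (ofWords fun u : Word => deltaLetters (a :: b :: c :: d :: u)) = 0 :=
        hom_ext fun u => by simp [deltaLetters]
      rw [this, headOp_zero, LinearMap.zero_apply, add_zero]
  rw [deltaHead, ← cons_word, headOp_cons, ofWords_comp_cons, ← cons_word b, headOp_cons,
    ofWords_comp_cons, ← cons_word c, headOp_cons, ofWords_comp_cons, hz, ← word_nil]
  simp only [ofWords_word, cons_word]
  simp [deltaLetters, deltaConst, add_assoc]

theorem lconc_lw (k d : ℕ) (w : Word) :
    lconc (lw k d) (word w) = if h : 0 < k then word ((⟨k, h⟩, d) :: w) else 0 := by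
  unfold lw
  split_ifs <;> simp

theorem lconc_lw_coe (k : ℕ+) (d : ℕ) (w : Word) : lconc (lw k d) (word w) = word ((k, d) :: w) := by
  rw [← letter_eq_lw (k, d), lconc_letter, cons_word]

theorem lconc_lw_sub (k : ℕ+) (d : ℕ) (w : Word) :
    lconc (lw ((k : ℕ) - 1) d) (word w) = if 1 < k then word ((k - 1, d) :: w) else 0 := by
  rw [lconc_lw]
  by_cases h : 1 < k
  · have h' : 0 < (k : ℕ) - 1 := by
      have : 1 < (k : ℕ) := h
      omega
    rw [dif_pos h', if_pos h]
    congr 3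
    apply PNat.coe_injective
    rw [PNat.sub_coe, if_pos h]; rfl
  · rw [if_neg h, dif_neg]
    intro h'
    exact h (by change 1 < (k : ℕ); omega)

theorem ite_lconc (P : Prop) [Decidable P] (x y : LetterAlg) (z : QA) :
    lconc (if P then x else y) z = if P then lconc x z else lconc y z := by
  split_ifs <;> rfl

/-- The splittings with empty prefix give the terms in which the first letter takes part. The cases
follow the length, since the local rule sees at most three letters and the constants only words of
length at most two. -/
theorem wordDelta_cons (a : Letter) (w : Word) :
    wordDelta (a :: w) = cons a (wordDelta w) + deltaHead (a :: w) := by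
  obtain ⟨k, d⟩ := a
  have c1 : ∀ k : ℕ+, ((k : ℕ) = 1) = (k = 1) := fun k => by rw [← PNat.coe_inj]; rfl
  have c2 : ∀ k : ℕ+, ((k : ℕ) = 2) = (k = 2) := fun k => by rw [← PNat.coe_inj]; rfl
  match w with
  | [] =>
    rw [deltaHead_one]
    simp only [wordDelta, wordDelta1, wordDelta2, wordDelta3, wordDelta4, wordDelta5, splitSum,
      deltaLetters, deltaConst, dlw, map_smul, LinearMap.smul_apply, ← word_nil, lconc_lw_sub,
      List.cons.injEq, Prod.mk.injEq, and_true, map_zero, and_false, if_false,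
      reduceCtorEq, zero_add, mul_add, add_smul, mul_ite, ite_smul, mul_zero, zero_smul, mul_one,
      smul_ite, smul_zero, sub_zero, add_zero]
    split_ifs <;> module
  | [(l, e)] =>
    rw [deltaHead_two]
    simp only [wordDelta, wordDelta1, wordDelta2, wordDelta3, wordDelta4, wordDelta5, splitSum,
      deltaLetters, deltaConst, dlw, map_smul, LinearMap.smul_apply, ← word_nil, lconc_lw_sub,
      List.cons.injEq, Prod.mk.injEq, and_true, map_zero, List.cons_ne_nil, and_false, if_false,
      reduceCtorEq, zero_add, ite_smul, zero_smul,
      smul_ite, smul_zero, map_add, map_sub, LinearMap.add_apply, LinearMap.sub_apply, ite_lconc, lconc_lw_coe,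
      LinearMap.zero_apply, c1, c2]
    rw [add_comm e d]
    by_cases hk : k = 1 <;> by_cases hl : l = 1 <;> by_cases hd : d = 0 <;>
      by_cases he : e = 0 <;>
      simp only [hk, hl, hd, he, if_true, if_false, true_and, and_true, false_and, and_false,
        and_self, lt_self_iff_false] <;>
      module
  | (l, e) :: (m, f) :: w =>
    rw [deltaHead_cons]
    simp only [wordDelta, wordDelta1, wordDelta2, wordDelta3, wordDelta4, wordDelta5, splitSum,
      deltaLetters, dlw, map_smul, LinearMap.smul_apply, lconc_lw_sub,
      List.cons.injEq, Prod.mk.injEq, map_zero, List.cons_ne_nil, and_false, if_false,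
      zero_add,
      smul_ite, smul_zero, map_add, map_sub, LinearMap.add_apply, LinearMap.sub_apply, ite_lconc, lconc_lw_coe,
      LinearMap.zero_apply, c1, c2]
    rw [add_comm e d]
    by_cases hk : k = 1 <;> by_cases hl : l = 1 <;> by_cases hm : m = 1 <;>
      simp only [hk, hl, hm, if_true, if_false, true_and, and_true, false_and, and_false,
        and_self, lt_self_iff_false] <;>
      module

/-- `δ` on `ℚ⟨𝒜⟩`. -/
noncomputable def deltaQA : QA →ₗ[ℚ] QA := ofWords wordDelta

/-- The part of `δ` that takes place in the first letters. -/
noncomputable def deltaHeadQA : QA →ₗ[ℚ] QA := ofWords deltaHead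

theorem deltaQA_one : deltaQA 1 = 0 := by
  rw [← word_nil, deltaQA, ofWords_word]
  simp [wordDelta, wordDelta1, wordDelta2, wordDelta3, wordDelta4, wordDelta5, splitSum]

theorem deltaQA_cons (a : Letter) (x : QA) :
    deltaQA (cons a x) = cons a (deltaQA x) + deltaHeadQA (cons a x) := by
  have : deltaQA.comp (cons a) = (cons a).comp deltaQA + deltaHeadQA.comp (cons a) :=
    hom_ext fun w => by simp [deltaQA, deltaHeadQA, wordDelta_cons]
  exact LinearMap.congr_fun this x

theorem deltaHeadQA_eq (x : QA) : deltaHeadQA x = headOp (ofWords deltaLetters) x +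
    ofWords deltaConst x • (1 : QA) := by
  have : deltaHeadQA = headOp (ofWords deltaLetters) + (ofWords deltaConst).smulRight (1 : QA) :=
    hom_ext fun w => by simp [deltaHeadQA, deltaHead]
  exact LinearMap.congr_fun this x

/-- The constant terms do not fit the shape `headOp`, so they are split off as a `tailOp`, which is
a derivation by itself; the remainder falls under `leibniz_of_head`. -/
theorem deltaQA_mul (x y : QA) : deltaQA (x * y) = x * deltaQA y + y * deltaQA x := by
  have hc1 : ofWords deltaConst 1 = 0 := by
    rw [← word_nil, ofWords_word]; simp [deltaConst]
  have hp1 : ofWords deltaLetters 1 = 0 := by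
    rw [← word_nil, ofWords_word]; simp [deltaLetters]
  have h1 := leibniz_of_head (δ := deltaQA - tailOp (ofWords deltaConst))
    (H := headOp (ofWords deltaLetters))
    (by simp [deltaQA_one, tailOp_one, hc1])
    (fun a x => by
      simp only [LinearMap.sub_apply, deltaQA_cons, tailOp_cons, deltaHeadQA_eq, map_sub]
      abel)
    (headOp_cons_mul_cons hp1 deltaLetters_leibniz) x y
  have h2 := tailOp_mul hc1 deltaConst_mul x y
  simp only [LinearMap.sub_apply, mul_sub] at h1
  rw [h2] at h1
  linear_combination (exp := 1) h1

/-- Leibniz rule for maps given on words by a sum over the letters. -/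
theorem splitSum_letter_mul {ρ : Word → QA} {g : Letter → LetterAlg}
    (hρ : ∀ a w, ρ (a :: w) = lconc (g a) (word w))
    (hg : ∀ a b, g (a + b) = g a * letter b + letter a * g b) (x y : QA) :
    ofWords (splitSum ρ) (x * y) = x * ofWords (splitSum ρ) y + y * ofWords (splitSum ρ) x := by
  let p : Word → LetterAlg := fun | [a] => g a | _ => 0
  have hlong : ∀ w : Word, 2 ≤ w.length → p w = 0 := fun w hw => by
    match w, hw with
    | a :: b :: w, _ => rfl
  have hp1 : ofWords p 1 = 0 := by rw [← word_nil, ofWords_word]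
  have hp : IsLocalLeibniz (ofWords p) := by
    intro w v hw hv
    match w, v with
    | [a], [b] =>
      rw [word_mul_word]
      simp [stuffle, p, letterPart, hg]
    | a :: b :: w, v =>
      rw [ofWords_eq_zero_of_long hlong (by simp), letterPart_long (a :: b :: w) (by simp),
        ofWords_word, ofWords_word, hlong (a :: b :: w) (by simp), zero_mul, zero_mul, add_zero]
    | v, a :: b :: w =>
      rw [mul_comm, ofWords_eq_zero_of_long hlong (by simp), letterPart_long (a :: b :: w) (by simp),
        ofWords_word, ofWords_word, hlong (a :: b :: w) (by simp), mul_zero, mul_zero, add_zero]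
  have head : ∀ a w, headOp (ofWords p) (cons a (word w)) = lconc (g a) (word w) := by
    intro a w
    have : (ofWords p).comp (cons a) = counit.smulRight (g a) := hom_ext fun w => by
      cases w <;> simp [p, counit]
    rw [headOp_cons, this, hp1]
    match w with
    | [] => rw [word_nil, headOp_one]; simp
    | b :: w =>
      have h : (counit.smulRight (g a)).comp (cons b) = 0 := LinearMap.ext fun x => by simp
      rw [← cons_word, headOp_cons, h, headOp_zero]
      simp
  refine leibniz_of_head (δ := ofWords (splitSum ρ)) (H := headOp (ofWords p)) ?_ ?_
    (headOp_cons_mul_cons hp1 hp) x y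
  · rw [← word_nil, ofWords_word, splitSum]
  · intro a x
    have : (ofWords (splitSum ρ)).comp (cons a) = (cons a).comp (ofWords (splitSum ρ)) +
        (headOp (ofWords p)).comp (cons a) := hom_ext fun w => by
      simp only [LinearMap.comp_apply, LinearMap.add_apply, head]
      simp [splitSum, hρ, add_comm]
    exact LinearMap.congr_fun this x

/-- The map `(k, d) ↦ k · (k + 1, d + 1)` obeys the product rule for `⋄` because upper indices add.
-/
theorem wordD_mul (x y : QA) :
    ofWords wordD (x * y) = x * ofWords wordD y + y * ofWords wordD x := by
  refine splitSum_letter_mul (g := fun a => ((a.1 : ℕ) : ℚ) • letter (a + (1, 1)))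
    (fun a w => ?_) (fun a b => ?_) x y
  · simp; rfl
  · simp only [smul_mul_assoc, mul_smul_comm, letter_mul, Prod.fst_add, PNat.add_coe, Nat.cast_add,
      add_smul]
    rw [add_right_comm a (1, 1) b, add_assoc]

theorem wordW_eq_splitSum :
    wordW = splitSum fun | a :: v => ((a.1 : ℕ) + a.2 : ℚ) • word (a :: v) | [] => 0 := by
  funext w
  induction w with
  | nil => simp [wordW, splitSum, wt]
  | cons a w ih =>
    rw [splitSum, ← ih]
    simp only [wordW, wt, List.map_cons, List.sum_cons, map_smul, cons_word, ← add_smul]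
    push_cast
    ring_nf

theorem wordW_mul (x y : QA) :
    ofWords wordW (x * y) = x * ofWords wordW y + y * ofWords wordW x := by
  rw [wordW_eq_splitSum]
  refine splitSum_letter_mul (g := fun a => ((a.1 : ℕ) + a.2 : ℚ) • letter a)
    (fun a w => by simp) (fun a b => ?_) x y
  simp only [smul_mul_assoc, mul_smul_comm, letter_mul, Prod.fst_add, Prod.snd_add, PNat.add_coe,
    Nat.cast_add, ← add_smul]
  ring_nf

/-! ### Generating series along lists of points -/

/-- Left concatenation with the letter `(i + 1, j)`. -/
noncomputable def catL (i j : ℕ) : Module.End ℚ QA := cons (i.succPNat, j)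

theorem lconc_lw_succ (i j : ℕ) : lconc (lw (i + 1) j) = catL i j := by
  rw [lw, dif_pos (Nat.succ_pos i), lconc_letter]; rfl

/-- Two linear maps agree as soon as they agree on `1` and on all `catL i j x`. -/
theorem hom_ext_catL {M : Type*} [AddCommGroup M] [Module ℚ M] {f g : QA →ₗ[ℚ] M}
    (h1 : f 1 = g 1) (h : ∀ i j w, f (catL i j (word w)) = g (catL i j (word w))) : f = g :=
  hom_ext_cons h1 fun a w => by
    have := h a.1.natPred a.2 w
    rwa [catL, PNat.succPNat_natPred] at this

/-- A linear map from its value at `1` and its values on the words `(i + 1, j) w`. -/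
noncomputable def ofCat (x : QA) (f : ℕ → ℕ → QA →ₗ[ℚ] QA) : Module.End ℚ QA := ofWords fun
  | [] => x
  | (k, d) :: w => f k.natPred d (word w)

@[simp] theorem ofCat_one (x : QA) (f : ℕ → ℕ → QA →ₗ[ℚ] QA) : ofCat x f 1 = x := by
  rw [← word_nil, ofCat, ofWords_word]

@[simp] theorem ofCat_catL (x : QA) (f : ℕ → ℕ → QA →ₗ[ℚ] QA) (i j : ℕ) (y : QA) :
    ofCat x f (catL i j y) = f i j y := by
  have : (ofCat x f).comp (catL i j) = f i j := hom_ext fun w => by simp [ofCat, catL]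
  exact LinearMap.congr_fun this y

/-- Raise the second index of the first letter by `n`. -/
noncomputable def opV (n : ℕ) : Module.End ℚ QA :=
  -- The value at the empty word is chosen so that merging a final letter `(1, d)` into nothing
  -- leaves `1` exactly for `d = 0`. The constant terms of `δ` are then produced by the same
  -- operators as all others.
  ofCat (if n = 0 then 1 else 0) fun i j => catL i (j + n)

/-- Lower the first index of the first letter. -/
noncomputable def opS : Module.End ℚ QA := ofCat 0 fun i j => if i = 0 then 0 else catL (i - 1) j

/-- Differentiate in the second index of the first letter. -/
noncomputable def opDV : Module.End ℚ QA := ofCat 0 fun i j => (j : ℚ) • catL i (j - 1)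

/-- Merge a first letter `(1, d)` into its right neighbour. -/
noncomputable def opK : Module.End ℚ QA := ofCat 0 fun i j => if i = 0 then opV j else 0

/-- Apply an operator behind the first letter. -/
noncomputable def opJ (θ : Module.End ℚ QA) : Module.End ℚ QA :=
  ofCat 0 fun i j => (catL i j).comp θ

/-- Merge a second letter `(1, d)` into the first letter. -/
noncomputable def opM : Module.End ℚ QA :=
  ofCat 0 fun i j => ofCat 0 fun l m => if l = 0 then catL i (j + m) else 0

/-- The projection to the multiples of the empty word. -/
noncomputable def opE : Module.End ℚ QA := ofCat 1 fun _ _ => 0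

theorem word_cons_eq_catL (a : Letter) (w : Word) :
    word (a :: w) = catL a.1.natPred a.2 (word w) := by
  rw [catL, PNat.succPNat_natPred, cons_word]

theorem lconc_lw_catL (i j : ℕ) : lconc (lw i j) = if i = 0 then 0 else catL (i - 1) j := by
  rcases i with - | i
  · simp
  · rw [lconc_lw_succ]; simp

theorem deltaHeadQA_one : deltaHeadQA 1 = 0 := by
  rw [deltaHeadQA_eq, headOp_one, ← word_nil, ofWords_word, ofWords_word]
  simp [deltaLetters, deltaConst]

theorem deltaHeadQA_catL (i j : ℕ) :
    deltaHeadQA (catL i j 1) = (j : ℚ) • (if i = 0 then 0 else catL (i - 1) (j - 1) 1) -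
      (1 / 2 : ℚ) • ((if i = 1 ∧ j = 0 then 1 else 0) + (if i = 0 ∧ j = 1 then 1 else 0)) := by
  have c1 : i.succPNat = 1 ↔ i = 0 := by rw [← PNat.coe_inj]; simp
  have c2 : i.succPNat = 2 ↔ i = 1 := by rw [← PNat.coe_inj]; simp
  have : catL i j 1 = word [(i.succPNat, j)] := by rw [catL, ← word_nil, cons_word]
  rw [this, deltaHeadQA, ofWords_word, deltaHead_one]
  simp only [deltaLetters, deltaConst, dlw, Nat.succPNat_coe, Nat.succ_eq_add_one,
    Nat.add_sub_cancel, zero_add, map_smul, LinearMap.smul_apply, lconc_lw_catL, c1, c2]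
  split_ifs <;> simp <;> module

theorem deltaHeadQA_catL_two (i j l m : ℕ) :
    deltaHeadQA (catL i j (catL l m 1)) =
      lconc (deltaLetters [(i.succPNat, j)]) (catL l m 1) +
      lconc (deltaLetters [(i.succPNat, j), (l.succPNat, m)]) 1 +
      (if (i = 0 ∧ l = 0) ∧ j = 0 ∧ m = 0 then 1 / 4 else 0 : ℚ) • (1 : QA) := by
  have c1 : i.succPNat = 1 ↔ i = 0 := by rw [← PNat.coe_inj]; simp
  have c2 : l.succPNat = 1 ↔ l = 0 := by rw [← PNat.coe_inj]; simp
  have h1 : catL i j (catL l m 1) = word [(i.succPNat, j), (l.succPNat, m)] := by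
    simp only [catL, ← word_nil, cons_word]
  have h2 : catL l m 1 = word [(l.succPNat, m)] := by rw [catL, ← word_nil, cons_word]
  rw [h1, h2, deltaHeadQA, ofWords_word, deltaHead_two]
  simp only [deltaConst, c1, c2]

theorem deltaHeadQA_catL_three (i j l m n p : ℕ) (w : Word) :
    deltaHeadQA (catL i j (catL l m (catL n p (word w)))) =
      lconc (deltaLetters [(i.succPNat, j)]) (catL l m (catL n p (word w))) +
      lconc (deltaLetters [(i.succPNat, j), (l.succPNat, m)]) (catL n p (word w)) +
      lconc (deltaLetters [(i.succPNat, j), (l.succPNat, m), (n.succPNat, p)]) (word w) := by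
  simp only [catL, cons_word]
  rw [deltaHeadQA, ofWords_word, deltaHead_cons]

theorem opV_catL (n i j : ℕ) (x : QA) : opV n (catL i j x) = catL i (j + n) x := by
  simp [opV]

theorem opV_one (n : ℕ) : opV n 1 = if n = 0 then 1 else 0 := by
  simp [opV]

theorem opS_catL (i j : ℕ) (x : QA) : opS (catL i j x) = if i = 0 then 0 else catL (i - 1) j x := by
  simp only [opS, ofCat_catL]; split_ifs <;> rfl

theorem opK_catL (i j : ℕ) (x : QA) : opK (catL i j x) = if i = 0 then opV j x else 0 := by
  simp only [opK, ofCat_catL]; split_ifs <;> rfl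

theorem opDV_catL (i j : ℕ) (x : QA) : opDV (catL i j x) = (j : ℚ) • catL i (j - 1) x := by
  simp [opDV]

theorem opM_catL_catL (i j l m : ℕ) (x : QA) :
    opM (catL i j (catL l m x)) = if l = 0 then catL i (j + m) x else 0 := by
  simp only [opM, ofCat_catL]; split_ifs <;> rfl

theorem opM_catL_one (i j : ℕ) : opM (catL i j 1) = 0 := by
  simp [opM]

theorem opJ_catL (θ : Module.End ℚ QA) (i j : ℕ) (x : QA) :
    opJ θ (catL i j x) = catL i j (θ x) := by
  simp [opJ]

theorem op_one (θ : Module.End ℚ QA) :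
    opS 1 = 0 ∧ opK 1 = 0 ∧ opDV 1 = 0 ∧ opM 1 = 0 ∧ opJ θ 1 = 0 := by
  simp [opS, opK, opDV, opM, opJ]

theorem smul_catL_sub_one (i j m : ℕ) (x : QA) :
    (m : ℚ) • catL i (j + (m - 1)) x = (m : ℚ) • catL i (j + m - 1) x := by
  rcases m with - | m
  · simp
  · rw [show j + (m + 1 - 1) = j + (m + 1) - 1 by omega]

/-- This form is useful because each operator on the right acts on generating series in a simple
way: `opS` and `opDV` multiply by a coordinate, `opK` and `opM` delete or merge points. -/
theorem deltaHeadQA_eq_op :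
    deltaHeadQA = opS * opDV - (1 / 2 : ℚ) • (opK * opS - opS * opK + opK * opDV) +
      (1 / 4 : ℚ) • (opK * opK) - (1 / 2 : ℚ) • (opS * opM - opM * opJ opS + opM * opJ opDV) -
      (1 / 4 : ℚ) • (opM * opM) := by
  obtain ⟨hS, hK, hD, hM, -⟩ := op_one 0
  have hJ : ∀ θ, opJ θ 1 = 0 := fun θ => (op_one θ).2.2.2.2
  refine hom_ext_catL ?_ fun i j w => ?_
  · simp only [LinearMap.sub_apply, LinearMap.add_apply, LinearMap.smul_apply,
      Module.End.mul_apply, hS, hK, hD, hM, hJ, deltaHeadQA_one, map_zero]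
    simp
  match w with
  | [] =>
    rw [word_nil, deltaHeadQA_catL]
    simp only [LinearMap.sub_apply, LinearMap.add_apply, LinearMap.smul_apply,
      Module.End.mul_apply, opS_catL, opK_catL, opDV_catL, opM_catL_one, opJ_catL, hS, hD,
      map_smul, map_zero, opV_one]
    rcases i with - | - | i <;> rcases j with - | - | j <;>
      simp [hS, hK, opK_catL, opV_one]
  | [(l, m)] =>
    rw [word_cons_eq_catL, word_nil]
    generalize l.natPred = l
    rw [deltaHeadQA_catL_two]
    simp only [LinearMap.sub_apply, LinearMap.add_apply, LinearMap.smul_apply,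
      Module.End.mul_apply, opS_catL, opK_catL, opDV_catL, opJ_catL,
      map_smul, opM_catL_catL, opV_catL, deltaLetters, dlw, Nat.succPNat_coe,
      Nat.succ_eq_add_one, Nat.add_sub_cancel, zero_add, lconc_lw_catL, map_add, map_sub,
      Nat.add_eq_right]
    have h1 := fun i x => smul_catL_sub_one i j m x
    have h2 := fun i x => smul_catL_sub_one i m j x
    rcases i with - | - | i <;> rcases l with - | - | l <;>
      simp [opS_catL, opK_catL, opV_one, opM_catL_one, lconc_lw_catL, opV_catL,
        opM_catL_catL, h1, h2, add_comm m j] <;> try module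
  | (l, m) :: (n, p) :: w =>
    rw [word_cons_eq_catL, word_cons_eq_catL]
    generalize l.natPred = l
    generalize n.natPred = n
    dsimp only
    rw [deltaHeadQA_catL_three]
    simp only [LinearMap.sub_apply, LinearMap.add_apply, LinearMap.smul_apply,
      Module.End.mul_apply, opS_catL, opK_catL, opDV_catL, opJ_catL,
      map_smul, opM_catL_catL, opV_catL, deltaLetters, dlw, Nat.succPNat_coe,
      Nat.succ_eq_add_one, Nat.add_sub_cancel, zero_add, lconc_lw_catL, map_add, map_sub,
      Nat.add_eq_right]
    have h1 := fun i x => smul_catL_sub_one i j m x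
    have h2 := fun i x => smul_catL_sub_one i m j x
    rcases i with - | - | i <;> rcases l with - | - | l <;>
      simp [opS_catL, opK_catL, lconc_lw_catL, opV_catL, add_assoc,
        opM_catL_catL, h1, h2, add_comm m j] <;> try module
    all_goals
      rcases n with - | n <;> simp [lconc_lw_catL, show p + (j + m) = j + (m + p) by omega] <;>
        module

/-! ### Generating series with operator coefficients -/

/-- Formal power series of endomorphisms of `ℚ⟨𝒜⟩`. -/
abbrev EndSeries : Type := PowerSeries (Module.End ℚ QA)

/-- The homogenised generating series of the letters:
`∑ X ^ i Y ^ j / j! · T ^ (i + j) · (i + 1, j)`. -/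
noncomputable def lam (X Y : ℚ) : EndSeries := PowerSeries.mk fun N =>
  ∑ p ∈ Finset.HasAntidiagonal.antidiagonal N, (X ^ p.1 * Y ^ p.2 / (p.2.factorial : ℚ)) • catL p.1 p.2

/-- The exponential series of `opV`. -/
noncomputable def expV (Y : ℚ) : EndSeries := PowerSeries.mk fun N =>
  (Y ^ N / (N.factorial : ℚ)) • opV N

theorem X_mul_comm (f : EndSeries) : PowerSeries.X * f = f * PowerSeries.X :=
  (PowerSeries.commute_X f).eq.symm

theorem end_ext_op {θ : Module.End ℚ QA} {i j : ℕ} {f : Module.End ℚ QA}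
    (h : ∀ x, θ (catL i j x) = f x) : θ * catL i j = f := LinearMap.ext h

/-- Lowering the first index trades one factor of the scalar `X` for a factor of the series
variable, which records the total degree. -/
theorem C_opS_mul_lam (X Y : ℚ) :
    PowerSeries.C opS * lam X Y = X • (PowerSeries.X * lam X Y) := by
  ext n : 1
  rw [PowerSeries.coeff_C_mul, PowerSeries.coeff_smul, lam, PowerSeries.coeff_mk]
  have h : ∀ i j, opS * catL i j = if i = 0 then 0 else catL (i - 1) j := fun i j =>
    end_ext_op fun x => by rw [opS_catL]; split_ifs <;> rfl
  rcases n with - | n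
  · simp [h]
  · rw [PowerSeries.coeff_succ_X_mul, PowerSeries.coeff_mk, Finset.Nat.sum_antidiagonal_succ,
      mul_add, Finset.mul_sum, Finset.smul_sum]
    simp only [mul_smul_comm, h, if_true, smul_zero, zero_add, Nat.succ_ne_zero, if_false,
      Nat.add_sub_cancel, smul_smul]
    refine Finset.sum_congr rfl fun p _ => ?_
    congr 1
    ring

theorem C_opDV_mul_lam (X Y : ℚ) :
    PowerSeries.C opDV * lam X Y = Y • (PowerSeries.X * lam X Y) := by
  ext n : 1
  rw [PowerSeries.coeff_C_mul, PowerSeries.coeff_smul, lam, PowerSeries.coeff_mk]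
  have h : ∀ i j, opDV * catL i j = (j : ℚ) • catL i (j - 1) := fun i j =>
    end_ext_op fun x => by rw [opDV_catL]; rfl
  rcases n with - | n
  · simp [h]
  · rw [PowerSeries.coeff_succ_X_mul, PowerSeries.coeff_mk, Finset.mul_sum, Finset.smul_sum]
    simp only [mul_smul_comm, h, smul_smul]
    rw [Finset.Nat.sum_antidiagonal_succ' (n := n)]
    simp only [Nat.cast_zero, mul_zero, zero_smul, zero_add, Nat.add_sub_cancel]
    refine Finset.sum_congr rfl fun p _ => ?_
    congr 1
    rw [Nat.factorial_succ]
    have := Nat.factorial_ne_zero p.2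
    push_cast
    field_simp
    ring

theorem C_opK_mul_lam (X Y : ℚ) : PowerSeries.C opK * lam X Y = expV Y := by
  ext n : 1
  rw [PowerSeries.coeff_C_mul, lam, PowerSeries.coeff_mk, expV, PowerSeries.coeff_mk,
    Finset.mul_sum]
  have h : ∀ i j, opK * catL i j = if i = 0 then opV j else 0 := fun i j =>
    end_ext_op fun x => by rw [opK_catL]; split_ifs <;> rfl
  rw [Finset.sum_eq_single (0, n)]
  · simp [h]
  · rintro ⟨i, j⟩ hij hne
    rw [Finset.HasAntidiagonal.mem_antidiagonal] at hij
    have : i ≠ 0 := by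
      rintro rfl
      simp at hij
      exact hne (by rw [hij])
    simp [h, this]
  · simp

theorem C_opJ_mul_lam (θ : Module.End ℚ QA) (X Y : ℚ) :
    PowerSeries.C (opJ θ) * lam X Y = lam X Y * PowerSeries.C θ := by
  ext n : 1
  rw [PowerSeries.coeff_C_mul, PowerSeries.coeff_mul_C, lam, PowerSeries.coeff_mk, Finset.mul_sum,
    Finset.sum_mul]
  refine Finset.sum_congr rfl fun p _ => ?_
  rw [mul_smul_comm, smul_mul_assoc]
  congr 1
  exact LinearMap.ext fun x => opJ_catL _ _ _ _

/-- The binomial theorem in the form needed for merging letters. -/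
theorem sum_merge (X Y Y' : ℚ) (N : ℕ) (g : ℕ → ℕ → Module.End ℚ QA) :
    ∑ p ∈ Finset.HasAntidiagonal.antidiagonal N, ∑ r ∈ Finset.HasAntidiagonal.antidiagonal p.2,
      ((X ^ p.1 * Y ^ r.1 / (r.1.factorial : ℚ)) * (Y' ^ r.2 / (r.2.factorial : ℚ))) •
        g p.1 (r.1 + r.2) =
    ∑ p ∈ Finset.HasAntidiagonal.antidiagonal N, (X ^ p.1 * (Y + Y') ^ p.2 / (p.2.factorial : ℚ)) • g p.1 p.2 := by
  refine Finset.sum_congr rfl fun p _ => ?_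
  have : ∀ r ∈ Finset.HasAntidiagonal.antidiagonal p.2,
      ((X ^ p.1 * Y ^ r.1 / (r.1.factorial : ℚ)) * (Y' ^ r.2 / (r.2.factorial : ℚ))) •
        g p.1 (r.1 + r.2) = ((X ^ p.1 * Y ^ r.1 / (r.1.factorial : ℚ)) *
          (Y' ^ r.2 / (r.2.factorial : ℚ))) • g p.1 p.2 := fun r hr => by
    rw [Finset.HasAntidiagonal.mem_antidiagonal.1 hr]
  rw [Finset.sum_congr rfl this, ← Finset.sum_smul]
  congr 1
  rw [add_pow, Finset.Nat.sum_antidiagonal_eq_sum_range_succ_mk, Finset.mul_sum, Finset.sum_div]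
  refine Finset.sum_congr rfl fun i hi => ?_
  have hi' : i ≤ p.2 := Nat.lt_succ_iff.1 (Finset.mem_range.1 hi)
  rw [Nat.cast_choose ℚ hi']
  have := Nat.factorial_ne_zero p.2
  have := Nat.factorial_ne_zero i
  have := Nat.factorial_ne_zero (p.2 - i)
  field_simp

theorem sum_antidiagonal_left_comm {M : Type*} [AddCommMonoid M] (f : ℕ → ℕ → ℕ → M) (N : ℕ) :
    ∑ x ∈ Finset.HasAntidiagonal.antidiagonal N,
      ∑ i ∈ Finset.HasAntidiagonal.antidiagonal x.2, f x.1 i.1 i.2 =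
    ∑ x ∈ Finset.HasAntidiagonal.antidiagonal N,
      ∑ i ∈ Finset.HasAntidiagonal.antidiagonal x.2, f i.1 x.1 i.2 := by
  rw [Finset.sum_sigma', Finset.sum_sigma']
  refine Finset.sum_nbij' (fun a => ⟨(a.2.1, a.1.1 + a.2.2), (a.1.1, a.2.2)⟩)
    (fun a => ⟨(a.2.1, a.1.1 + a.2.2), (a.1.1, a.2.2)⟩) ?_ ?_ ?_ ?_ ?_ <;>
  · rintro ⟨⟨a, b⟩, ⟨c, d⟩⟩ h
    obtain ⟨h1, h2⟩ := Finset.mem_sigma.1 h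
    replace h1 := Finset.HasAntidiagonal.mem_antidiagonal.1 h1
    replace h2 := Finset.HasAntidiagonal.mem_antidiagonal.1 h2
    dsimp only at h1 h2
    first
    | exact Finset.mem_sigma.2 ⟨Finset.HasAntidiagonal.mem_antidiagonal.2 (by dsimp only; omega),
        Finset.HasAntidiagonal.mem_antidiagonal.2 rfl⟩
    | (subst h2; rfl)

theorem sum_antidiagonal_assoc {M : Type*} [AddCommMonoid M] (f : ℕ → ℕ → ℕ → M) (N : ℕ) :
    ∑ x ∈ Finset.HasAntidiagonal.antidiagonal N,
      ∑ i ∈ Finset.HasAntidiagonal.antidiagonal x.1, f i.1 i.2 x.2 =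
    ∑ x ∈ Finset.HasAntidiagonal.antidiagonal N,
      ∑ i ∈ Finset.HasAntidiagonal.antidiagonal x.2, f x.1 i.1 i.2 := by
  rw [Finset.sum_sigma', Finset.sum_sigma']
  refine Finset.sum_nbij' (fun a => ⟨(a.2.1, a.2.2 + a.1.2), (a.2.2, a.1.2)⟩)
    (fun a => ⟨(a.1.1 + a.2.1, a.2.2), (a.1.1, a.2.1)⟩) ?_ ?_ ?_ ?_ ?_ <;>
  · rintro ⟨⟨a, b⟩, ⟨c, d⟩⟩ h
    obtain ⟨h1, h2⟩ := Finset.mem_sigma.1 h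
    replace h1 := Finset.HasAntidiagonal.mem_antidiagonal.1 h1
    replace h2 := Finset.HasAntidiagonal.mem_antidiagonal.1 h2
    dsimp only at h1 h2
    first
    | exact Finset.mem_sigma.2 ⟨Finset.HasAntidiagonal.mem_antidiagonal.2 (by dsimp only; omega),
        Finset.HasAntidiagonal.mem_antidiagonal.2 rfl⟩
    | (subst h2; rfl)

theorem expV_mul_lam (X Y Y' : ℚ) : expV Y * lam X Y' = lam X (Y + Y') := by
  ext n : 1
  rw [PowerSeries.coeff_mul, lam, lam, PowerSeries.coeff_mk, ← sum_merge,
    ← sum_antidiagonal_left_comm fun a i j =>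
      ((X ^ i * Y ^ a / (a.factorial : ℚ)) * (Y' ^ j / (j.factorial : ℚ))) • catL i (a + j)]
  simp only [expV, PowerSeries.coeff_mk, Finset.mul_sum]
  have h : ∀ a i j, opV a * catL i j = catL i (a + j) := fun a i j =>
    end_ext_op fun x => by rw [opV_catL, add_comm]
  refine Finset.sum_congr rfl fun p _ => Finset.sum_congr rfl fun r _ => ?_
  rw [smul_mul_smul_comm, h]
  congr 1
  ring

/-- Only the summands of the second factor with upper index 1 survive, so `X'` drops out. The second
indices add, and the binomial theorem turns this into the addition of `Y` and `Y'`. -/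
theorem C_opM_mul_lam_mul_lam (X Y X' Y' : ℚ) :
    PowerSeries.C opM * lam X Y * lam X' Y' = lam X (Y + Y') := by
  ext n : 1
  have h : ∀ i j l m, opM * (catL i j * catL l m) = if l = 0 then catL i (j + m) else 0 :=
    fun i j l m => LinearMap.ext fun x => by
      rw [Module.End.mul_apply, Module.End.mul_apply, opM_catL_catL]; split_ifs <;> rfl
  have h0 : ∀ i j N, opM * (catL i j * PowerSeries.coeff N (lam X' Y')) =
      (Y' ^ N / (N.factorial : ℚ)) • catL i (j + N) := by
    intro i j N
    rw [lam, PowerSeries.coeff_mk, Finset.mul_sum, Finset.mul_sum, Finset.sum_eq_single (0, N)]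
    · simp [h]
    · rintro ⟨l, m⟩ hij hne
      rw [Finset.HasAntidiagonal.mem_antidiagonal] at hij
      have : l ≠ 0 := by
        rintro rfl
        simp at hij
        exact hne (by rw [hij])
      simp [h, this]
    · simp
  have hR : PowerSeries.coeff n (lam X (Y + Y')) =
      ∑ x ∈ Finset.HasAntidiagonal.antidiagonal n, ∑ i ∈ Finset.HasAntidiagonal.antidiagonal x.1,
        ((X ^ i.1 * Y ^ i.2 / (i.2.factorial : ℚ)) * (Y' ^ x.2 / (x.2.factorial : ℚ))) •
          catL i.1 (i.2 + x.2) := by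
    rw [lam, PowerSeries.coeff_mk, ← sum_merge, sum_antidiagonal_assoc fun i j m =>
      ((X ^ i * Y ^ j / (j.factorial : ℚ)) * (Y' ^ m / (m.factorial : ℚ))) • catL i (j + m)]
  rw [mul_assoc, PowerSeries.coeff_C_mul, PowerSeries.coeff_mul, hR, Finset.mul_sum]
  refine Finset.sum_congr rfl fun p _ => ?_
  have hL : PowerSeries.coeff p.1 (lam X Y) = ∑ i ∈ Finset.HasAntidiagonal.antidiagonal p.1,
      (X ^ i.1 * Y ^ i.2 / (i.2.factorial : ℚ)) • catL i.1 i.2 := PowerSeries.coeff_mk _ _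
  rw [hL, Finset.sum_mul, Finset.mul_sum]
  refine Finset.sum_congr rfl fun r _ => ?_
  rw [smul_mul_assoc, mul_smul_comm, h0 r.1 r.2 p.2, smul_smul]

/-- The constant series `opE`. -/
noncomputable def eSeries : EndSeries := PowerSeries.C opE

theorem op_mul_opE {θ : Module.End ℚ QA} (h : θ 1 = 0) : θ * opE = 0 :=
  hom_ext_catL (by simp [opE, h]) fun i j w => by simp [opE]

theorem C_mul_eSeries {θ : Module.End ℚ QA} (h : θ 1 = 0) : PowerSeries.C θ * eSeries = 0 := by
  rw [eSeries, ← map_mul, op_mul_opE h, map_zero]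

theorem expV_mul_eSeries (Y : ℚ) : expV Y * eSeries = eSeries := by
  ext n : 1
  rw [eSeries, PowerSeries.coeff_mul_C, expV, PowerSeries.coeff_mk, smul_mul_assoc]
  rcases n with - | n
  · have : opV 0 * opE = opE := hom_ext_catL (by simp [opE, opV_one]) fun i j w => by simp [opE]
    simp [this]
  · rw [op_mul_opE (by simp [opV_one]), PowerSeries.coeff_C]
    simp

theorem C_opM_mul_lam_mul_eSeries (X Y : ℚ) : PowerSeries.C opM * lam X Y * eSeries = 0 := by
  have h : ∀ i j, opM * (catL i j * opE) = 0 := fun i j =>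
    hom_ext_catL (by simp [opE, opM_catL_one]) fun i j w => by simp [opE]
  ext n : 1
  rw [mul_assoc, PowerSeries.coeff_C_mul, eSeries, PowerSeries.coeff_mul_C, lam,
    PowerSeries.coeff_mk, Finset.sum_mul, Finset.mul_sum]
  simp [h]

/-- The generating series at the points `(X_j, Y_j)`, where the list contains the pairs
`(Y_1 + ⋯ + Y_j, X_j)` and `s` is the starting value of the partial sums. -/
noncomputable def bSeries (s : ℚ) : List (ℚ × ℚ) → EndSeries
  | [] => eSeries
  | (S, X) :: P => lam X (S - s) * bSeries S P

/-- Raising the second index of the first letter exponentially changes only the starting value of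
the partial sums. This is the advantage of recording partial sums of the `Y_j` instead of the `Y_j`.
-/
theorem expV_mul_bSeries (y s : ℚ) (P : List (ℚ × ℚ)) :
    expV y * bSeries s P = bSeries (s - y) P := by
  match P with
  | [] => exact expV_mul_eSeries y
  | (S, X) :: P =>
    rw [bSeries, bSeries, ← mul_assoc, expV_mul_lam]
    congr 2
    ring

theorem C_op_mul_mul (θ η : Module.End ℚ QA) (f : EndSeries) :
    PowerSeries.C (θ * η) * f = PowerSeries.C θ * (PowerSeries.C η * f) := by
  rw [map_mul, mul_assoc]

/-- The second coordinate of the first point. -/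
def hdX : List (ℚ × ℚ) → ℚ
  | [] => 0
  | (_, X) :: _ => X

/-- The first coordinate of the last point, or the starting value. -/
def prevS (s : ℚ) : List (ℚ × ℚ) → ℚ
  | [] => s
  | (S, _) :: P => prevS S P

theorem C_opS_mul_bSeries (s : ℚ) (P : List (ℚ × ℚ)) :
    PowerSeries.C opS * bSeries s P = hdX P • (PowerSeries.X * bSeries s P) := by
  match P with
  | [] => rw [bSeries, C_mul_eSeries (op_one 0).1, hdX, zero_smul]
  | (S, X) :: P => rw [bSeries, ← mul_assoc, C_opS_mul_lam, hdX, smul_mul_assoc, mul_assoc]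

/-- In partial-sum coordinates, absorbing `Y_1` into `Y_2` is plain deletion of the first point: the
next difference is then taken from `s` instead of `S`. -/
theorem C_opK_mul_lam_mul_bSeries (s S X : ℚ) (P : List (ℚ × ℚ)) :
    PowerSeries.C opK * bSeries s ((S, X) :: P) = bSeries s P := by
  rw [bSeries, ← mul_assoc, C_opK_mul_lam, expV_mul_bSeries, sub_sub_cancel]

theorem C_opDV_mul_bSeries (s S X : ℚ) (P : List (ℚ × ℚ)) :
    PowerSeries.C opDV * bSeries s ((S, X) :: P) =
      (S - s) • (PowerSeries.X * bSeries s ((S, X) :: P)) := by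
  rw [bSeries, ← mul_assoc, C_opDV_mul_lam, smul_mul_assoc, mul_assoc]

theorem C_opM_mul_bSeries_single (s S X : ℚ) :
    PowerSeries.C opM * bSeries s [(S, X)] = 0 := by
  rw [bSeries, bSeries, ← mul_assoc, C_opM_mul_lam_mul_eSeries]

theorem C_opM_mul_bSeries_cons (s S X S' X' : ℚ) (P : List (ℚ × ℚ)) :
    PowerSeries.C opM * bSeries s ((S, X) :: (S', X') :: P) = bSeries s ((S', X) :: P) := by
  rw [bSeries, bSeries, bSeries, ← mul_assoc, ← mul_assoc, C_opM_mul_lam_mul_lam]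
  congr 2
  ring

theorem C_opJ_mul_bSeries (θ : Module.End ℚ QA) (s S X : ℚ) (P : List (ℚ × ℚ)) :
    PowerSeries.C (opJ θ) * bSeries s ((S, X) :: P) =
      lam X (S - s) * (PowerSeries.C θ * bSeries S P) := by
  rw [bSeries, ← mul_assoc, C_opJ_mul_lam, mul_assoc]

/-! ### `δ` as a sum over splittings of the list of points, and its symmetry -/

/-- The sum of `f u m v` over all splittings `P = u m v` with `m` of length `k`. -/
noncomputable def decSum {α M : Type*} [AddCommMonoid M] (k : ℕ)
    (f : List α → List α → List α → M) (P : List α) : M :=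
  ∑ i ∈ Finset.range (P.length + 1 - k), f (P.take i) ((P.drop i).take k) (P.drop (i + k))

theorem decSum_of_length_lt {α M : Type*} [AddCommMonoid M] {k : ℕ}
    (f : List α → List α → List α → M) {P : List α} (h : P.length < k) : decSum k f P = 0 := by
  rw [decSum, Nat.sub_eq_zero_of_le h, Finset.sum_range_zero]

theorem decSum_cons {α M : Type*} [AddCommMonoid M] {k : ℕ}
    (f : List α → List α → List α → M) (a : α) {P : List α} (h : k ≤ P.length + 1) :
    decSum k f (a :: P) = decSum k (fun u m v => f (a :: u) m v) P +
      f [] ((a :: P).take k) ((a :: P).drop k) := by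
  rw [decSum, List.length_cons, show P.length + 1 + 1 - k = (P.length + 1 - k) + 1 by omega,
    Finset.sum_range_succ', decSum]
  congr 1
  · refine Finset.sum_congr rfl fun i _ => ?_
    rw [show i + 1 + k = (i + k) + 1 by omega]
    rfl
  · simp

theorem mul_decSum {α M : Type*} [NonUnitalNonAssocSemiring M] (k : ℕ)
    (f : List α → List α → List α → M) (c : M) (P : List α) :
    c * decSum k f P = decSum k (fun u m v => c * f u m v) P := Finset.mul_sum _ _ _

theorem map_decSum {α M N : Type*} [AddCommMonoid M] [AddCommMonoid N] (k : ℕ)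
    (f : List α → List α → List α → M) (φ : M →+ N) (P : List α) :
    φ (decSum k f P) = decSum k (fun u m v => φ (f u m v)) P := map_sum _ _ _

/-- Reverse a list of points and exchange the coordinates. -/
def revSwap (P : List (ℚ × ℚ)) : List (ℚ × ℚ) := (P.map Prod.swap).reverse

theorem revSwap_cons (a : ℚ × ℚ) (P : List (ℚ × ℚ)) :
    revSwap (a :: P) = revSwap P ++ [a.swap] := by simp [revSwap]

theorem revSwap_append (P Q : List (ℚ × ℚ)) :
    revSwap (P ++ Q) = revSwap Q ++ revSwap P := by simp [revSwap]

theorem revSwap_revSwap (P : List (ℚ × ℚ)) : revSwap (revSwap P) = P := by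
  simp [revSwap]

theorem length_revSwap (P : List (ℚ × ℚ)) : (revSwap P).length = P.length := by simp [revSwap]

theorem decSum_revSwap {M : Type*} [AddCommMonoid M] (k : ℕ)
    (f : List (ℚ × ℚ) → List (ℚ × ℚ) → List (ℚ × ℚ) → M) (P : List (ℚ × ℚ)) :
    decSum k f (revSwap P) =
      decSum k (fun u m v => f (revSwap v) (revSwap m) (revSwap u)) P := by
  rw [decSum, decSum, length_revSwap, ← Finset.sum_range_reflect]
  refine Finset.sum_congr rfl fun i hi => ?_
  have hi := Finset.mem_range.1 hi
  congr 1
  · rw [revSwap, revSwap, List.take_reverse, List.length_map, List.map_drop]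
    congr 3
    omega
  · rw [revSwap, revSwap, List.drop_reverse, List.take_reverse, List.map_take, List.map_drop,
      List.length_take, List.length_map, List.drop_take]
    congr 2
    · omega
    · congr 2
      omega
  · rw [revSwap, revSwap, List.drop_reverse, List.length_map, List.map_take]
    congr 3
    omega

/-- The coefficient of the unchanged series. -/
def diagCoeff (s : ℚ) : List (ℚ × ℚ) → ℚ
  | [] => 0
  | (S, X) :: P => X * (S - s) + diagCoeff S P

theorem prevS_append (s : ℚ) (P : List (ℚ × ℚ)) (a : ℚ × ℚ) : prevS s (P ++ [a]) = a.1 := by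
  induction P generalizing s with
  | nil => rfl
  | cons b P ih => exact ih b.1

theorem prevS_revSwap (P : List (ℚ × ℚ)) : prevS 0 (revSwap P) = hdX P := by
  match P with
  | [] => rfl
  | (S, X) :: P => rw [revSwap_cons, prevS_append]; rfl

theorem hdX_revSwap (P : List (ℚ × ℚ)) : hdX (revSwap P) = prevS 0 P := by
  rw [← prevS_revSwap, revSwap_revSwap]

theorem diagCoeff_append (s : ℚ) (P : List (ℚ × ℚ)) (a : ℚ × ℚ) :
    diagCoeff s (P ++ [a]) = diagCoeff s P + a.2 * (a.1 - prevS s P) := by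
  induction P generalizing s with
  | nil => simp [diagCoeff, prevS]
  | cons b P ih =>
    rw [List.cons_append, diagCoeff, ih, diagCoeff, prevS, add_assoc]

/-- Summation by parts: `∑ X_j (S_j - S_{j-1})` equals `∑ S_j (X_j - X_{j+1})` up to the boundary
term at the starting value. -/
theorem diagCoeff_eq (s : ℚ) (P : List (ℚ × ℚ)) :
    diagCoeff s P = diagCoeff 0 (revSwap P) - s * hdX P := by
  induction P generalizing s with
  | nil => simp [diagCoeff, revSwap, hdX]
  | cons a P ih =>
    obtain ⟨S, X⟩ := a
    rw [revSwap_cons, diagCoeff_append, diagCoeff, ih S, prevS_revSwap, hdX]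
    simp only [Prod.swap]
    ring

theorem diagCoeff_revSwap (P : List (ℚ × ℚ)) : diagCoeff 0 (revSwap P) = diagCoeff 0 P := by
  rw [diagCoeff_eq 0 P, zero_mul, sub_zero]

section

variable {M : Type*} [AddCommGroup M] [Module ℚ M]

/-- The terms in which one point is removed. -/
def term₁ (g : ℕ → List (ℚ × ℚ) → M) (s : ℚ) (u m v : List (ℚ × ℚ)) : M :=
  match m with
  | [a] => (-(1 / 2) * (a.2 - hdX v + (a.1 - prevS s u)) : ℚ) • g 1 (u ++ v)
  | _ => 0

/-- The terms in which two neighbouring points are removed or merged. -/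
def term₂ (g : ℕ → List (ℚ × ℚ) → M) (u m v : List (ℚ × ℚ)) : M :=
  match m with
  | [a, b] => (1 / 4 : ℚ) • g 0 (u ++ v) -
      (1 / 2 * (a.2 - b.2 + (b.1 - a.1)) : ℚ) • g 1 (u ++ (b.1, a.2) :: v)
  | _ => 0

/-- The terms in which three neighbouring points are merged. -/
def term₃ (g : ℕ → List (ℚ × ℚ) → M) (u m v : List (ℚ × ℚ)) : M :=
  match m with
  | [a, _, c] => (-(1 / 4) : ℚ) • g 0 (u ++ (c.1, a.2) :: v)
  | _ => 0

/-- The action of `δ` on generating series. -/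
noncomputable def deltaSum (g : ℕ → List (ℚ × ℚ) → M) (s : ℚ) (P : List (ℚ × ℚ)) : M :=
  diagCoeff s P • g 2 P + decSum 1 (term₁ g s) P + decSum 2 (term₂ g) P + decSum 3 (term₃ g) P

/-- Reversing and exchanging coordinates interchanges the differences `X_j - X_{j+1}` and `S_j -
S_{j-1}`, and every coefficient is a sum of one of each kind. The merged point of a block takes `S`
from its last and `X` from its first point, which is the same rule for the reversed block. The
diagonal coefficient is handled by summation by parts. -/
theorem deltaSum_revSwap (g : ℕ → List (ℚ × ℚ) → M) (P : List (ℚ × ℚ)) :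
    deltaSum g 0 (revSwap P) = deltaSum (fun n Q => g n (revSwap Q)) 0 P := by
  rw [deltaSum, deltaSum, diagCoeff_revSwap, decSum_revSwap, decSum_revSwap, decSum_revSwap]
  congr 2
  · congr 2
    funext u m v
    match m with
    | [] => rfl
    | [a] =>
      change term₁ g 0 (revSwap v) [a.swap] (revSwap u) = _
      simp only [term₁, prevS_revSwap, hdX_revSwap, revSwap_append, Prod.swap]
      congr 1
      ring
    | a :: b :: m =>
      -- For a block of the wrong length both sides are zero; the pattern match only reduces once
      -- the shape of the reversed block is exposed.
      have : ∃ c d m', revSwap (a :: b :: m) = c :: d :: m' := by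
        have h := length_revSwap (a :: b :: m)
        match revSwap (a :: b :: m), h with
        | c :: d :: m', _ => exact ⟨c, d, m', rfl⟩
      obtain ⟨c, d, m', h⟩ := this
      rw [h]
      rfl
  · congr 1
    funext u m v
    match m with
    | [] => rfl
    | [a] => rfl
    | [a, b] =>
      change term₂ g (revSwap v) [b.swap, a.swap] (revSwap u) = _
      simp only [term₂, revSwap_append, revSwap_cons, Prod.swap, List.append_assoc,
        List.singleton_append]
      congr 2
      ring
    | a :: b :: c :: m =>
      have : ∃ d e f m', revSwap (a :: b :: c :: m) = d :: e :: f :: m' := by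
        have h := length_revSwap (a :: b :: c :: m)
        match revSwap (a :: b :: c :: m), h with
        | d :: e :: f :: m', _ => exact ⟨d, e, f, m', rfl⟩
      obtain ⟨d, e, f, m', h⟩ := this
      rw [h]
      rfl
  · funext u m v
    match m with
    | [] => rfl
    | [a] => rfl
    | [a, b] => rfl
    | [a, b, c] =>
      change term₃ g (revSwap v) [c.swap, b.swap, a.swap] (revSwap u) = _
      simp only [term₃, revSwap_append, revSwap_cons, Prod.swap, List.append_assoc,
        List.singleton_append]
    | a :: b :: c :: d :: m =>
      have : ∃ x y z w m', revSwap (a :: b :: c :: d :: m) = x :: y :: z :: w :: m' := by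
        have h := length_revSwap (a :: b :: c :: d :: m)
        match revSwap (a :: b :: c :: d :: m), h with
        | x :: y :: z :: w :: m', _ => exact ⟨x, y, z, w, m', rfl⟩
      obtain ⟨x, y, z, w, m', h⟩ := this
      rw [h]
      rfl

theorem map_deltaSum {N : Type*} [AddCommGroup N] [Module ℚ N] (φ : M →ₗ[ℚ] N)
    (g : ℕ → List (ℚ × ℚ) → M) (s : ℚ) (P : List (ℚ × ℚ)) :
    φ (deltaSum g s P) = deltaSum (fun n Q => φ (g n Q)) s P := by
  have h1 : ∀ k f, φ (decSum k f P) = decSum k (fun u m v => φ (f u m v)) P :=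
    fun k f => map_decSum k f φ.toAddMonoidHom P
  rw [deltaSum, deltaSum, map_add, map_add, map_add, map_smul, h1, h1, h1]
  congr 2
  · congr 2
    funext u m v
    unfold term₁
    split <;> simp
  · congr 1
    funext u m v
    unfold term₂
    split <;> simp
  · funext u m v
    unfold term₃
    split <;> simp

end

theorem C_smul_mul (c : ℚ) (θ : Module.End ℚ QA) (f : EndSeries) :
    PowerSeries.C (c • θ) * f = c • (PowerSeries.C θ * f) := by
  ext n : 1
  rw [PowerSeries.coeff_C_mul, PowerSeries.coeff_smul, PowerSeries.coeff_C_mul, smul_mul_assoc]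

/-- The generating series in the form in which `deltaSum` uses it. -/
noncomputable def bPow (s : ℚ) (n : ℕ) (P : List (ℚ × ℚ)) : EndSeries :=
  PowerSeries.X ^ n * bSeries s P

theorem C_mul_X_mul (θ : Module.End ℚ QA) (g : EndSeries) :
    PowerSeries.C θ * (PowerSeries.X * g) = PowerSeries.X * (PowerSeries.C θ * g) := by
  rw [← mul_assoc, ← X_mul_comm, mul_assoc]

theorem lam_mul_X_mul (X Y : ℚ) (g : EndSeries) :
    lam X Y * (PowerSeries.X * g) = PowerSeries.X * (lam X Y * g) := by
  rw [← mul_assoc, ← X_mul_comm, mul_assoc]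

theorem C_deltaHeadQA_mul (f : EndSeries) :
    PowerSeries.C deltaHeadQA * f =
      PowerSeries.C opS * (PowerSeries.C opDV * f) - (1 / 2 : ℚ) •
        (PowerSeries.C opK * (PowerSeries.C opS * f) - PowerSeries.C opS * (PowerSeries.C opK * f) +
          PowerSeries.C opK * (PowerSeries.C opDV * f)) +
      (1 / 4 : ℚ) • (PowerSeries.C opK * (PowerSeries.C opK * f)) - (1 / 2 : ℚ) •
        (PowerSeries.C opS * (PowerSeries.C opM * f) -
          PowerSeries.C opM * (PowerSeries.C (opJ opS) * f) +
          PowerSeries.C opM * (PowerSeries.C (opJ opDV) * f)) -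
      (1 / 4 : ℚ) • (PowerSeries.C opM * (PowerSeries.C opM * f)) := by
  rw [deltaHeadQA_eq_op]
  simp only [map_sub, map_add, sub_mul, add_mul, C_smul_mul, C_op_mul_mul]

theorem C_deltaHeadQA_mul_bSeries_single (s : ℚ) (a : ℚ × ℚ) :
    PowerSeries.C deltaHeadQA * bSeries s [a] =
      (a.2 * (a.1 - s)) • bPow s 2 [a] + term₁ (bPow s) s [] [a] [] := by
  obtain ⟨S, X⟩ := a
  have e1 : ∀ s, bSeries s [] = eSeries := fun _ => rfl
  have hK : PowerSeries.C opK * eSeries = 0 := C_mul_eSeries (op_one 0).2.1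
  have hS : PowerSeries.C opS * eSeries = 0 := C_mul_eSeries (op_one 0).1
  have hD : PowerSeries.C opDV * eSeries = 0 := C_mul_eSeries (op_one 0).2.2.1
  rw [C_deltaHeadQA_mul]
  simp only [C_opDV_mul_bSeries, C_opS_mul_bSeries, C_opK_mul_lam_mul_bSeries,
    C_opJ_mul_bSeries, mul_smul_comm, C_mul_X_mul, C_opM_mul_bSeries_single, hdX, e1, hK, hS, hD,
    mul_zero, smul_zero, term₁, List.nil_append, bPow, pow_one, prevS, pow_two, mul_assoc]
  module

/-- One factor `opM` of its square is left unevaluated, since the result depends on whether a third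
point exists. -/
theorem C_deltaHeadQA_mul_bSeries_cons (s : ℚ) (a b : ℚ × ℚ) (P : List (ℚ × ℚ)) :
    PowerSeries.C deltaHeadQA * bSeries s (a :: b :: P) =
      (a.2 * (a.1 - s)) • bPow s 2 (a :: b :: P) + term₁ (bPow s) s [] [a] (b :: P) +
      term₂ (bPow s) [] [a, b] P - (1 / 4 : ℚ) • (PowerSeries.C opM * bSeries s ((b.1, a.2) :: P)) := by
  obtain ⟨S, X⟩ := a
  obtain ⟨S', X'⟩ := b
  have h1 : PowerSeries.C opM * (lam X (S - s) * bSeries S ((S', X') :: P)) =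
      bSeries s ((S', X) :: P) := C_opM_mul_bSeries_cons s S X S' X' P
  rw [C_deltaHeadQA_mul]
  simp only [C_opDV_mul_bSeries, C_opS_mul_bSeries, C_opK_mul_lam_mul_bSeries,
    C_opJ_mul_bSeries, mul_smul_comm, C_mul_X_mul, lam_mul_X_mul, C_opM_mul_bSeries_cons, hdX, h1,
    term₁, term₂, List.nil_append, bPow, pow_one, pow_zero, one_mul, prevS, pow_two, mul_assoc]
  module

theorem lam_mul_bPow (s S X : ℚ) (n : ℕ) (P : List (ℚ × ℚ)) :
    lam X (S - s) * bPow S n P = bPow s n ((S, X) :: P) := by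
  rw [bPow, bPow, bSeries, ← mul_assoc, ← mul_assoc]
  congr 1
  exact ((PowerSeries.commute_X_pow _ n).eq)

theorem C_deltaQA_mul_lam (X Y : ℚ) :
    PowerSeries.C deltaQA * lam X Y =
      lam X Y * PowerSeries.C deltaQA + PowerSeries.C deltaHeadQA * lam X Y := by
  ext n : 1
  rw [map_add, PowerSeries.coeff_C_mul, PowerSeries.coeff_mul_C, PowerSeries.coeff_C_mul, lam,
    PowerSeries.coeff_mk, Finset.mul_sum, Finset.sum_mul, Finset.mul_sum, ← Finset.sum_add_distrib]
  refine Finset.sum_congr rfl fun p _ => ?_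
  rw [mul_smul_comm, smul_mul_assoc, mul_smul_comm, ← smul_add]
  congr 1
  exact LinearMap.ext fun x => deltaQA_cons _ x

/-- Splittings of a nonempty list with nonempty prefix correspond to `δ` acting behind the first
letter, those with empty prefix to the head terms. The number of remaining points decides which
block lengths occur at the head. -/
theorem C_deltaQA_mul_bSeries (s : ℚ) (P : List (ℚ × ℚ)) :
    PowerSeries.C deltaQA * bSeries s P = deltaSum (bPow s) s P := by
  induction P generalizing s with
  | nil =>
    rw [bSeries, C_mul_eSeries deltaQA_one, deltaSum, decSum_of_length_lt _ (by simp),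
      decSum_of_length_lt _ (by simp), decSum_of_length_lt _ (by simp), diagCoeff]
    simp
  | cons a P ih =>
    obtain ⟨S, X⟩ := a
    have h1 : lam X (S - s) * decSum 1 (term₁ (bPow S) S) P =
        decSum 1 (fun u m v => term₁ (bPow s) s ((S, X) :: u) m v) P := by
      rw [mul_decSum]
      congr 1
      funext u m v
      unfold term₁
      split
      · rw [mul_smul_comm, lam_mul_bPow]; rfl
      · exact mul_zero _
    have h2 : lam X (S - s) * decSum 2 (term₂ (bPow S)) P =
        decSum 2 (fun u m v => term₂ (bPow s) ((S, X) :: u) m v) P := by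
      rw [mul_decSum]
      congr 1
      funext u m v
      unfold term₂
      split
      · rw [mul_sub, mul_smul_comm, mul_smul_comm, lam_mul_bPow, lam_mul_bPow]; rfl
      · exact mul_zero _
    have h3 : lam X (S - s) * decSum 3 (term₃ (bPow S)) P =
        decSum 3 (fun u m v => term₃ (bPow s) ((S, X) :: u) m v) P := by
      rw [mul_decSum]
      congr 1
      funext u m v
      unfold term₃
      split
      · rw [mul_smul_comm, lam_mul_bPow]; rfl
      · exact mul_zero _
    have h4 : PowerSeries.C deltaQA * bSeries s ((S, X) :: P) =
        lam X (S - s) * deltaSum (bPow S) S P +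
          PowerSeries.C deltaHeadQA * bSeries s ((S, X) :: P) := by
      rw [← ih, bSeries, ← mul_assoc, C_deltaQA_mul_lam, add_mul, mul_assoc, mul_assoc]
    rw [h4, deltaSum, mul_add, mul_add, mul_add, mul_smul_comm, lam_mul_bPow, h1, h2, h3, deltaSum,
      decSum_cons (k := 1) _ _ (by omega), diagCoeff]
    match P with
    | [] =>
      rw [C_deltaHeadQA_mul_bSeries_single, decSum_of_length_lt (k := 2) _ (by simp),
        decSum_of_length_lt (k := 3) _ (by simp), decSum_of_length_lt (k := 2) _ (by simp),
        decSum_of_length_lt (k := 3) _ (by simp), List.take_succ_cons, List.drop_succ_cons]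
      simp only [List.take_zero, List.drop_zero]
      module
    | [b] =>
      rw [C_deltaHeadQA_mul_bSeries_cons, decSum_cons (k := 2) _ (S, X) (by simp),
        decSum_of_length_lt (k := 3) _ (by simp),
        decSum_of_length_lt (k := 3) _ (by simp), C_opM_mul_bSeries_single]
      simp only [List.take_zero, List.drop_zero, List.take_succ_cons, List.drop_succ_cons]
      module
    | b :: c :: P =>
      obtain ⟨S', X'⟩ := b
      obtain ⟨S'', X''⟩ := c
      rw [C_deltaHeadQA_mul_bSeries_cons, decSum_cons (k := 2) _ (S, X) (by simp),
        decSum_cons (k := 3) _ (S, X) (by simp), C_opM_mul_bSeries_cons]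
      have h5 : term₃ (bPow s) [] [(S, X), (S', X'), (S'', X'')] P =
          (-(1 / 4) : ℚ) • bSeries s ((S'', X) :: P) := by
        simp [term₃, bPow]
      simp only [List.take_zero, List.drop_zero, List.take_succ_cons, List.drop_succ_cons, h5]
      module

/-- The coefficients of the generating series. -/
noncomputable def genCoeff (N : ℕ) (P : List (ℚ × ℚ)) : QA :=
  PowerSeries.coeff N (bSeries 0 P) 1

/-- The coefficients of the shifted generating series. -/
noncomputable def shiftCoeff (N n : ℕ) (P : List (ℚ × ℚ)) : QA :=
  if n ≤ N then genCoeff (N - n) P else 0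

theorem deltaQA_genCoeff (N : ℕ) (P : List (ℚ × ℚ)) :
    deltaQA (genCoeff N P) = deltaSum (shiftCoeff N) 0 P := by
  let φ : EndSeries →ₗ[ℚ] QA :=
    { toFun := fun f => (PowerSeries.coeff N f : Module.End ℚ QA) 1
      map_add' := fun f g => by rw [map_add, LinearMap.add_apply]
      map_smul' := fun c f => by
        rw [PowerSeries.coeff_smul, LinearMap.smul_apply, RingHom.id_apply] }
  have h : φ (PowerSeries.C deltaQA * bSeries 0 P) = deltaQA (genCoeff N P) := by
    change (PowerSeries.coeff N (PowerSeries.C deltaQA * bSeries 0 P) : Module.End ℚ QA) 1 = _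
    rw [PowerSeries.coeff_C_mul]
    rfl
  rw [← h, C_deltaQA_mul_bSeries]
  refine (map_deltaSum φ (bPow 0) 0 P).trans ?_
  congr 1
  funext n Q
  change (PowerSeries.coeff N (PowerSeries.X ^ n * bSeries 0 Q) : Module.End ℚ QA) 1 = _
  rw [PowerSeries.coeff_X_pow_mul', shiftCoeff]
  split_ifs <;> rfl

/-! ### Evaluations -/

/-- Evaluate the first letter at the point `(u, v)`. -/
noncomputable def evalHead (a : ℚ × ℚ) : QA →ₗ[ℚ] QA := ofWords fun
  | [] => 0
  | (k, d) :: w => (a.1 ^ d * a.2 ^ k.natPred / (k.natPred.factorial : ℚ)) • word w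

/-- The coefficient of a word. -/
noncomputable def coeffWord (w : Word) : QA →ₗ[ℚ] ℚ := ofWords fun v => if v = w then 1 else 0

/-- Evaluate all letters at the points `(u, v)` of a list. -/
noncomputable def evalAt : List (ℚ × ℚ) → QA →ₗ[ℚ] ℚ
  | [] => coeffWord []
  | a :: p => evalAt p ∘ₗ evalHead a

theorem coeffWord_apply (w : Word) (x : QA) : coeffWord w x = (show Word →₀ ℚ from x) w := by
  have : coeffWord w = (Finsupp.lapply w : (Word →₀ ℚ) →ₗ[ℚ] ℚ) := hom_ext fun v => by
    rw [coeffWord, ofWords_word]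
    exact (Finsupp.single_apply).symm
  rw [this]
  rfl

theorem QA_ext {x y : QA} (h : ∀ w, coeffWord w x = coeffWord w y) : x = y := by
  simp only [coeffWord_apply] at h
  exact Finsupp.ext h

/-- The evaluations of a series in one letter as a polynomial. -/
noncomputable def headPoly (w : Word) : QA →ₗ[ℚ] MvPolynomial Bool ℚ := ofWords fun
  | [] => 0
  | (k, d) :: v => if v = w then
      MvPolynomial.monomial (Finsupp.single true d + Finsupp.single false k.natPred)
        (1 / (k.natPred.factorial : ℚ)) else 0

theorem eval_headPoly (w : Word) (g : Bool → ℚ) (x : QA) :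
    MvPolynomial.eval g (headPoly w x) = coeffWord w (evalHead (g true, g false) x) := by
  have : (MvPolynomial.aeval g).toLinearMap ∘ₗ headPoly w =
      coeffWord w ∘ₗ evalHead (g true, g false) := hom_ext fun v => by
    match v with
    | [] => simp [headPoly, evalHead]
    | (k, d) :: v =>
      simp only [LinearMap.comp_apply, headPoly, evalHead, ofWords_word, coeffWord, map_smul]
      split_ifs
      · simp [Finsupp.prod_add_index', pow_add,
          MvPolynomial.aeval_monomial]
        ring
      · simp
  have := LinearMap.congr_fun this x
  simpa [MvPolynomial.aeval_eq_eval] using this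

theorem coeff_headPoly (w : Word) (k : ℕ+) (d : ℕ) (x : QA) :
    MvPolynomial.coeff (Finsupp.single true d + Finsupp.single false k.natPred) (headPoly w x) =
      coeffWord ((k, d) :: w) x / (k.natPred.factorial : ℚ) := by
  have : MvPolynomial.lcoeff ℚ (Finsupp.single true d + Finsupp.single false k.natPred) ∘ₗ
      headPoly w = (1 / (k.natPred.factorial : ℚ)) • coeffWord ((k, d) :: w) := hom_ext fun v => by
    match v with
    | [] => simp [headPoly, coeffWord]
    | (l, e) :: v =>
      simp only [LinearMap.comp_apply, headPoly, ofWords_word, coeffWord, LinearMap.smul_apply,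
        List.cons.injEq, Prod.mk.injEq]
      by_cases hv : v = w
      · simp only [hv, if_true, and_true, MvPolynomial.lcoeff_apply, MvPolynomial.coeff_monomial]
        have : (Finsupp.single true e + Finsupp.single false l.natPred : Bool →₀ ℕ) =
            Finsupp.single true d + Finsupp.single false k.natPred ↔ l = k ∧ e = d := by
          constructor
          · intro h
            have h1 := DFunLike.congr_fun h true
            have h2 := DFunLike.congr_fun h false
            simp at h1 h2
            exact ⟨by rw [← PNat.succPNat_natPred l, h2, PNat.succPNat_natPred], h1⟩
          · rintro ⟨rfl, rfl⟩; rfl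
        rw [if_congr this rfl rfl]
        split_ifs with h
        · rw [h.1]; simp
        · simp
      · simp [hv]
  have := LinearMap.congr_fun this x
  simp only [LinearMap.comp_apply, MvPolynomial.lcoeff_apply, LinearMap.smul_apply,
    smul_eq_mul] at this
  rw [this]
  ring

/-- As a function of the point assigned to the first letter, the evaluation is a polynomial over the
infinite field `ℚ`; if it vanishes everywhere, its coefficients vanish. Induction on the length
peels off one letter at a time. -/
theorem coeffWord_eq_zero_of_evalAt (r : ℕ) (x : QA)
    (h : ∀ p : List (ℚ × ℚ), p.length = r → evalAt p x = 0) (w : Word) (hw : w.length = r) :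
    coeffWord w x = 0 := by
  induction r generalizing x w with
  | zero =>
    rw [List.length_eq_zero_iff.1 hw]
    exact h [] rfl
  | succ r ih =>
    match w, hw with
    | (k, d) :: w, hw =>
      have h1 : headPoly w x = 0 := MvPolynomial.funext fun g => by
        rw [eval_headPoly, map_zero]
        exact ih _ (fun p hp => h ((g true, g false) :: p) (by simp [hp])) w (by simpa using hw)
      have h2 := coeff_headPoly w k d x
      rw [h1, MvPolynomial.coeff_zero] at h2
      exact (div_eq_zero_iff.1 h2.symm).resolve_right
        (Nat.cast_ne_zero.2 (Nat.factorial_ne_zero k.natPred))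

theorem ext_evalAt {x y : QA} (h : ∀ p, evalAt p x = evalAt p y) : x = y := by
  rw [← sub_eq_zero]
  refine QA_ext fun w => ?_
  rw [map_zero]
  refine coeffWord_eq_zero_of_evalAt w.length _ (fun p _ => ?_) w rfl
  rw [map_sub, h, sub_self]

theorem evalAt_catL (a : ℚ × ℚ) (p : List (ℚ × ℚ)) (i j : ℕ) (x : QA) :
    evalAt (a :: p) (catL i j x) = a.1 ^ j * a.2 ^ i / (i.factorial : ℚ) * evalAt p x := by
  have : evalAt (a :: p) ∘ₗ catL i j = (a.1 ^ j * a.2 ^ i / (i.factorial : ℚ)) • evalAt p :=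
    hom_ext fun w => by simp [evalAt, catL, evalHead]
  exact LinearMap.congr_fun this x

theorem evalAt_cons_one (a : ℚ × ℚ) (p : List (ℚ × ℚ)) : evalAt (a :: p) 1 = 0 := by
  rw [← word_nil]
  simp [evalAt, evalHead]

theorem evalAt_nil_one : evalAt [] 1 = 1 := by
  rw [← word_nil]
  simp [evalAt, coeffWord]

theorem evalAt_nil_catL (i j : ℕ) (x : QA) : evalAt [] (catL i j x) = 0 := by
  have : evalAt [] ∘ₗ catL i j = 0 := hom_ext fun w => by simp [evalAt, catL, coeffWord]
  exact LinearMap.congr_fun this x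

/-! ### Pairing of points -/

/-- The pairing between the points of an evaluation and the points of a generating series. -/
def pairing (s : ℚ) : List (ℚ × ℚ) → List (ℚ × ℚ) → ℚ
  | (u, v) :: p, (S, X) :: P => v * X + u * (S - s) + pairing S p P
  | _, _ => 0

/-- The first coordinate of the first point. -/
def hdU : List (ℚ × ℚ) → ℚ
  | [] => 0
  | (u, _) :: _ => u

/-- Partial sums of the second, and differences of the first coordinates. -/
def conjAux (c : ℚ) : List (ℚ × ℚ) → List (ℚ × ℚ)
  | [] => []
  | (u, v) :: p => (c + v, u - hdU p) :: conjAux (c + v) p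

/-- The conjugate list of points. -/
def conj (p : List (ℚ × ℚ)) : List (ℚ × ℚ) := (conjAux 0 p).reverse

theorem length_conjAux (c : ℚ) (p : List (ℚ × ℚ)) : (conjAux c p).length = p.length := by
  induction p generalizing c with
  | nil => rfl
  | cons a p ih => simp [conjAux, ih]

theorem length_conj (p : List (ℚ × ℚ)) : (conj p).length = p.length := by
  rw [conj, List.length_reverse, length_conjAux]

theorem pairing_eq_sub (s : ℚ) (p P : List (ℚ × ℚ)) (h : p.length = P.length) :
    pairing s p P = pairing 0 p P - s * hdU p := by
  match p, P, h with
  | [], [], _ => simp [pairing, hdU]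
  | (u, v) :: p, (S, X) :: P, h => simp only [pairing, hdU]; ring

/-- Summation by parts moves the differencing from the `S_j` to the `u_j`, while the `v_j` are
rewritten as differences of their partial sums. -/
theorem pairing_conjAux (c s : ℚ) (p P : List (ℚ × ℚ)) (h : p.length = P.length) :
    pairing s p P = pairing c (P.map Prod.swap) (conjAux c p) - s * hdU p := by
  induction p generalizing c s P with
  | nil =>
    match P, h with
    | [], _ => simp [pairing, hdU]
  | cons a p ih =>
    match P, h with
    | (S, X) :: P, h =>
      obtain ⟨u, v⟩ := a
      rw [pairing, conjAux, List.map_cons, Prod.swap, pairing, ih (c + v) S P (by simpa using h)]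
      change _ = _ - s * u
      ring

theorem pairing_append (s : ℚ) (p P : List (ℚ × ℚ)) (a b : ℚ × ℚ) (h : p.length = P.length) :
    pairing s (p ++ [a]) (P ++ [b]) = pairing s p P + (a.2 * b.2 + a.1 * (b.1 - prevS s P)) := by
  induction p generalizing s P with
  | nil =>
    match P, h with
    | [], _ => simp [pairing, prevS]
  | cons c p ih =>
    match P, h with
    | (S, X) :: P, h =>
      simp only [List.cons_append, pairing, prevS]
      rw [ih S P (by simpa using h)]
      ring

theorem prevS_reverse (P : List (ℚ × ℚ)) : prevS 0 P.reverse = hdU P := by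
  match P with
  | [] => rfl
  | (S, X) :: P => rw [List.reverse_cons, prevS_append]; rfl

theorem pairing_reverse (p P : List (ℚ × ℚ)) (h : p.length = P.length) :
    pairing 0 p.reverse P.reverse = pairing 0 P p := by
  induction p generalizing P with
  | nil =>
    match P, h with
    | [], _ => simp [pairing]
  | cons a p ih =>
    match P, h with
    | b :: P, h =>
      have h' : p.length = P.length := by simpa using h
      obtain ⟨S, X⟩ := b
      rw [List.reverse_cons, List.reverse_cons, pairing_append _ _ _ _ _ (by simpa using h'), ih P h',
        prevS_reverse, pairing, pairing_eq_sub a.1 P p h'.symm]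
      ring

/-- This adjointness translates the swap of generating series into conjugation of evaluation points.
-/
theorem pairing_conj (p P : List (ℚ × ℚ)) (h : p.length = P.length) :
    pairing 0 (conj p) P = pairing 0 p (revSwap P) := by
  have h1 := pairing_reverse (conjAux 0 p) P.reverse (by rw [length_conjAux, h, List.length_reverse])
  rw [List.reverse_reverse] at h1
  rw [conj, h1, pairing_conjAux 0 0 p (revSwap P) (by rw [h, length_revSwap]), zero_mul, sub_zero]
  congr 1
  simp [revSwap]

theorem sum_add_pow_div_factorial (x y : ℚ) (N : ℕ) :
    ∑ a ∈ Finset.HasAntidiagonal.antidiagonal N,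
      x ^ a.1 / (a.1.factorial : ℚ) * (y ^ a.2 / (a.2.factorial : ℚ)) =
        (x + y) ^ N / (N.factorial : ℚ) := by
  rw [add_pow, Finset.Nat.sum_antidiagonal_eq_sum_range_succ_mk, Finset.sum_div]
  refine Finset.sum_congr rfl fun i hi => ?_
  have hi' : i ≤ N := Nat.lt_succ_iff.1 (Finset.mem_range.1 hi)
  rw [Nat.cast_choose ℚ hi']
  have := Nat.factorial_ne_zero N
  have := Nat.factorial_ne_zero i
  have := Nat.factorial_ne_zero (N - i)
  field_simp

/-- The coefficients of the generating series with starting value `s`. -/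
theorem coeff_bSeries_cons (s : ℚ) (b : ℚ × ℚ) (P : List (ℚ × ℚ)) (N : ℕ) :
    (PowerSeries.coeff N (bSeries s (b :: P)) : Module.End ℚ QA) 1 =
      ∑ a ∈ Finset.HasAntidiagonal.antidiagonal N,
        ∑ i ∈ Finset.HasAntidiagonal.antidiagonal a.1,
          (b.2 ^ i.1 * (b.1 - s) ^ i.2 / (i.2.factorial : ℚ)) •
            catL i.1 i.2 ((PowerSeries.coeff a.2 (bSeries b.1 P) : Module.End ℚ QA) 1) := by
  obtain ⟨S, X⟩ := b
  rw [bSeries, PowerSeries.coeff_mul, LinearMap.sum_apply]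
  refine Finset.sum_congr rfl fun a _ => ?_
  rw [lam, PowerSeries.coeff_mk, Finset.sum_mul, LinearMap.sum_apply]
  rfl

theorem coeff_bSeries_nil (s : ℚ) (N : ℕ) :
    (PowerSeries.coeff N (bSeries s []) : Module.End ℚ QA) 1 = if N = 0 then 1 else 0 := by
  rw [bSeries, eSeries, PowerSeries.coeff_C]
  split_ifs
  · simp [opE]
  · rfl

/-- Evaluating the letter series `∑ X^i Y^j / j! · (i+1, j)` at `(u, v)` gives `exp(v X + u Y)`,
because the evaluation supplies the missing `1 / i!`. The whole series becomes the exponential of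
the pairing, read off in degree `N`. -/
theorem evalAt_coeff_bSeries (s : ℚ) (p P : List (ℚ × ℚ)) (h : p.length = P.length) (N : ℕ) :
    evalAt p ((PowerSeries.coeff N (bSeries s P) : Module.End ℚ QA) 1) =
      pairing s p P ^ N / (N.factorial : ℚ) := by
  induction p generalizing s P N with
  | nil =>
    match P, h with
    | [], _ =>
      rw [coeff_bSeries_nil]
      split_ifs with hN
      · simp [hN, evalAt_nil_one]
      · simp [pairing, hN]
  | cons a p ih =>
    match P, h with
    | b :: P, h =>
      have h' : p.length = P.length := by simpa using h
      obtain ⟨S, X⟩ := b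
      rw [coeff_bSeries_cons, map_sum, pairing, ← sum_add_pow_div_factorial]
      refine Finset.sum_congr rfl fun c _ => ?_
      rw [map_sum, ← sum_add_pow_div_factorial, Finset.sum_mul]
      refine Finset.sum_congr rfl fun i _ => ?_
      rw [map_smul, evalAt_catL, ih _ P h', smul_eq_mul, mul_pow, mul_pow]
      ring

theorem evalAt_coeff_bSeries_of_ne (s : ℚ) (p P : List (ℚ × ℚ)) (h : p.length ≠ P.length) (N : ℕ) :
    evalAt p ((PowerSeries.coeff N (bSeries s P) : Module.End ℚ QA) 1) = 0 := by
  induction P generalizing s p N with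
  | nil =>
    match p, h with
    | a :: p, _ =>
      rw [coeff_bSeries_nil]
      split_ifs <;> simp [evalAt_cons_one]
  | cons b P ih =>
    rw [coeff_bSeries_cons, map_sum]
    refine Finset.sum_eq_zero fun c _ => ?_
    rw [map_sum]
    refine Finset.sum_eq_zero fun i _ => ?_
    match p, h with
    | [], _ => rw [map_smul, evalAt_nil_catL, smul_zero]
    | a :: p, h =>
      rw [map_smul, evalAt_catL, ih _ _ (by simpa using h), mul_zero, smul_zero]

theorem evalAt_conj_genCoeff (p P : List (ℚ × ℚ)) (N : ℕ) :
    evalAt (conj p) (genCoeff N P) = evalAt p (genCoeff N (revSwap P)) := by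
  by_cases h : p.length = P.length
  · rw [genCoeff, genCoeff, evalAt_coeff_bSeries _ _ _ (by rw [length_conj, h]),
      evalAt_coeff_bSeries _ _ _ (by rw [length_revSwap, h]), pairing_conj p P h]
  · rw [genCoeff, genCoeff, evalAt_coeff_bSeries_of_ne _ _ _ (by rwa [length_conj]),
      evalAt_coeff_bSeries_of_ne _ _ _ (by rwa [length_revSwap])]

/-! ### The generating series span -/

theorem polynomial_coeff_eq_zero (N : ℕ) (c : ℕ → ℕ → ℚ)
    (h : ∀ X Y : ℚ, ∑ a ∈ Finset.range (N + 1), ∑ i ∈ Finset.HasAntidiagonal.antidiagonal a,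
      X ^ i.1 * Y ^ i.2 * c i.1 i.2 = 0) (i j : ℕ) (hij : i + j ≤ N) : c i j = 0 := by
  let e : ℕ × ℕ → Bool →₀ ℕ := fun i => Finsupp.single true i.1 + Finsupp.single false i.2
  have he : Function.Injective e := fun x y hxy => by
    have h1 := DFunLike.congr_fun hxy true
    have h2 := DFunLike.congr_fun hxy false
    simp [e] at h1 h2
    exact Prod.ext h1 h2
  let f : MvPolynomial Bool ℚ := ∑ a ∈ Finset.range (N + 1),
    ∑ i ∈ Finset.HasAntidiagonal.antidiagonal a, MvPolynomial.monomial (e i) (c i.1 i.2)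
  have hf : f = 0 := MvPolynomial.funext fun g => by
    rw [map_zero, ← h (g true) (g false), map_sum]
    refine Finset.sum_congr rfl fun a _ => ?_
    rw [map_sum]
    refine Finset.sum_congr rfl fun i _ => ?_
    simp [e, MvPolynomial.eval_monomial, Finsupp.prod_add_index', pow_add]
    ring
  have h1 : MvPolynomial.coeff (e (i, j)) f = c i j := by
    simp only [f, MvPolynomial.coeff_sum, MvPolynomial.coeff_monomial]
    rw [Finset.sum_eq_single (i + j), Finset.sum_eq_single (i, j)]
    · simp
    · exact fun b _ hb => if_neg fun h => hb (he h)
    · simp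
    · intro a _ ha
      refine Finset.sum_eq_zero fun b hb => if_neg fun h => ha ?_
      rw [he h] at hb
      exact (Finset.HasAntidiagonal.mem_antidiagonal.1 hb).symm
    · exact fun h => absurd (Finset.mem_range.2 (Nat.lt_succ_of_le hij)) h
  rw [← h1, hf, MvPolynomial.coeff_zero]

/-- Fixing the later points and varying the first gives a polynomial identity in `X` and `Y`, whose
coefficients are `f` on words with a prescribed first letter and a generating series as tail. The
general starting value `s` is needed for the induction. -/
theorem eq_zero_of_bSeries (r : ℕ) (f : QA →ₗ[ℚ] ℚ)
    (h : ∀ (s : ℚ) (P : List (ℚ × ℚ)), P.length = r → ∀ N,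
      f ((PowerSeries.coeff N (bSeries s P) : Module.End ℚ QA) 1) = 0)
    (w : Word) (hw : w.length = r) : f (word w) = 0 := by
  induction r generalizing f w with
  | zero =>
    rw [List.length_eq_zero_iff.1 hw, word_nil]
    have := h 0 [] rfl 0
    rwa [coeff_bSeries_nil, if_pos rfl] at this
  | succ r ih =>
    match w, hw with
    | a :: w, hw =>
      rw [word_cons_eq_catL]
      refine ih (f ∘ₗ catL a.1.natPred a.2) (fun s P hP N => ?_) w (by simpa using hw)
      -- The total degree is chosen so that the wanted first letter is paired with the degree-`N`
      -- coefficient of the tail.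
      have h1 := polynomial_coeff_eq_zero (N + (a.1.natPred + a.2)) (fun i j => f (catL i j
        ((PowerSeries.coeff (N + (a.1.natPred + a.2) - (i + j)) (bSeries s P) :
          Module.End ℚ QA) 1)) / (j.factorial : ℚ)) (fun X Y => ?_) a.1.natPred a.2 (by omega)
      · rw [Nat.add_sub_cancel] at h1
        exact (div_eq_zero_iff.1 h1).resolve_right (Nat.cast_ne_zero.2 (Nat.factorial_ne_zero a.2))
      -- Starting at `s - Y` makes the first difference equal to `Y` and leaves the tail with
      -- starting value `s`, independent of `Y`.
      · have h2 := h (s - Y) ((s, X) :: P) (by simp [hP]) (N + (a.1.natPred + a.2))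
        rw [coeff_bSeries_cons, map_sum, Finset.Nat.sum_antidiagonal_eq_sum_range_succ_mk] at h2
        rw [← h2]
        refine Finset.sum_congr rfl fun b _ => ?_
        rw [map_sum]
        refine Finset.sum_congr rfl fun i hi => ?_
        rw [map_smul, smul_eq_mul, Finset.HasAntidiagonal.mem_antidiagonal.1 hi, sub_sub_cancel]
        ring

theorem bSeries_shift (c s : ℚ) (P : List (ℚ × ℚ)) :
    bSeries (s - c) (P.map fun a => (a.1 - c, a.2)) = bSeries s P := by
  induction P generalizing s with
  | nil => rfl
  | cons a P ih =>
    rw [List.map_cons, bSeries, ih, sub_sub_sub_cancel_right]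
    rfl

theorem hom_ext_genCoeff {f g : QA →ₗ[ℚ] QA} (h : ∀ N P, f (genCoeff N P) = g (genCoeff N P)) :
    f = g := by
  refine hom_ext fun w => QA_ext fun v => ?_
  have := eq_zero_of_bSeries w.length (coeffWord v ∘ₗ (f - g)) (fun s P _ N => ?_) w rfl
  · rw [LinearMap.comp_apply, LinearMap.sub_apply, map_sub, sub_eq_zero] at this
    exact this
  · have := h N (P.map fun a => (a.1 - s, a.2))
    rw [← bSeries_shift s s P, sub_self]
    rw [genCoeff] at this
    rw [LinearMap.comp_apply, LinearMap.sub_apply, this, sub_self, map_zero]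

/-! ### The swap of a generating series -/

/-- The divided monomial `c ^ e / e!`. -/
noncomputable def divMonomial {σ : Type*} (c : σ → ℚ) (e : σ →₀ ℕ) : ℚ :=
  e.prod fun s n => c s ^ n / (n.factorial : ℚ)

theorem divMonomial_eq {σ : Type*} [Fintype σ] (c : σ → ℚ) (e : σ →₀ ℕ) :
    divMonomial c e = ∏ s, c s ^ e s / ((e s).factorial : ℚ) :=
  Finsupp.prod_fintype _ _ (by simp)

theorem sum_smul_pow {σ A : Type*} [Fintype σ] [DecidableEq σ] [CommRing A] [Algebra ℚ A]
    (c : σ → ℚ) (ℓ : σ → A) (N : ℕ) :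
    (∑ s, c s • ℓ s) ^ N = (N.factorial : ℚ) • ∑ k ∈ Finset.piAntidiag Finset.univ N,
      (∏ s, c s ^ k s / ((k s).factorial : ℚ)) • ∏ s, ℓ s ^ k s := by
  rw [Finset.sum_pow_eq_sum_piAntidiag, Finset.smul_sum]
  refine Finset.sum_congr rfl fun k hk => ?_
  have h1 := Nat.multinomial_spec Finset.univ k
  rw [(Finset.mem_piAntidiag.1 hk).1] at h1
  have h2 : (Nat.multinomial Finset.univ k : ℚ) = (N.factorial : ℚ) / ∏ s, ((k s).factorial : ℚ) := by
    rw [eq_div_iff (Finset.prod_ne_zero_iff.2 fun s _ => Nat.cast_ne_zero.2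
      (Nat.factorial_ne_zero _)), mul_comm, ← h1]
    push_cast
    rfl
  simp only [smul_pow, Finset.prod_smul, Finset.prod_div_distrib]
  rw [smul_smul, mul_div_assoc', mul_comm (N.factorial : ℚ), ← mul_div_assoc', ← h2,
    ← nsmul_eq_mul, ← Nat.cast_smul_eq_nsmul ℚ, smul_smul, mul_comm]

-- Applied coefficientwise, `φ` sends `g` to `κ · exp(∑ c_s x_s)`. Substituting linear forms gives
-- `κ · exp(∑ c_s ℓ_s)`, which is `κ · exp(∑ c'_s x_s)`. The proof compares the parts of degree
-- `e.degree`, that is powers of a linear form divided by a factorial.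
open MvPolynomial in
theorem map_coeff_subst {σ : Type*} [Fintype σ] [DecidableEq σ] (ℓ : σ → MvPolynomial σ ℚ)
    (hℓ : ∀ s, (ℓ s).IsHomogeneous 1) (a : σ → MvPowerSeries σ QA)
    (ha : ∀ s, a s = ((map (algebraMap ℚ QA) (ℓ s) : MvPolynomial σ QA) : MvPowerSeries σ QA))
    (hsub : MvPowerSeries.HasSubst a) (g : MvPowerSeries σ QA) (φ : QA →ₗ[ℚ] ℚ) (κ : ℚ)
    (c c' : σ → ℚ) (hg : ∀ e, φ (MvPowerSeries.coeff e g) = κ * divMonomial c e)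
    (hc : ∑ s, c s • ℓ s = ∑ s, c' s • X s) (e : σ →₀ ℕ) :
    φ (MvPowerSeries.coeff e (MvPowerSeries.subst a g)) = κ * divMonomial c' e := by
  have h1 : ∀ d : σ →₀ ℕ, MvPowerSeries.coeff e (d.prod fun s n => a s ^ n) =
      algebraMap ℚ QA (coeff e (∏ s, ℓ s ^ d s)) := fun d => by
    have : ∏ s, a s ^ d s = ((map (algebraMap ℚ QA) (∏ s, ℓ s ^ d s) : MvPolynomial σ QA) :
        MvPowerSeries σ QA) := by
      rw [map_prod]
      refine Eq.trans ?_ (map_prod (coeToMvPowerSeries.ringHom (R := QA) (σ := σ)) _ _).symm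
      refine Finset.prod_congr rfl fun s _ => ?_
      rw [ha, map_pow, map_pow]
      rfl
    rw [Finsupp.prod_fintype _ _ (by simp), ← coeff_map, ← coeff_coe, this]
  -- Homogeneity restricts the a priori infinite sum over exponents to those of the same total
  -- degree as `e`.
  have h2 : ∀ d : σ → ℕ, ∑ s, d s ≠ e.degree → coeff e (∏ s, ℓ s ^ d s) = 0 := fun d hd => by
    have : (∏ s, ℓ s ^ d s).IsHomogeneous (∑ s, d s) :=
      IsHomogeneous.prod _ _ _ fun s _ => by simpa using (hℓ s).pow (d s)
    exact this.coeff_eq_zero (Ne.symm hd)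
  have h3 : MvPowerSeries.coeff e (MvPowerSeries.subst a g) =
      ∑ k ∈ Finset.piAntidiag Finset.univ e.degree,
        coeff e (∏ s, ℓ s ^ k s) • MvPowerSeries.coeff (Finsupp.equivFunOnFinite.symm k) g := by
    rw [MvPowerSeries.coeff_subst hsub, ← finsum_comp_equiv Finsupp.equivFunOnFinite.symm]
    simp only [h1, smul_eq_mul, Finsupp.equivFunOnFinite_symm_apply_apply]
    rw [finsum_eq_sum_of_support_subset]
    · refine Finset.sum_congr rfl fun k _ => ?_
      rw [mul_comm, ← Algebra.smul_def]
    · intro k hk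
      rw [Function.mem_support] at hk
      rw [Finset.mem_coe, Finset.mem_piAntidiag]
      refine ⟨?_, fun _ _ => Finset.mem_univ _⟩
      by_contra h
      exact hk (by rw [h2 k h, map_zero, mul_zero])
  have h4 : κ * coeff e ((∑ s, c s • ℓ s) ^ e.degree) =
      (e.degree.factorial : ℚ) * φ (MvPowerSeries.coeff e (MvPowerSeries.subst a g)) := by
    rw [h3, sum_smul_pow, coeff_smul, smul_eq_mul, coeff_sum, map_sum, mul_left_comm,
      Finset.mul_sum]
    congr 1
    refine Finset.sum_congr rfl fun k _ => ?_
    rw [coeff_smul, map_smul, hg, divMonomial_eq, smul_eq_mul, smul_eq_mul]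
    simp
    ring
  have h5 : coeff e ((∑ s, c' s • X s : MvPolynomial σ ℚ) ^ e.degree) =
      (e.degree.factorial : ℚ) * divMonomial c' e := by
    rw [sum_smul_pow, coeff_smul, smul_eq_mul, coeff_sum]
    congr 1
    have h6 : ∀ k : σ → ℕ, coeff e (∏ s, (X s : MvPolynomial σ ℚ) ^ k s) =
        if k = e then 1 else 0 := fun k => by
      have : ∏ s, (X s : MvPolynomial σ ℚ) ^ k s =
          monomial (Finsupp.equivFunOnFinite.symm k) 1 := by
        rw [monomial_eq, Finsupp.prod_fintype _ _ (by simp)]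
        simp
      rw [this, coeff_monomial]
      congr 1
      rw [Equiv.symm_apply_eq]
      rfl
    simp only [coeff_smul, h6]
    rw [Finset.sum_eq_single (e : σ → ℕ)]
    · rw [divMonomial_eq]; simp
    · intro k _ hk
      simp [hk]
    · intro h
      refine absurd (Finset.mem_piAntidiag.2 ⟨?_, fun _ _ => Finset.mem_univ _⟩) h
      rw [Finsupp.degree_eq_sum]
  rw [hc, h5, mul_left_comm] at h4
  exact (mul_left_cancel₀ (Nat.cast_ne_zero.2 (Nat.factorial_ne_zero _)) h4).symm

theorem exists_eq_ofFn {α : Type*} {n : ℕ} (p : List α) (h : p.length = n) :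
    ∃ q : Fin n → α, p = List.ofFn q := by
  subst h
  exact ⟨p.get, (List.ofFn_get p).symm⟩

theorem evalAt_ofFn (r : ℕ) (q : Fin r → ℚ × ℚ) (w : Fin r → Letter) :
    evalAt (List.ofFn q) (word (List.ofFn w)) =
      ∏ i, (q i).1 ^ (w i).2 * (q i).2 ^ (w i).1.natPred / ((w i).1.natPred.factorial : ℚ) := by
  induction r with
  | zero => simp [evalAt_nil_one, word_nil]
  | succ r ih =>
    rw [List.ofFn_succ, List.ofFn_succ, word_cons_eq_catL, evalAt_catL, ih, Fin.prod_univ_succ]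

theorem evalAt_of_length_ne (p : List (ℚ × ℚ)) (w : Word) (h : p.length ≠ w.length) :
    evalAt p (word w) = 0 := by
  induction w generalizing p with
  | nil =>
    match p, h with
    | a :: p, _ => rw [word_nil, evalAt_cons_one]
  | cons b w ih =>
    rw [word_cons_eq_catL]
    match p, h with
    | [], _ => rw [evalAt_nil_catL]
    | a :: p, h => rw [evalAt_catL, ih p (by simpa using h), mul_zero]

theorem evalAt_coeff_genSeries (r : ℕ) (q : Fin r → ℚ × ℚ) (e : Fin r ⊕ Fin r →₀ ℕ) :
    evalAt (List.ofFn q) (MvPowerSeries.coeff e (genSeries r)) =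
      divMonomial (Sum.elim (fun i => (q i).2) fun i => (q i).1) e := by
  change evalAt (List.ofFn q) (genSeries r e) = _
  rw [genSeries, map_smul, evalAt_ofFn, divMonomial_eq, Fintype.prod_sum_type, smul_eq_mul,
    ← Finset.prod_inv_distrib, ← Finset.prod_mul_distrib, ← Finset.prod_mul_distrib]
  refine Finset.prod_congr rfl fun i _ => ?_
  simp only [Sum.elim_inl, Sum.elim_inr, Nat.natPred_succPNat]
  ring

theorem conjAux_ofFn (c : ℚ) (r : ℕ) (q : Fin r → ℚ × ℚ) :
    conjAux c (List.ofFn q) = List.ofFn fun i =>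
      (c + ∑ j ∈ Finset.univ.filter (fun j => j ≤ i), (q j).2,
        (q i).1 - if h : (i : ℕ) + 1 < r then (q ⟨i + 1, h⟩).1 else 0) := by
  induction r generalizing c with
  | zero => simp [conjAux]
  | succ r ih =>
    rw [List.ofFn_succ, List.ofFn_succ]
    change (c + (q 0).2, (q 0).1 - hdU (List.ofFn fun i : Fin r => q i.succ)) ::
      conjAux (c + (q 0).2) (List.ofFn fun i : Fin r => q i.succ) = _
    rw [ih]
    congr 1
    · congr 1
      · congr 1
        rw [Finset.sum_eq_single 0] <;> simp
      · congr 1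
        rcases r with - | r
        · simp [hdU]
        · rw [List.ofFn_succ]
          simp [hdU]
    · congr 1
      funext i
      congr 1
      · rw [add_assoc, Finset.sum_filter, Finset.sum_filter, Fin.sum_univ_succ]
        simp
      · simp

theorem reverse_ofFn {α : Type*} {r : ℕ} (f : Fin r → α) :
    (List.ofFn f).reverse = List.ofFn fun i => f i.rev := by
  refine List.ext_getElem (by simp) fun i h1 h2 => ?_
  rw [List.getElem_reverse, List.getElem_ofFn, List.getElem_ofFn]
  congr 1
  refine Fin.ext ?_
  simp only [List.length_ofFn, Fin.val_rev]
  omega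

theorem conj_ofFn (r : ℕ) (q : Fin r → ℚ × ℚ) :
    conj (List.ofFn q) = List.ofFn fun i =>
      (∑ j ∈ Finset.univ.filter (fun j => j ≤ i.rev), (q j).2,
        (q i.rev).1 - if h : (i.rev : ℕ) + 1 < r then (q ⟨i.rev + 1, h⟩).1 else 0) := by
  rw [conj, conjAux_ofFn, reverse_ofFn]
  simp only [zero_add]

/-- The linear forms of the swap, with rational coefficients. -/
noncomputable def swapForms (r : ℕ) : Fin r ⊕ Fin r → MvPolynomial (Fin r ⊕ Fin r) ℚ
  | Sum.inl i => ∑ j ∈ Finset.univ.filter (fun j => j ≤ i.rev), MvPolynomial.X (Sum.inr j)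
  | Sum.inr i => MvPolynomial.X (Sum.inl i.rev) -
      if h : (i.rev : ℕ) + 1 < r then MvPolynomial.X (Sum.inl ⟨(i.rev : ℕ) + 1, h⟩) else 0

theorem isHomogeneous_swapForms (r : ℕ) (s : Fin r ⊕ Fin r) : (swapForms r s).IsHomogeneous 1 := by
  rcases s with i | i
  · exact MvPolynomial.IsHomogeneous.sum _ _ _ fun j _ => MvPolynomial.isHomogeneous_X ℚ _
  · refine (MvPolynomial.isHomogeneous_X ℚ _).sub ?_
    split_ifs
    · exact MvPolynomial.isHomogeneous_X ℚ _
    · exact MvPolynomial.isHomogeneous_zero _ _ _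

theorem swapVars_eq (r : ℕ) (s : Fin r ⊕ Fin r) :
    swapVars r s = ((MvPolynomial.map (algebraMap ℚ QA) (swapForms r s) :
      MvPolynomial (Fin r ⊕ Fin r) QA) : MvPowerSeries (Fin r ⊕ Fin r) QA) := by
  rcases s with i | i
  · simp only [swapVars, swapForms, map_sum, MvPolynomial.map_X]
    refine Eq.trans ?_ (map_sum (MvPolynomial.coeToMvPowerSeries.ringHom (R := QA)
      (σ := Fin r ⊕ Fin r)) _ _).symm
    simp
  · simp only [swapVars, swapForms, map_sub, MvPolynomial.map_X]
    refine Eq.trans ?_ (map_sub (MvPolynomial.coeToMvPowerSeries.ringHom (R := QA)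
      (σ := Fin r ⊕ Fin r)) _ _).symm
    split_ifs <;> simp

theorem dite_succ_lt_eq_sum {M : Type*} [AddCommMonoid M] {r : ℕ} (k : ℕ) (f : Fin r → M) :
    (if h : k + 1 < r then f ⟨k + 1, h⟩ else 0) = ∑ j : Fin r, if (j : ℕ) = k + 1 then f j else 0 := by
  split_ifs with h
  · rw [Finset.sum_eq_single ⟨k + 1, h⟩]
    · simp
    · exact fun j _ hj => if_neg fun h' => hj (Fin.ext h')
    · simp
  · refine (Finset.sum_eq_zero fun j _ => if_neg fun h' => h ?_).symm
    rw [← h']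
    exact j.2

/-- The matrix of the swap substitution is transposed here. This works because the relations `j ≤
i.rev` and `i = j.rev + 1` are symmetric in `i` and `j`, so the transpose is the formula for
conjugate points. -/
theorem sum_smul_swapForms (r : ℕ) (q : Fin r → ℚ × ℚ) :
    ∑ s, Sum.elim (fun i => (q i).2) (fun i => (q i).1) s • swapForms r s =
      ∑ s, Sum.elim
        (fun i : Fin r => (q i.rev).1 -
          if h : (i.rev : ℕ) + 1 < r then (q ⟨(i.rev : ℕ) + 1, h⟩).1 else 0)
        (fun i : Fin r => ∑ j ∈ Finset.univ.filter (fun j => j ≤ i.rev), (q j).2) s •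
          (MvPolynomial.X s : MvPolynomial (Fin r ⊕ Fin r) ℚ) := by
  rw [Fintype.sum_sum_type, Fintype.sum_sum_type, add_comm]
  simp only [Sum.elim_inl, Sum.elim_inr, swapForms]
  congr 1
  · simp only [smul_sub, sub_smul, Finset.sum_sub_distrib]
    congr 1
    · rw [← Equiv.sum_comp Fin.revPerm]
      simp
    · simp only [dite_succ_lt_eq_sum _ fun j : Fin r => (q j).1,
        dite_succ_lt_eq_sum _ fun j : Fin r =>
          (MvPolynomial.X (Sum.inl j) : MvPolynomial (Fin r ⊕ Fin r) ℚ), Finset.smul_sum,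
        Finset.sum_smul]
      rw [Finset.sum_comm]
      refine Finset.sum_congr rfl fun i _ => Finset.sum_congr rfl fun j _ => ?_
      have : (i : ℕ) = (j.rev : ℕ) + 1 ↔ (j : ℕ) = (i.rev : ℕ) + 1 := by
        have := i.2
        have := j.2
        simp only [Fin.val_rev]
        omega
      rw [smul_ite, ite_smul, smul_zero, zero_smul, if_congr this rfl rfl]
  · simp only [Finset.sum_filter, Finset.smul_sum, Finset.sum_smul]
    rw [Finset.sum_comm]
    refine Finset.sum_congr rfl fun i _ => Finset.sum_congr rfl fun j _ => ?_
    have : i ≤ j.rev ↔ j ≤ i.rev := by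
      have := i.2
      have := j.2
      simp only [Fin.le_def, Fin.val_rev]
      omega
    rw [smul_ite, ite_smul, smul_zero, zero_smul, if_congr this rfl rfl]

/-- Evaluation turns the generating series into an exponential, so the substitution acts on the
exponent only. The factor `∏ d!` in the swap of a word cancels the factorials of the `d_i` in the
divided monomial; those of the `k_i - 1` belong to the evaluation. -/
theorem evalAt_swapWord (p : List (ℚ × ℚ)) (w : Word) :
    evalAt p (swapWord w) = evalAt (conj p) (word w) := by
  by_cases h : p.length = w.length
  · obtain ⟨q, rfl⟩ := exists_eq_ofFn p h
    have h1 := map_coeff_subst (swapForms w.length) (isHomogeneous_swapForms _) _ (swapVars_eq _)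
      (hasSubst_swapVars _) (genSeries w.length) (evalAt (List.ofFn q)) 1 _ _
      (fun e => (evalAt_coeff_genSeries w.length q e).trans (one_mul _).symm) (sum_smul_swapForms w.length q) (wordExponent w)
    rw [swapWord, map_smul, h1, conj_ofFn]
    refine Eq.trans ?_ (congrArg (fun v => evalAt _ (word v)) (List.ofFn_get w))
    rw [one_mul, evalAt_ofFn, divMonomial_eq, Fintype.prod_sum_type, smul_eq_mul,
      ← Finset.prod_mul_distrib, ← Finset.prod_mul_distrib]
    refine Finset.prod_congr rfl fun i _ => ?_
    have h2 : ((w.get i).2.factorial : ℚ) ≠ 0 := Nat.cast_ne_zero.2 (Nat.factorial_ne_zero _)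
    simp only [Sum.elim_inl, Sum.elim_inr, wordExponent, Finsupp.equivFunOnFinite_symm_apply_apply]
    field_simp
  · rw [evalAt_of_length_ne _ _ (by rwa [length_conj]), swapWord]
    -- For mismatched lengths the evaluation kills the whole generating series, which is the case `κ
    -- = 0`.
    have h1 := map_coeff_subst (swapForms w.length) (isHomogeneous_swapForms _) _ (swapVars_eq _)
      (hasSubst_swapVars _) (genSeries w.length) (evalAt p) 0 0 0 (fun e => ?_) (by simp)
      (wordExponent w)
    · rw [map_smul, h1, zero_mul, smul_zero]
    · change evalAt p (genSeries w.length e) = _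
      rw [genSeries, map_smul, evalAt_of_length_ne _ _ (by simpa using h), smul_zero, zero_mul]

theorem evalAt_swap (p : List (ℚ × ℚ)) (x : QA) : evalAt p (swap x) = evalAt (conj p) x := by
  have : evalAt p ∘ₗ swap = evalAt (conj p) := hom_ext fun w => by
    rw [LinearMap.comp_apply, swap, ofWords_word, evalAt_swapWord]
  exact LinearMap.congr_fun this x

theorem swap_genCoeff (N : ℕ) (P : List (ℚ × ℚ)) :
    swap (genCoeff N P) = genCoeff N (revSwap P) :=
  ext_evalAt fun p => by rw [evalAt_swap, evalAt_conj_genCoeff]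

/-- It suffices to compare on coefficients of generating series, where the swap acts by `revSwap`
and the formula for `δ` is invariant under it. -/
theorem swap_deltaQA (x : QA) : swap (deltaQA x) = deltaQA (swap x) := by
  have : swap ∘ₗ deltaQA = deltaQA ∘ₗ swap := hom_ext_genCoeff fun N P => by
    rw [LinearMap.comp_apply, LinearMap.comp_apply, swap_genCoeff, deltaQA_genCoeff,
      deltaQA_genCoeff, map_deltaSum, deltaSum_revSwap]
    congr 1
    funext n Q
    rw [shiftCoeff, shiftCoeff]
    split_ifs
    · rw [swap_genCoeff]
    · rw [map_zero]
  exact LinearMap.congr_fun this x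

/-! ### Compatibility of `W` and `D` with the swap -/

theorem wordW_cons (a : Letter) (x : QA) :
    ofWords wordW (cons a x) = ((a.1 : ℕ) + a.2 : ℚ) • cons a x + cons a (ofWords wordW x) := by
  have : ofWords wordW ∘ₗ cons a =
      ((a.1 : ℕ) + a.2 : ℚ) • cons a + cons a ∘ₗ ofWords wordW := hom_ext fun w => by
    simp only [LinearMap.comp_apply, LinearMap.add_apply, LinearMap.smul_apply, cons_word,
      ofWords_word, wordW, wt, List.map_cons, List.sum_cons, map_smul]
    push_cast
    rw [add_smul]
  exact LinearMap.congr_fun this x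

theorem wordD_catL (i j : ℕ) (x : QA) :
    ofWords wordD (catL i j x) =
      (i + 1 : ℚ) • catL (i + 1) (j + 1) x + catL i j (ofWords wordD x) := by
  have : ofWords wordD ∘ₗ catL i j =
      (i + 1 : ℚ) • catL (i + 1) (j + 1) + catL i j ∘ₗ ofWords wordD := hom_ext fun w => by
    have h : i.succPNat + 1 = (i + 1).succPNat := PNat.coe_injective (by simp)
    simp only [LinearMap.comp_apply, LinearMap.add_apply, LinearMap.smul_apply, catL, cons_word,
      ofWords_word, wordD, splitSum, h]
    simp
  exact LinearMap.congr_fun this x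

/-- The series degree counts `(k - 1) + d` for every letter, so the weight exceeds it by the number
of letters. -/
theorem wordW_coeff_bSeries (s : ℚ) (P : List (ℚ × ℚ)) (N : ℕ) :
    ofWords wordW ((PowerSeries.coeff N (bSeries s P) : Module.End ℚ QA) 1) =
      (N + P.length : ℚ) • (PowerSeries.coeff N (bSeries s P) : Module.End ℚ QA) 1 := by
  induction P generalizing s N with
  | nil =>
    rw [coeff_bSeries_nil]
    split_ifs with h
    · rw [h, ← word_nil, ofWords_word]
      simp [wordW, wt]
    · simp
  | cons b P ih =>
    rw [coeff_bSeries_cons, map_sum, Finset.smul_sum]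
    refine Finset.sum_congr rfl fun a ha => ?_
    rw [map_sum, Finset.smul_sum]
    refine Finset.sum_congr rfl fun i hi => ?_
    have h : ∀ y, ofWords wordW (catL i.1 i.2 y) =
        (i.1 + 1 + i.2 : ℚ) • catL i.1 i.2 y + catL i.1 i.2 (ofWords wordW y) := fun y => by
      rw [catL, wordW_cons]; simp
    rw [map_smul, h, ih, map_smul, smul_comm]
    congr 1
    rw [← add_smul]
    congr 1
    rw [← Finset.HasAntidiagonal.mem_antidiagonal.1 ha,
      ← Finset.HasAntidiagonal.mem_antidiagonal.1 hi, List.length_cons]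
    push_cast
    ring

theorem swap_wordW (x : QA) : swap (ofWords wordW x) = ofWords wordW (swap x) := by
  have : swap ∘ₗ ofWords wordW = ofWords wordW ∘ₗ swap := hom_ext_genCoeff fun N P => by
    have h : ∀ P, ofWords wordW (genCoeff N P) = (N + P.length : ℚ) • genCoeff N P :=
      fun P => wordW_coeff_bSeries 0 P N
    rw [LinearMap.comp_apply, LinearMap.comp_apply, swap_genCoeff, h, h, map_smul, swap_genCoeff,
      length_revSwap]
  exact LinearMap.congr_fun this x

/-- The sum of the products of the coordinates. -/
def dotSum (p : List (ℚ × ℚ)) : ℚ := (p.map fun a => a.1 * a.2).sum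

theorem evalAt_wordD (p : List (ℚ × ℚ)) (x : QA) :
    evalAt p (ofWords wordD x) = dotSum p * evalAt p x := by
  induction p generalizing x with
  | nil =>
    have : evalAt [] ∘ₗ ofWords wordD = 0 := hom_ext_catL
      (by rw [← word_nil]; simp [wordD, splitSum]) fun i j w => by
        rw [LinearMap.comp_apply, wordD_catL, map_add, map_smul, evalAt_nil_catL, evalAt_nil_catL]
        simp
    rw [show dotSum [] = 0 from rfl, zero_mul]
    exact LinearMap.congr_fun this x
  | cons a p ih =>
    have : evalAt (a :: p) ∘ₗ ofWords wordD = dotSum (a :: p) • evalAt (a :: p) := hom_ext_catL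
      (by rw [LinearMap.comp_apply, ← word_nil, ofWords_word, LinearMap.smul_apply, word_nil,
            evalAt_cons_one, wordD, splitSum, map_zero, smul_zero]) fun i j w => by
        have h : dotSum (a :: p) = a.1 * a.2 + dotSum p := List.sum_cons
        rw [LinearMap.comp_apply, wordD_catL, map_add, map_smul, evalAt_catL, evalAt_catL, ih,
          LinearMap.smul_apply, evalAt_catL, h,
          smul_eq_mul, smul_eq_mul, Nat.factorial_succ]
        have := Nat.factorial_ne_zero i
        push_cast
        field_simp
        ring
    exact LinearMap.congr_fun this x

/-- Summation by parts once more; for integral points it says that conjugate partitions have the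
same size. -/
theorem dotSum_conjAux (c : ℚ) (p : List (ℚ × ℚ)) :
    dotSum (conjAux c p) = dotSum p + c * hdU p := by
  induction p generalizing c with
  | nil => simp [conjAux, dotSum, hdU]
  | cons a p ih =>
    obtain ⟨u, v⟩ := a
    rw [conjAux, dotSum, List.map_cons, List.sum_cons, ← dotSum, ih, dotSum, dotSum, List.map_cons,
      List.sum_cons]
    change _ = _ + c * u
    ring

theorem dotSum_conj (p : List (ℚ × ℚ)) : dotSum (conj p) = dotSum p := by
  rw [conj, dotSum, List.map_reverse, List.sum_reverse, ← dotSum, dotSum_conjAux, zero_mul, add_zero]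

theorem swap_wordD (x : QA) : swap (ofWords wordD x) = ofWords wordD (swap x) :=
  ext_evalAt fun p => by
    rw [evalAt_swap, evalAt_wordD, evalAt_wordD, evalAt_swap, dotSum_conj]

/-! ### The induced derivations -/

theorem cls_surjective : Function.Surjective cls := Ideal.Quotient.mk_surjective

theorem cls_eq_zero_iff {x : QA} : cls x = 0 ↔ x ∈ swapIdeal := Ideal.Quotient.eq_zero_iff_mem

theorem cls_swap (x : QA) : cls (swap x) = cls x := by
  rw [← sub_eq_zero, ← map_sub, cls_eq_zero_iff]
  exact Ideal.subset_span ⟨x, rfl⟩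

theorem mem_swapIdeal_of_leibniz (f : QA →ₗ[ℚ] QA) (hf : ∀ x y, f (x * y) = x * f y + y * f x)
    (hs : ∀ x, swap (f x) = f (swap x)) {x : QA} (hx : x ∈ swapIdeal) : f x ∈ swapIdeal := by
  induction hx using Submodule.span_induction with
  | mem x hx =>
    obtain ⟨y, rfl⟩ := hx
    rw [map_sub, ← hs]
    exact Ideal.subset_span ⟨f y, rfl⟩
  | zero => rw [map_zero]; exact zero_mem _
  | add x y _ _ hx hy => rw [map_add]; exact add_mem hx hy
  | smul a x hx ih =>
    rw [smul_eq_mul, hf]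
    exact add_mem (Ideal.mul_mem_left _ _ ih) (Ideal.mul_mem_right _ _ hx)

/-- The derivation of the quotient induced by a derivation that commutes with the swap. -/
theorem exists_derivation (f : QA →ₗ[ℚ] QA) (hf : ∀ x y, f (x * y) = x * f y + y * f x)
    (hs : ∀ x, swap (f x) = f (swap x)) :
    ∃ Θ : Derivation ℚ FMES FMES, ∀ x, Θ (cls x) = cls (f x) := by
  have h1 : ∀ x y, cls x = cls y → cls (f x) = cls (f y) := fun x y h => by
    rw [← sub_eq_zero, ← map_sub, cls_eq_zero_iff] at h ⊢
    rw [← map_sub]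
    exact mem_swapIdeal_of_leibniz f hf hs h
  let s := Function.surjInv cls_surjective
  have h2 : ∀ x, cls (s x) = x := Function.surjInv_eq cls_surjective
  have h3 : ∀ x, cls (f (s (cls x))) = cls (f x) := fun x => h1 _ _ (h2 _)
  let g : FMES →ₗ[ℚ] FMES :=
    { toFun := fun x => cls (f (s x))
      map_add' := fun x y => by
        obtain ⟨x, rfl⟩ := cls_surjective x
        obtain ⟨y, rfl⟩ := cls_surjective y
        rw [← map_add, h3, h3, h3, map_add, map_add]
      map_smul' := fun c x => by
        obtain ⟨x, rfl⟩ := cls_surjective x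
        rw [← map_smul, h3, h3, map_smul, map_smul, RingHom.id_apply] }
  refine ⟨Derivation.mk' g fun x y => ?_, h3⟩
  obtain ⟨x, rfl⟩ := cls_surjective x
  obtain ⟨y, rfl⟩ := cls_surjective y
  change cls (f (s (cls x * cls y))) = cls x • cls (f (s (cls y))) + cls y • cls (f (s (cls x)))
  rw [← map_mul, h3, h3, h3, hf, map_add, map_mul, map_mul]
  rfl

theorem exists_induced_derivations :
    ∃ D W δ : Derivation ℚ FMES FMES,
      (∀ x, D (cls x) = cls (ofWords wordD x)) ∧ (∀ x, W (cls x) = cls (ofWords wordW x)) ∧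
        ∀ x, δ (cls x) = cls (deltaQA x) := by
  obtain ⟨D, hD⟩ := exists_derivation _ wordD_mul swap_wordD
  obtain ⟨W, hW⟩ := exists_derivation _ wordW_mul swap_wordW
  obtain ⟨δ, hδ⟩ := exists_derivation _ deltaQA_mul swap_deltaQA
  exact ⟨D, W, δ, hD, hW, hδ⟩

/-! ### Relations between products of formal Eisenstein series -/

open Finset.HasAntidiagonal (antidiagonal)

theorem catL_one_mul_catL_one (i j l m : ℕ) :
    catL i j 1 * catL l m 1 =
      catL i j (catL l m 1) + catL l m (catL i j 1) + catL (i + l + 1) (j + m) 1 := by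
  have h : (i.succPNat, j) + (l.succPNat, m) = ((i + l + 1).succPNat, j + m) :=
    Prod.ext (PNat.coe_injective (by simp; omega)) rfl
  simp only [catL]
  rw [cons_mul_cons, one_mul, mul_one, one_mul, h]

theorem genCoeff_single (N : ℕ) (a : ℚ × ℚ) :
    genCoeff N [a] = ∑ i ∈ antidiagonal N,
      (a.2 ^ i.1 * a.1 ^ i.2 / (i.2.factorial : ℚ)) • catL i.1 i.2 1 := by
  rw [genCoeff, coeff_bSeries_cons, Finset.sum_eq_single (N, 0)]
  · simp only [coeff_bSeries_nil, if_true, sub_zero]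
  · rintro ⟨b, c⟩ hb hne
    refine Finset.sum_eq_zero fun i _ => ?_
    rw [coeff_bSeries_nil, if_neg, map_zero, smul_zero]
    rintro rfl
    have := Finset.HasAntidiagonal.mem_antidiagonal.1 hb
    exact hne (by simp at this; rw [this])
  · intro h
    exact absurd (Finset.HasAntidiagonal.mem_antidiagonal.2 (by simp)) h

theorem genCoeff_pair_zero_left (N : ℕ) (X₁ X₂ : ℚ) :
    genCoeff N [(0, X₁), (0, X₂)] = ∑ i ∈ antidiagonal N,
      (X₁ ^ i.1 * X₂ ^ i.2) • catL i.1 0 (catL i.2 0 1) := by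
  rw [genCoeff, coeff_bSeries_cons]
  refine Finset.sum_congr rfl fun i _ => ?_
  have h := genCoeff_single i.2 (0, X₂)
  rw [genCoeff, Finset.sum_eq_single (i.2, 0)] at h
  · rw [Finset.sum_eq_single (i.1, 0)]
    · simp only
      rw [h]
      simp [smul_smul]
    · rintro ⟨b, c⟩ hb hne
      rcases c with - | c
      · have := Finset.HasAntidiagonal.mem_antidiagonal.1 hb
        exact absurd (by simp at this; rw [this]) hne
      · simp
    · intro h
      exact absurd (Finset.HasAntidiagonal.mem_antidiagonal.2 (by simp)) h
  · rintro ⟨b, c⟩ hb hne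
    rcases c with - | c
    · have := Finset.HasAntidiagonal.mem_antidiagonal.1 hb
      exact absurd (by simp at this; rw [this]) hne
    · simp
  · intro h
    exact absurd (Finset.HasAntidiagonal.mem_antidiagonal.2 (by simp)) h

/-- With `X₁ = X₂ = 0` only words with upper indices 1 survive. The tail starts at `Y₁` and is
translated back to the starting value 0. -/
theorem genCoeff_pair_zero_right (N : ℕ) (Y₁ Y₂ : ℚ) :
    genCoeff N [(Y₁, 0), (Y₁ + Y₂, 0)] = ∑ i ∈ antidiagonal N,
      (Y₁ ^ i.1 / (i.1.factorial : ℚ) * (Y₂ ^ i.2 / (i.2.factorial : ℚ))) •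
        catL 0 i.1 (catL 0 i.2 1) := by
  rw [genCoeff, coeff_bSeries_cons]
  refine Finset.sum_congr rfl fun i _ => ?_
  have h := genCoeff_single i.2 (Y₂, 0)
  have hs := bSeries_shift Y₁ Y₁ [(Y₁ + Y₂, 0)]
  simp only [sub_self, List.map_cons, List.map_nil, add_sub_cancel_left] at hs
  rw [genCoeff, Finset.sum_eq_single (0, i.2)] at h
  · rw [Finset.sum_eq_single (0, i.1)]
    · simp only
      rw [← hs, h]
      simp [smul_smul]
    · rintro ⟨b, c⟩ hb hne
      rcases b with - | b
      · have := Finset.HasAntidiagonal.mem_antidiagonal.1 hb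
        exact absurd (by simp at this; rw [this]) hne
      · simp
    · intro h
      exact absurd (Finset.HasAntidiagonal.mem_antidiagonal.2 (by simp)) h
  · rintro ⟨b, c⟩ hb hne
    rcases b with - | b
    · have := Finset.HasAntidiagonal.mem_antidiagonal.1 hb
      exact absurd (by simp at this; rw [this]) hne
    · simp
  · intro h
    exact absurd (Finset.HasAntidiagonal.mem_antidiagonal.2 (by simp)) h

theorem cls_genCoeff_revSwap (N : ℕ) (P : List (ℚ × ℚ)) :
    cls (genCoeff N (revSwap P)) = cls (genCoeff N P) := by
  rw [← swap_genCoeff, cls_swap]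

/-- The formal Eisenstein series `G(n + 1)`. -/
noncomputable def gEis (n : ℕ) : FMES := cls (catL n 0 1)

theorem eisG_eq_gEis (k : ℕ+) : eisG k = gEis k.natPred := by
  rw [eisG, G, gEis, catL, PNat.succPNat_natPred, ← word_nil, cons_word]

/-- In depth one the swap exchanges the roles of `k - 1` and `d`; the factorial comes from the
normalisation `Y^d / d!`. -/
theorem cls_catL_zero (n : ℕ) : cls (catL 0 n 1) = (n.factorial : ℚ) • gEis n := by
  have h := cls_genCoeff_revSwap n [(1, 0)]
  have h1 : revSwap [(1, 0)] = [(0, 1)] := rfl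
  rw [h1, genCoeff_single, genCoeff_single, Finset.sum_eq_single (n, 0),
    Finset.sum_eq_single (0, n)] at h
  · have hn : (n.factorial : ℚ) ≠ 0 := Nat.cast_ne_zero.2 (Nat.factorial_ne_zero _)
    simp only [pow_zero, one_pow, mul_one, Nat.factorial_zero, Nat.cast_one, div_one, map_smul,
      one_smul] at h
    rw [gEis, h, smul_smul, mul_one_div_cancel hn, one_smul]
  · rintro ⟨b, c⟩ hb hne
    rcases b with - | b
    · have := Finset.HasAntidiagonal.mem_antidiagonal.1 hb
      exact absurd (by simp at this; rw [this]) hne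
    · simp
  · intro h
    exact absurd (Finset.HasAntidiagonal.mem_antidiagonal.2 (by simp)) h
  · rintro ⟨b, c⟩ hb hne
    rcases c with - | c
    · have := Finset.HasAntidiagonal.mem_antidiagonal.1 hb
      exact absurd (by simp at this; rw [this]) hne
    · simp
  · intro h
    exact absurd (Finset.HasAntidiagonal.mem_antidiagonal.2 (by simp)) h

/-- The generating polynomial of the products `G(a + 1) G(b + 1)`. -/
noncomputable def prodPoly (N : ℕ) (X Y : ℚ) : FMES :=
  ∑ i ∈ antidiagonal N, (X ^ i.1 * Y ^ i.2) • (gEis i.1 * gEis i.2)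

/-- The complete homogeneous polynomial in two variables. -/
def homPoly (N : ℕ) (X Y : ℚ) : ℚ := ∑ i ∈ antidiagonal N, X ^ i.1 * Y ^ i.2

/-- The generating polynomial of the double formal Eisenstein series. -/
noncomputable def doublePoly (N : ℕ) (X Y : ℚ) : FMES := cls (genCoeff N [(0, X), (0, Y)])

/-- This is the stuffle product of two letters with lower index 0; the merged letter gives the
single Eisenstein series. -/
theorem doublePoly_add_swap (N : ℕ) (X Y : ℚ) :
    doublePoly N X Y + doublePoly N Y X = prodPoly N X Y - homPoly N X Y • gEis (N + 1) := by
  have h : ∑ i ∈ antidiagonal N, (X ^ i.1 * Y ^ i.2) • (catL i.1 0 1 * catL i.2 0 1) =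
      genCoeff N [(0, X), (0, Y)] + genCoeff N [(0, Y), (0, X)] +
        homPoly N X Y • catL (N + 1) 0 1 := by
    rw [genCoeff_pair_zero_left, genCoeff_pair_zero_left, homPoly, Finset.sum_smul,
      ← Finset.Nat.sum_antidiagonal_swap (f := fun i => (Y ^ i.1 * X ^ i.2) • _), ← Finset.sum_add_distrib,
      ← Finset.sum_add_distrib]
    refine Finset.sum_congr rfl fun i hi => ?_
    rw [catL_one_mul_catL_one, Finset.HasAntidiagonal.mem_antidiagonal.1 hi]
    simp only [Prod.fst_swap, Prod.snd_swap, add_zero]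
    rw [smul_add, smul_add, mul_comm (Y ^ i.2)]
  have h' := congrArg cls h
  simp only [map_sum, map_add, map_smul, map_mul] at h'
  rw [prodPoly, eq_sub_iff_add_eq]
  exact h'.symm

/-- This is the stuffle product of two letters with upper index 1, transported by the swap. The
merged letters all have upper index 2, and they are values of `D`, since `D` sends `(1, N)` to `(2,
N + 1)`. -/
theorem doublePoly_add_sub (D : Derivation ℚ FMES FMES)
    (hD : ∀ x, D (cls x) = cls (ofWords wordD x)) (N : ℕ) (X Y : ℚ) :
    doublePoly (N + 1) X Y + doublePoly (N + 1) X (X - Y) =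
      prodPoly (N + 1) Y (X - Y) - (X ^ (N + 1) / (N + 1 : ℚ)) • D (gEis N) := by
  have h : ∑ i ∈ antidiagonal (N + 1),
      (Y ^ i.1 / (i.1.factorial : ℚ) * ((X - Y) ^ i.2 / (i.2.factorial : ℚ))) •
        (catL 0 i.1 1 * catL 0 i.2 1) =
      genCoeff (N + 1) [(Y, 0), (X, 0)] + genCoeff (N + 1) [(X - Y, 0), (X, 0)] +
        (X ^ (N + 1) / ((N + 1).factorial : ℚ)) • catL 1 (N + 1) 1 := by
    have e1 := genCoeff_pair_zero_right (N + 1) Y (X - Y)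
    have e2 := genCoeff_pair_zero_right (N + 1) (X - Y) Y
    have e3 := sum_add_pow_div_factorial Y (X - Y) (N + 1)
    rw [add_sub_cancel] at e1 e3
    rw [sub_add_cancel] at e2
    rw [e1, e2, ← e3, Finset.sum_smul,
      ← Finset.Nat.sum_antidiagonal_swap (f := fun i =>
        ((X - Y) ^ i.1 / (i.1.factorial : ℚ) * (Y ^ i.2 / (i.2.factorial : ℚ))) • _),
      ← Finset.sum_add_distrib, ← Finset.sum_add_distrib]
    refine Finset.sum_congr rfl fun i hi => ?_
    rw [catL_one_mul_catL_one, Finset.HasAntidiagonal.mem_antidiagonal.1 hi]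
    simp only [Prod.fst_swap, Prod.snd_swap, add_zero]
    rw [smul_add, smul_add, mul_comm (_ / _) (Y ^ i.1 / _)]
  have hDg : D (gEis N) = (1 / (N.factorial : ℚ)) • cls (catL 1 (N + 1) 1) := by
    have h1 : gEis N = (1 / (N.factorial : ℚ)) • cls (catL 0 N 1) := by
      rw [cls_catL_zero, smul_smul, one_div_mul_cancel
        (Nat.cast_ne_zero.2 (Nat.factorial_ne_zero _)), one_smul]
    have h2 : ofWords wordD 1 = 0 := by rw [← word_nil, ofWords_word]; rfl
    rw [h1, D.map_smul, hD, wordD_catL, h2, map_zero, add_zero]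
    simp
  have e1 : doublePoly (N + 1) X Y = cls (genCoeff (N + 1) [(Y, 0), (X, 0)]) :=
    cls_genCoeff_revSwap (N + 1) [(Y, 0), (X, 0)]
  have e2 : doublePoly (N + 1) X (X - Y) = cls (genCoeff (N + 1) [(X - Y, 0), (X, 0)]) :=
    cls_genCoeff_revSwap (N + 1) [(X - Y, 0), (X, 0)]
  have h' := congrArg cls h
  simp only [map_sum, map_add, map_smul, map_mul, cls_catL_zero] at h'
  rw [e1, e2, hDg, eq_sub_iff_add_eq, prodPoly, smul_smul]
  have e4 : X ^ (N + 1) / (N + 1 : ℚ) * (1 / (N.factorial : ℚ)) =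
      X ^ (N + 1) / ((N + 1).factorial : ℚ) := by
    rw [Nat.factorial_succ]
    have := Nat.factorial_ne_zero N
    push_cast
    field_simp
  rw [e4, ← h']
  refine Finset.sum_congr rfl fun i _ => ?_
  have h1 : (i.1.factorial : ℚ) ≠ 0 := Nat.cast_ne_zero.2 (Nat.factorial_ne_zero _)
  have h2 : (i.2.factorial : ℚ) ≠ 0 := Nat.cast_ne_zero.2 (Nat.factorial_ne_zero _)
  rw [smul_mul_smul_comm, smul_smul]
  congr 1
  field_simp

theorem doublePoly_neg (N : ℕ) (hN : Even N) (X Y : ℚ) :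
    doublePoly N (-X) (-Y) = doublePoly N X Y := by
  rw [doublePoly, doublePoly, genCoeff_pair_zero_left, genCoeff_pair_zero_left]
  congr 1
  refine Finset.sum_congr rfl fun i hi => ?_
  congr 1
  rw [neg_pow X, neg_pow Y, mul_mul_mul_comm, ← pow_add,
    Finset.HasAntidiagonal.mem_antidiagonal.1 hi, hN.neg_one_pow, one_mul]

/-- Write `P` for the double polynomial. The three stuffle relations at `(U, V)`, `(V, V-U)`, `(V-U,
-U)` and the three swapped relations at `(V, U)`, `(V-U, V)`, `(-U, V-U)` involve the same six
values of `P`, once `P(-U, -V) = P(U, V)` is used; this last identity needs the even degree.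
Subtracting eliminates `P`. -/
theorem prodPoly_relation (D : Derivation ℚ FMES FMES)
    (hD : ∀ x, D (cls x) = cls (ofWords wordD x)) (N : ℕ) (hN : Even (N + 1)) (U V : ℚ) :
    prodPoly (N + 1) U V - prodPoly (N + 1) U (V - U) + prodPoly (N + 1) V (V - U) -
      prodPoly (N + 1) V (-U) + prodPoly (N + 1) (V - U) (-U) - prodPoly (N + 1) (V - U) (-V) =
    (homPoly (N + 1) U V + homPoly (N + 1) V (V - U) + homPoly (N + 1) (V - U) (-U)) •
      gEis (N + 2) -
    ((U ^ (N + 1) + V ^ (N + 1) + (V - U) ^ (N + 1)) / (N + 1 : ℚ)) • D (gEis N) := by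
  have a1 := doublePoly_add_swap (N + 1) U V
  have a2 := doublePoly_add_swap (N + 1) V (V - U)
  have a3 := doublePoly_add_swap (N + 1) (V - U) (-U)
  have b1 := doublePoly_add_sub D hD N V U
  have b2 := doublePoly_add_sub D hD N (V - U) V
  have b3 := doublePoly_add_sub D hD N (-U) (V - U)
  rw [show V - U - V = -U by ring] at b2
  rw [show -U - (V - U) = -V by ring, doublePoly_neg _ hN, hN.neg_pow] at b3
  rw [add_div, add_div, add_smul, add_smul, add_smul, add_smul]
  linear_combination (exp := 1) b1 + b2 + b3 - a1 - a2 - a3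

/-- The formal Eisenstein series `G(2 m + 2)`. -/
noncomputable def evenEis (m : ℕ) : FMES := gEis (2 * m + 1)

theorem sum_antidiagonal_odd {M : Type*} [AddCommMonoid M] (m : ℕ) (f : ℕ → ℕ → M)
    (hf : ∀ i j, Even j → f i j = 0) :
    ∑ i ∈ antidiagonal (2 * m + 2), f i.1 i.2 =
      ∑ i ∈ antidiagonal m, f (2 * i.1 + 1) (2 * i.2 + 1) := by
  symm
  refine Finset.sum_of_injOn (fun i => (2 * i.1 + 1, 2 * i.2 + 1)) ?_ ?_ ?_ fun _ _ => rfl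
  · rintro ⟨a, b⟩ _ ⟨c, d⟩ _ h
    simp only [Prod.mk.injEq] at h ⊢
    omega
  · rintro ⟨a, b⟩ h
    have := Finset.HasAntidiagonal.mem_antidiagonal.1 h
    refine Finset.HasAntidiagonal.mem_antidiagonal.2 ?_
    simp only at this ⊢
    omega
  · rintro ⟨a, b⟩ h hn
    refine hf _ _ ?_
    by_contra hb
    obtain ⟨c, rfl⟩ := Nat.not_even_iff_odd.1 hb
    have := Finset.HasAntidiagonal.mem_antidiagonal.1 h
    refine hn ⟨((a - 1) / 2, c), Finset.mem_coe.2 (Finset.HasAntidiagonal.mem_antidiagonal.2 ?_), ?_⟩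
    · simp only at this ⊢
      omega
    · simp only [Prod.mk.injEq, and_true] at this ⊢
      omega

theorem prodPoly_sub_neg (m : ℕ) (X Y : ℚ) :
    prodPoly (2 * m + 2) X Y - prodPoly (2 * m + 2) X (-Y) =
      ∑ i ∈ antidiagonal m, (2 * X ^ (2 * i.1 + 1) * Y ^ (2 * i.2 + 1)) •
        (evenEis i.1 * evenEis i.2) := by
  rw [prodPoly, prodPoly, ← Finset.sum_sub_distrib]
  have h := sum_antidiagonal_odd m (fun a b =>
    (X ^ a * Y ^ b) • (gEis a * gEis b) - (X ^ a * (-Y) ^ b) • (gEis a * gEis b)) fun i j hj => by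
      rw [hj.neg_pow, sub_self]
  rw [h]
  refine Finset.sum_congr rfl fun i _ => ?_
  rw [Odd.neg_pow ⟨i.2, rfl⟩, evenEis, evenEis, ← sub_smul]
  congr 1
  ring

theorem homPoly_one_one (n : ℕ) : homPoly n 1 1 = n + 1 := by
  simp [homPoly]

theorem homPoly_zero_right (n : ℕ) (X : ℚ) : homPoly n X 0 = X ^ n := by
  rw [homPoly, Finset.sum_eq_single (n, 0)]
  · simp
  · rintro ⟨b, c⟩ hb hne
    rcases c with - | c
    · have := Finset.HasAntidiagonal.mem_antidiagonal.1 hb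
      exact absurd (by simp at this; rw [this]) hne
    · simp
  · intro h
    exact absurd (Finset.HasAntidiagonal.mem_antidiagonal.2 (by simp)) h

theorem homPoly_comm (n : ℕ) (X Y : ℚ) : homPoly n X Y = homPoly n Y X := by
  rw [homPoly, ← Finset.Nat.sum_antidiagonal_swap, homPoly]
  exact Finset.sum_congr rfl fun i _ => mul_comm _ _

theorem derivation_evenEis (D : Derivation ℚ FMES FMES)
    (hD : ∀ x, D (cls x) = cls (ofWords wordD x)) (m : ℕ) :
    D (evenEis m) = ((m + 1) * (2 * m + 5) : ℚ) • evenEis (m + 1) -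
      (2 * (m + 1) : ℚ) • ∑ i ∈ antidiagonal m, evenEis i.1 * evenEis i.2 := by
  have hN : Even (2 * m + 1 + 1) := ⟨m + 1, by ring⟩
  -- At `U = V = 1` the arguments with a zero cancel in pairs. What is left is the difference of the
  -- values at `(1, 1)` and `(1, -1)`, which retains only products of even Eisenstein series.
  have h := prodPoly_relation D hD (2 * m + 1) hN 1 1
  rw [sub_self, homPoly_one_one, homPoly_zero_right, homPoly_comm, homPoly_zero_right, hN.neg_pow,
    one_pow, zero_pow (by omega)] at h
  have h1 := prodPoly_sub_neg m 1 1
  simp only [one_pow, mul_one, ← Finset.smul_sum] at h1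
  change _ = _ • evenEis (m + 1) - _ • D (evenEis m) at h
  have h2 : (2 : ℚ) • ∑ i ∈ antidiagonal m, evenEis i.1 * evenEis i.2 =
      (2 * m + 5 : ℚ) • evenEis (m + 1) - (1 / (m + 1) : ℚ) • D (evenEis m) := by
    rw [← h1]
    refine Eq.trans ?_ (h.trans ?_)
    · change _ = prodPoly (2 * m + 2) 1 1 - prodPoly (2 * m + 2) 1 0 + prodPoly (2 * m + 2) 1 0 -
        prodPoly (2 * m + 2) 1 (-1) + prodPoly (2 * m + 2) 0 (-1) - prodPoly (2 * m + 2) 0 (-1)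
      abel
    · have hm : (m + 1 : ℚ) ≠ 0 := by positivity
      congr 2
      · push_cast; ring
      · push_cast
        field_simp
        ring
  have hm : (m + 1 : ℚ) ≠ 0 := by positivity
  linear_combination (norm := skip) (m + 1 : ℚ) • h2
  match_scalars
  · field_simp
    ring
  · ring
  · ring

/-- A second specialisation, `(U, V) = (1, 2)` in weight 8, is compared with the formula for `D
G(6)`. Eliminating `D G(6)` also removes `G(2) G(6)` and leaves `30 G(4)² = -42 G(8) + 66 G(4)²`. -/
theorem evenEis_three : evenEis 3 = (6 / 7 : ℚ) • evenEis 1 ^ 2 := by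
  obtain ⟨D, -, -, hD, -, -⟩ := exists_induced_derivations
  have h := prodPoly_relation D hD 5 ⟨3, rfl⟩ 1 2
  have h0 := derivation_evenEis D hD 2
  have e1 := prodPoly_sub_neg 2 1 2
  have e2 := prodPoly_sub_neg 2 2 1
  have e3 := prodPoly_sub_neg 2 1 1
  have hs : ∀ f : ℕ × ℕ → FMES, ∑ i ∈ antidiagonal 2, f i = f (0, 2) + (f (1, 1) + f (2, 0)) :=
    fun f => by simp [Finset.Nat.antidiagonal_succ]
  have hp : ∀ X Y, homPoly 6 X Y =
      Y ^ 6 + X * Y ^ 5 + X ^ 2 * Y ^ 4 + X ^ 3 * Y ^ 3 + X ^ 4 * Y ^ 2 + X ^ 5 * Y + X ^ 6 :=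
    fun X Y => by simp [homPoly, Finset.Nat.antidiagonal_succ]; ring
  rw [hs] at h0 e1 e2 e3
  simp only at h0 e1 e2 e3
  norm_num [hp] at h h0 e1 e2 e3
  change _ = _ • evenEis 3 - _ • D (evenEis 2) at h
  rw [h0] at h
  have h' : prodPoly 6 1 2 - prodPoly 6 1 1 + prodPoly 6 2 1 - prodPoly 6 2 (-1) +
      prodPoly 6 1 (-1) - prodPoly 6 1 (-2) = (prodPoly 6 1 2 - prodPoly 6 1 (-2)) +
        (prodPoly 6 2 1 - prodPoly 6 2 (-1)) - (prodPoly 6 1 1 - prodPoly 6 1 (-1)) := by abel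
  rw [h', e1, e2, e3] at h
  rw [mul_comm (evenEis 2), ← pow_two] at h
  linear_combination (norm := module) (1 / 42 : ℚ) • h

/-! ### Nested sums -/

/-- The nested sum over `M > u₁ > ⋯ > u_r ≥ 0` of the products of the `f a_j u_j`. -/
noncomputable def nested (f : Letter → ℕ → ℝ) : Word → ℕ → ℝ
  | [], _ => 1
  | a :: w, M => ∑ u ∈ Finset.range M, f a u * nested f w u

theorem nested_nonneg {f : Letter → ℕ → ℝ} (hf : ∀ a u, 0 ≤ f a u) (w : Word) (M : ℕ) :
    0 ≤ nested f w M := by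
  induction w generalizing M with
  | nil => exact zero_le_one
  | cons a w ih => exact Finset.sum_nonneg fun u _ => mul_nonneg (hf a u) (ih u)

theorem nested_mono {f : Letter → ℕ → ℝ} (hf : ∀ a u, 0 ≤ f a u) (w : Word) :
    Monotone (nested f w) := by
  intro M N hMN
  match w with
  | [] => exact le_rfl
  | a :: w =>
    exact Finset.sum_le_sum_of_subset_of_nonneg (Finset.range_mono hMN) fun u _ _ =>
      mul_nonneg (hf a u) (nested_nonneg hf w u)

/-- The linear extension of the nested sums. -/
noncomputable def nestedQA (f : Letter → ℕ → ℝ) (M : ℕ) : QA →ₗ[ℚ] ℝ :=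
  ofWords fun w => nested f w M

theorem nestedQA_cons_succ (f : Letter → ℕ → ℝ) (M : ℕ) (a : Letter) (x : QA) :
    nestedQA f (M + 1) (cons a x) = nestedQA f M (cons a x) + f a M * nestedQA f M x := by
  have h : ∀ w, nested f (a :: w) (M + 1) = nested f (a :: w) M + f a M * nested f w M :=
    fun w => Finset.sum_range_succ _ _
  induction x using QA.induction_word with
  | hw w => simp only [nestedQA, cons_word, ofWords_word, h]
  | h0 => simp
  | hadd x y hx hy => simp only [map_add, hx, hy]; ring
  | hsmul c x hx => simp only [map_smul, hx, Rat.smul_def]; ring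

theorem nestedQA_one (f : Letter → ℕ → ℝ) (M : ℕ) : nestedQA f M 1 = 1 := by
  rw [← word_nil, nestedQA, ofWords_word, nested]

theorem nestedQA_zero_cons (f : Letter → ℕ → ℝ) (a : Letter) (x : QA) :
    nestedQA f 0 (cons a x) = 0 := by
  have : nestedQA f 0 ∘ₗ cons a = 0 := hom_ext fun w => by simp [nestedQA, nested]
  exact LinearMap.congr_fun this x

theorem map_mul_of_words (φ : QA →ₗ[ℚ] ℝ)
    (h : ∀ a b w v, φ (cons a (word w) * cons b (word v)) =
      φ (cons a (word w)) * φ (cons b (word v))) (h1 : φ 1 = 1) (x y : QA) :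
    φ (x * y) = φ x * φ y :=
  mul_ext₂ (f := (LinearMap.mul ℚ QA).compr₂ φ) (g := (LinearMap.mul ℚ ℝ).compl₁₂ φ φ)
    (fun w v => by
      change φ (word w * word v) = φ (word w) * φ (word v)
      match w, v with
      | [], v => rw [word_nil, one_mul, h1, one_mul]
      | a :: w, [] => rw [word_nil, mul_one, h1, mul_one]
      | a :: w, b :: v =>
        rw [← cons_word, ← cons_word]
        exact h a b w v) x y

/-- Raising the bound from `M` to `M + 1` adds the terms whose largest index is `M`. In a product
this index is attained in the first factor, the second, or both, which are the three terms of the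
stuffle recursion; the last one uses multiplicativity of `f` in the letter. -/
theorem nestedQA_mul {f : Letter → ℕ → ℝ} (hf : ∀ a b u, f (a + b) u = f a u * f b u) (M : ℕ)
    (x y : QA) : nestedQA f M (x * y) = nestedQA f M x * nestedQA f M y := by
  induction M generalizing x y with
  | zero =>
    refine map_mul_of_words _ (fun a b w v => ?_) (nestedQA_one f 0) x y
    rw [cons_mul_cons]
    simp only [map_add, nestedQA_zero_cons, mul_zero, add_zero]
  | succ M ih =>
    refine map_mul_of_words _ (fun a b w v => ?_) (nestedQA_one f _) x y
    have h := ih (cons a (word w)) (cons b (word v))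
    rw [cons_mul_cons] at h ⊢
    simp only [map_add, nestedQA_cons_succ] at h ⊢
    rw [ih (word w) (cons b (word v)), ih (cons a (word w)) (word v), ih (word w) (word v), hf]
    linear_combination h

/-- Upper bounds for nested sums. -/
theorem nested_le {f : Letter → ℕ → ℝ} (hf : ∀ a u, 0 ≤ f a u) {b : ℕ → ℝ}
    {L : ℝ} (hL : ∀ M, ∑ u ∈ Finset.range M, b u ≤ L) {C : Letter → ℝ}
    (hC : ∀ a, 0 ≤ C a) (hL0 : 0 ≤ L) (hfb : ∀ a u, f a u ≤ C a * b u) (w : Word) (M : ℕ) :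
    nested f w M ≤ (w.map C).prod * L ^ w.length := by
  induction w generalizing M with
  | nil => simp [nested]
  | cons a w ih =>
    have h0 : 0 ≤ (w.map C).prod * L ^ w.length :=
      mul_nonneg (List.prod_nonneg fun c hc => by
        obtain ⟨b, -, rfl⟩ := List.mem_map.1 hc
        exact hC b) (pow_nonneg hL0 _)
    calc nested f (a :: w) M ≤ ∑ u ∈ Finset.range M, (C a * b u) *
          ((w.map C).prod * L ^ w.length) := Finset.sum_le_sum fun u _ =>
            mul_le_mul (hfb a u) (ih u) (nested_nonneg hf w u) ((hf a u).trans (hfb a u))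
      _ = (C a * ((w.map C).prod * L ^ w.length)) * ∑ u ∈ Finset.range M, b u := by
          rw [Finset.mul_sum]
          exact Finset.sum_congr rfl fun u _ => by ring
      _ ≤ (C a * ((w.map C).prod * L ^ w.length)) * L :=
          mul_le_mul_of_nonneg_left (hL M) (mul_nonneg (hC a) h0)
      _ = _ := by rw [List.map_cons, List.prod_cons, List.length_cons, pow_succ]; ring

/-- The limit of the nested sums. -/
noncomputable def nestedLim (f : Letter → ℕ → ℝ) : QA →ₗ[ℚ] ℝ :=
  ofWords fun w => ⨆ M, nested f w M

theorem tendsto_nested {f : Letter → ℕ → ℝ} (hf : ∀ a u, 0 ≤ f a u)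
    (hb : ∀ w, BddAbove (Set.range (nested f w))) (x : QA) :
    Filter.Tendsto (fun M => nestedQA f M x) Filter.atTop (nhds (nestedLim f x)) := by
  induction x using QA.induction_word with
  | hw w =>
    simp only [nestedQA, nestedLim, ofWords_word]
    exact tendsto_atTop_ciSup (nested_mono hf w) (hb w)
  | h0 => simp
  | hadd x y hx hy => simpa only [map_add] using hx.add hy
  | hsmul c x hx => simpa only [map_smul] using hx.const_smul c

theorem nestedLim_mul {f : Letter → ℕ → ℝ} (hf : ∀ a u, 0 ≤ f a u)
    (hb : ∀ w, BddAbove (Set.range (nested f w))) (hm : ∀ a b u, f (a + b) u = f a u * f b u)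
    (x y : QA) : nestedLim f (x * y) = nestedLim f x * nestedLim f y := by
  refine tendsto_nhds_unique (tendsto_nested hf hb (x * y)) ?_
  simp only [nestedQA_mul hm]
  exact (tendsto_nested hf hb x).mul (tendsto_nested hf hb y)

/-- Comparison of two nested sums. -/
theorem nested_sub_le {f F : Letter → ℕ → ℝ} (hf : ∀ a u, 0 ≤ f a u) (hfF : ∀ a u, f a u ≤ F a u)
    {b : ℕ → ℝ} {L h : ℝ} (hL : ∀ M, ∑ u ∈ Finset.range M, b u ≤ L) {C : Letter → ℝ}
    (hC : ∀ a, 0 ≤ C a) (hL0 : 0 ≤ L) (h0 : 0 ≤ h) (hFb : ∀ a u, F a u ≤ C a * b u)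
    (hd : ∀ a u, F a u - f a u ≤ h * (C a * b u)) (w : Word) (M : ℕ) :
    nested F w M - nested f w M ≤ w.length * h * ((w.map C).prod * L ^ w.length) := by
  induction w generalizing M with
  | nil => simp [nested]
  | cons a w ih =>
    set B := (w.map C).prod * L ^ w.length with hB
    have hF : ∀ a u, 0 ≤ F a u := fun a u => (hf a u).trans (hfF a u)
    have hB0 : 0 ≤ B :=
      mul_nonneg (List.prod_nonneg fun c hc => by
        obtain ⟨b, -, rfl⟩ := List.mem_map.1 hc
        exact hC b) (pow_nonneg hL0 _)
    calc nested F (a :: w) M - nested f (a :: w) M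
        = ∑ u ∈ Finset.range M, ((F a u - f a u) * nested F w u +
            f a u * (nested F w u - nested f w u)) := by
          rw [nested, nested, ← Finset.sum_sub_distrib]
          exact Finset.sum_congr rfl fun u _ => by ring
      _ ≤ ∑ u ∈ Finset.range M, (h * (C a * b u) * B + (C a * b u) * (w.length * h * B)) := by
          refine Finset.sum_le_sum fun u _ => add_le_add ?_ ?_
          · exact mul_le_mul (hd a u) (nested_le hF hL hC hL0 hFb w u) (nested_nonneg hF w u)
              ((sub_nonneg.2 (hfF a u)).trans (hd a u))
          · exact (mul_le_mul_of_nonneg_left (ih u) (hf a u)).trans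
              (mul_le_mul_of_nonneg_right ((hfF a u).trans (hFb a u)) (by positivity))
      _ = (C a * ((w.length + 1) * h * B)) * ∑ u ∈ Finset.range M, b u := by
          rw [Finset.mul_sum]
          exact Finset.sum_congr rfl fun u _ => by ring
      _ ≤ (C a * ((w.length + 1) * h * B)) * L :=
          mul_le_mul_of_nonneg_left (hL M) (mul_nonneg (hC a) (by positivity))
      _ = _ := by
          rw [List.map_cons, List.prod_cons, List.length_cons, pow_succ, hB]; push_cast; ring

theorem nested_mono_fun {f F : Letter → ℕ → ℝ} (hf : ∀ a u, 0 ≤ f a u)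
    (hfF : ∀ a u, f a u ≤ F a u) (w : Word) (M : ℕ) : nested f w M ≤ nested F w M := by
  induction w generalizing M with
  | nil => exact le_rfl
  | cons a w ih =>
    exact Finset.sum_le_sum fun u _ =>
      mul_le_mul (hfF a u) (ih u) (nested_nonneg hf w u) ((hf a u).trans (hfF a u))

/-- Words with a letter of positive second index. -/
theorem nested_le_of_exists_pos {f : Letter → ℕ → ℝ} (hf : ∀ a u, 0 ≤ f a u) {b : ℕ → ℝ}
    {L h : ℝ} (hL : ∀ M, ∑ u ∈ Finset.range M, b u ≤ L) {C : Letter → ℝ}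
    (hC : ∀ a, 0 ≤ C a) (hL0 : 0 ≤ L) (h0 : 0 ≤ h) (hfb : ∀ a u, f a u ≤ C a * b u)
    (hpos : ∀ a u, a.2 ≠ 0 → f a u ≤ h * u * (C a * b u)) (w : Word) (hw : ∃ a ∈ w, a.2 ≠ 0)
    (M : ℕ) : nested f w M ≤ h * M * ((w.map C).prod * L ^ w.length) := by
  induction w generalizing M with
  | nil => simp at hw
  | cons a w ih =>
    set B := (w.map C).prod * L ^ w.length with hB
    have hB0 : 0 ≤ B :=
      mul_nonneg (List.prod_nonneg fun c hc => by
        obtain ⟨b, -, rfl⟩ := List.mem_map.1 hc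
        exact hC b) (pow_nonneg hL0 _)
    have hCb : ∀ u, 0 ≤ C a * b u := fun u => (hf a u).trans (hfb a u)
    have key : ∀ u ∈ Finset.range M, f a u * nested f w u ≤ (C a * b u) * (h * M * B) := by
      intro u hu
      have huM : (u : ℝ) ≤ M := Nat.cast_le.2 (Finset.mem_range.1 hu).le
      by_cases ha : a.2 = 0
      · have hw' : ∃ a ∈ w, a.2 ≠ 0 := by
          obtain ⟨c, hc, hc'⟩ := hw
          rcases List.mem_cons.1 hc with rfl | hc
          · exact absurd ha hc'
          · exact ⟨c, hc, hc'⟩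
        refine mul_le_mul (hfb a u) ((ih hw' u).trans ?_) (nested_nonneg hf w u) (hCb u)
        gcongr
      · refine (mul_le_mul ((hpos a u ha).trans ?_) (nested_le hf hL hC hL0 hfb w u)
          (nested_nonneg hf w u) ?_).trans (le_of_eq ?_) (b := (h * M * (C a * b u)) * B)
        · have := hCb u
          gcongr
        · have := hCb u
          positivity
        · ring
    calc nested f (a :: w) M ≤ ∑ u ∈ Finset.range M, (C a * b u) * (h * M * B) :=
          Finset.sum_le_sum key
      _ = (C a * (h * M * B)) * ∑ u ∈ Finset.range M, b u := by
          rw [Finset.mul_sum]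
          exact Finset.sum_congr rfl fun u _ => by ring
      _ ≤ (C a * (h * M * B)) * L :=
          mul_le_mul_of_nonneg_left (hL M) (mul_nonneg (hC a) (by positivity))
      _ = _ := by rw [List.map_cons, List.prod_cons, List.length_cons, pow_succ, hB]; ring

theorem isSplitWord_cons_one {a : Letter} {w : Word} (ha : a.1 = 1) (hw : IsSplitWord w) :
    IsSplitWord (a :: w) := by
  obtain ⟨u, v, rfl, hu, hv⟩ := hw
  refine ⟨a :: u, v, rfl, fun c hc => ?_, hv⟩
  rcases List.mem_cons.1 hc with rfl | hc
  · exact ha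
  · exact hu c hc

/-- Initial letters with upper index 1 are peeled off. At the first letter with larger upper index,
either its own lower index is positive and gives the factor `h`, or a later letter has positive
lower index. In the latter case the inner sum is bounded with a factor `h u`, and the superfluous
`u` is absorbed by the stronger decay of the current letter. -/
theorem nested_le_of_not_isSplitWord {f : Letter → ℕ → ℝ} (hf : ∀ a u, 0 ≤ f a u) {b : ℕ → ℝ}
    {L h : ℝ} (hL : ∀ M, ∑ u ∈ Finset.range M, b u ≤ L) {C : Letter → ℝ}
    (hC : ∀ a, 0 ≤ C a) (hL0 : 0 ≤ L) (h0 : 0 ≤ h) (hfb : ∀ a u, f a u ≤ C a * b u)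
    (hpos : ∀ a u, a.2 ≠ 0 → f a u ≤ h * u * (C a * b u))
    (hk : ∀ a u, a.1 ≠ 1 → u * f a u ≤ C a * b u)
    (hkpos : ∀ a u, a.1 ≠ 1 → a.2 ≠ 0 → f a u ≤ h * (C a * b u))
    (w : Word) (hw : ¬ IsSplitWord w) (M : ℕ) :
    nested f w M ≤ h * ((w.map C).prod * L ^ w.length) := by
  induction w generalizing M with
  | nil => exact absurd ⟨[], [], rfl, by simp, by simp⟩ hw
  | cons a w ih =>
    set B := (w.map C).prod * L ^ w.length with hB
    have hB0 : 0 ≤ B :=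
      mul_nonneg (List.prod_nonneg fun c hc => by
        obtain ⟨b, -, rfl⟩ := List.mem_map.1 hc
        exact hC b) (pow_nonneg hL0 _)
    have hCb : ∀ u, 0 ≤ C a * b u := fun u => (hf a u).trans (hfb a u)
    have key : ∀ u, f a u * nested f w u ≤ (C a * b u) * (h * B) := by
      intro u
      by_cases ha : a.1 = 1
      · exact mul_le_mul (hfb a u) (ih (fun h' => hw (isSplitWord_cons_one ha h')) u)
          (nested_nonneg hf w u) (hCb u)
      by_cases ha2 : a.2 = 0
      · have hw' : ∃ c ∈ w, c.2 ≠ 0 := by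
          by_contra hn
          push Not at hn
          refine hw ⟨[], a :: w, rfl, by simp, fun c hc => ?_⟩
          rcases List.mem_cons.1 hc with rfl | hc
          · exact ha2
          · exact hn c hc
        calc f a u * nested f w u ≤ f a u * (h * u * B) :=
              mul_le_mul_of_nonneg_left (nested_le_of_exists_pos hf hL hC hL0 h0 hfb hpos w hw' u)
                (hf a u)
          _ = (u * f a u) * (h * B) := by ring
          _ ≤ _ := mul_le_mul_of_nonneg_right (hk a u ha) (mul_nonneg h0 hB0)
      · calc f a u * nested f w u ≤ (h * (C a * b u)) * B :=
              mul_le_mul (hkpos a u ha ha2) (nested_le hf hL hC hL0 hfb w u) (nested_nonneg hf w u)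
                (mul_nonneg h0 (hCb u))
          _ = _ := by ring
    calc nested f (a :: w) M ≤ ∑ u ∈ Finset.range M, (C a * b u) * (h * B) :=
          Finset.sum_le_sum fun u _ => key u
      _ = (C a * (h * B)) * ∑ u ∈ Finset.range M, b u := by
          rw [Finset.mul_sum]
          exact Finset.sum_congr rfl fun u _ => by ring
      _ ≤ (C a * (h * B)) * L :=
          mul_le_mul_of_nonneg_left (hL M) (mul_nonneg (hC a) (by positivity))
      _ = _ := by rw [List.map_cons, List.prod_cons, List.length_cons, pow_succ, hB]; ring

/-! ### Estimates for one letter -/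

/-- The series `∑ v ^ j / j! · Y ^ v` over `v ≥ 1`. -/
noncomputable def powSeries (j : ℕ) (Y : ℝ) : ℝ :=
  ∑' m : ℕ, ((m : ℝ) + 1) ^ j / (j.factorial : ℝ) * Y ^ (m + 1)

theorem pow_div_factorial_le_choose (j m : ℕ) :
    ((m : ℝ) + 1) ^ j / (j.factorial : ℝ) ≤ ((m + j).choose j : ℝ) := by
  have := Nat.pow_le_choose (α := ℝ) j (m + j)
  rw [show m + j + 1 - j = m + 1 by omega] at this
  exact_mod_cast this

theorem choose_le_pow_div_factorial (j m : ℕ) :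
    (m.choose j : ℝ) ≤ ((m : ℝ) + 1) ^ j / (j.factorial : ℝ) :=
  (Nat.choose_le_pow_div (α := ℝ) j m).trans (by gcongr; linarith)

theorem hasSum_choose {Y : ℝ} (hY0 : 0 ≤ Y) (hY1 : Y < 1) (j : ℕ) :
    HasSum (fun m => ((m + j).choose j : ℝ) * Y ^ m) (1 / (1 - Y) ^ (j + 1)) :=
  hasSum_choose_mul_geometric_of_norm_lt_one j (by rwa [Real.norm_of_nonneg hY0])

theorem summable_powSeries {Y : ℝ} (hY0 : 0 ≤ Y) (hY1 : Y < 1) (j : ℕ) :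
    Summable fun m : ℕ => ((m : ℝ) + 1) ^ j / (j.factorial : ℝ) * Y ^ (m + 1) := by
  refine Summable.of_nonneg_of_le (fun m => by positivity) (fun m => ?_)
    ((hasSum_choose hY0 hY1 j).summable.mul_right Y)
  rw [pow_succ, ← mul_assoc]
  exact mul_le_mul_of_nonneg_right (mul_le_mul_of_nonneg_right (pow_div_factorial_le_choose j m)
    (pow_nonneg hY0 _)) hY0

theorem powSeries_le {Y : ℝ} (hY0 : 0 ≤ Y) (hY1 : Y < 1) (j : ℕ) :
    powSeries j Y ≤ Y / (1 - Y) ^ (j + 1) := by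
  have h := (hasSum_choose hY0 hY1 j).mul_right Y
  rw [one_div_mul_eq_div] at h
  refine hasSum_le (fun m => ?_) (summable_powSeries hY0 hY1 j).hasSum h
  rw [pow_succ, ← mul_assoc]
  exact mul_le_mul_of_nonneg_right (mul_le_mul_of_nonneg_right (pow_div_factorial_le_choose j m)
    (pow_nonneg hY0 _)) hY0

/-- Both comparisons of `powSeries` with rational functions rest on `∑ C(m+j, j) Y^m = (1 -
Y)^(-(j+1))`. For the lower bound the binomial series is shifted by `j`, so that its coefficients
fall below those of `powSeries`. -/
theorem le_powSeries {Y : ℝ} (hY0 : 0 ≤ Y) (hY1 : Y < 1) (j : ℕ) :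
    (Y / (1 - Y)) ^ (j + 1) ≤ powSeries j Y := by
  have h := (hasSum_choose hY0 hY1 j).mul_right (Y ^ (j + 1))
  rw [one_div_mul_eq_div, ← div_pow] at h
  rw [← h.tsum_eq]
  refine h.summable.tsum_le_tsum_of_inj (fun m => m + j) (fun a b hab => by simpa using hab)
    (fun c _ => by positivity) (fun m => ?_) (summable_powSeries hY0 hY1 j)
  rw [mul_assoc, ← pow_add, ← add_assoc]
  exact mul_le_mul_of_nonneg_right (choose_le_pow_div_factorial j (m + j)) (pow_nonneg hY0 _)

/-- The upper and lower bounds differ by the factor `1 - Y^j ≤ j (1 - Y)`, so the difference has a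
pole at `Y = 1` of order one less. This lost order is the source of the factor `h` between the two
realizations. -/
theorem powSeries_sub_le {Y : ℝ} (hY0 : 0 ≤ Y) (hY1 : Y < 1) (j : ℕ) :
    powSeries j Y - (Y / (1 - Y)) ^ (j + 1) ≤ j * (Y / (1 - Y) ^ j) := by
  have h1 : 0 < 1 - Y := sub_pos.2 hY1
  have h2 : 1 - Y ^ j ≤ j * (1 - Y) := by
    have := one_add_mul_le_pow (a := Y - 1) (by linarith) j
    rw [add_sub_cancel] at this
    linarith
  calc powSeries j Y - (Y / (1 - Y)) ^ (j + 1)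
      ≤ Y / (1 - Y) ^ (j + 1) - (Y / (1 - Y)) ^ (j + 1) := sub_le_sub_right (powSeries_le hY0 hY1 j) _
    _ = Y / (1 - Y) ^ (j + 1) * (1 - Y ^ j) := by rw [div_pow, pow_succ Y]; ring
    _ ≤ Y / (1 - Y) ^ (j + 1) * (j * (1 - Y)) := by gcongr
    _ = _ := by rw [pow_succ]; field_simp

/-- The multiplicative letter functions. -/
noncomputable def chiLetter (h : ℝ) (a : Letter) (u : ℕ) : ℝ :=
  if u = 0 then 0 else (h * u) ^ a.2 *
    (h * (Real.exp (-(h * u)) / (1 - Real.exp (-(h * u))))) ^ (a.1 : ℕ)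

/-- The letter functions that are compatible with the swap. -/
noncomputable def phiLetter (h : ℝ) (a : Letter) (u : ℕ) : ℝ :=
  if u = 0 then 0 else (h * u) ^ a.2 *
    (h ^ (a.1 : ℕ) * powSeries a.1.natPred (Real.exp (-(h * u))))

theorem chiLetter_add (h : ℝ) (a b : Letter) (u : ℕ) :
    chiLetter h (a + b) u = chiLetter h a u * chiLetter h b u := by
  rw [chiLetter, chiLetter, chiLetter]
  split_ifs
  · simp
  · rw [Prod.fst_add, Prod.snd_add, PNat.add_coe, pow_add, pow_add]
    ring

theorem exp_neg_mem {x : ℝ} (hx : 0 < x) : 0 ≤ Real.exp (-x) ∧ Real.exp (-x) < 1 :=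
  ⟨(Real.exp_pos _).le, by simpa using hx⟩

theorem chiLetter_nonneg {h : ℝ} (hh : 0 < h) (a : Letter) (u : ℕ) : 0 ≤ chiLetter h a u := by
  rw [chiLetter]
  split_ifs with hu
  · exact le_rfl
  · have hx : 0 < h * u := mul_pos hh (Nat.cast_pos.2 (Nat.pos_of_ne_zero hu))
    obtain ⟨h0, h1⟩ := exp_neg_mem hx
    have := sub_pos.2 h1
    positivity

theorem chiLetter_le_phiLetter {h : ℝ} (hh : 0 < h) (a : Letter) (u : ℕ) :
    chiLetter h a u ≤ phiLetter h a u := by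
  rw [chiLetter, phiLetter]
  split_ifs with hu
  · exact le_rfl
  · have hx : 0 < h * u := mul_pos hh (Nat.cast_pos.2 (Nat.pos_of_ne_zero hu))
    obtain ⟨h0, h1⟩ := exp_neg_mem hx
    have h2 := le_powSeries h0 h1 a.1.natPred
    rw [PNat.natPred_add_one] at h2
    rw [mul_pow h (_ / _)]
    gcongr

/-- Three quarters of the exponential decay absorb the polynomial, by the `n`-th power of `1 + x ≤ 2
n exp(3x / (4n))`; one quarter is kept for summability. -/
theorem one_add_pow_le (n : ℕ) {x : ℝ} (hx : 0 ≤ x) :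
    (1 + x) ^ n * Real.exp (-x) ≤ (2 * n : ℝ) ^ n * Real.exp (-(x / 4)) := by
  have h1 : (1 + x) ^ n ≤ (2 * n : ℝ) ^ n * Real.exp (3 * x / 4) := by
    rcases Nat.eq_zero_or_pos n with rfl | hn
    · simpa using by positivity
    · have hn' : (1 : ℝ) ≤ n := Nat.one_le_cast.2 hn
      have h2 : 1 + x ≤ 2 * n * Real.exp (3 * x / 4 / n) := by
        have h3 := Real.add_one_le_exp (3 * x / 4 / n)
        have h4 : 1 + x ≤ 2 * n * (3 * x / 4 / n + 1) := by
          have : 2 * n * (3 * x / 4 / n + 1) = 3 * x / 2 + 2 * n := by field_simp; ring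
          rw [this]
          linarith
        exact h4.trans (mul_le_mul_of_nonneg_left h3 (by positivity))
      calc (1 + x) ^ n ≤ (2 * n * Real.exp (3 * x / 4 / n)) ^ n :=
            pow_le_pow_left₀ (by positivity) h2 n
        _ = _ := by
            rw [mul_pow, ← Real.exp_nat_mul, mul_div_cancel₀ _ (by positivity)]
  calc (1 + x) ^ n * Real.exp (-x) ≤ (2 * n : ℝ) ^ n * Real.exp (3 * x / 4) * Real.exp (-x) :=
        mul_le_mul_of_nonneg_right h1 (Real.exp_pos _).le
    _ = _ := by rw [mul_assoc, ← Real.exp_add]; congr 2; ring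

/-- The constants in the letter bounds. -/
noncomputable def letterConst (a : Letter) : ℝ :=
  (a.1 : ℕ) * (2 * ((a.1 : ℕ) + a.2 : ℕ) : ℝ) ^ ((a.1 : ℕ) + a.2)

theorem letterConst_nonneg (a : Letter) : 0 ≤ letterConst a := by
  rw [letterConst]; positivity

/-- The weight function of the letter bounds. -/
noncomputable def letterWeight (h : ℝ) (u : ℕ) : ℝ := Real.exp (-(h * u / 4)) / u

theorem div_one_sub_exp_le {h : ℝ} (hh : 0 < h) {u : ℕ} (hu : u ≠ 0) :
    h / (1 - Real.exp (-(h * u))) ≤ (1 + h * u) / u := by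
  have hu' : (0 : ℝ) < u := Nat.cast_pos.2 (Nat.pos_of_ne_zero hu)
  have hx : 0 < h * u := mul_pos hh hu'
  obtain ⟨h0, h1⟩ := exp_neg_mem hx
  rw [div_le_div_iff₀ (sub_pos.2 h1) hu']
  have h2 : (1 + h * u) * Real.exp (-(h * u)) ≤ 1 := by
    calc (1 + h * u) * Real.exp (-(h * u)) ≤ Real.exp (h * u) * Real.exp (-(h * u)) :=
          mul_le_mul_of_nonneg_right (by linarith [Real.add_one_le_exp (h * u)]) h0
      _ = 1 := by rw [← Real.exp_add, add_neg_cancel, Real.exp_zero]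
  linarith

/-- Of the factor `(h u)^d` a part `(h u)^e` is kept explicit and the rest is estimated away. The
choice `e = 1` is what yields the small factor for letters with positive lower index. -/
theorem phiLetter_mul_pow_le {h : ℝ} (hh : 0 < h) (a : Letter) (u : ℕ) (e : ℕ) (he : e ≤ a.2) :
    phiLetter h a u * u ^ (a.1 : ℕ) ≤
      (h * u) ^ e * ((2 * ((a.1 : ℕ) + a.2 : ℕ) : ℝ) ^ ((a.1 : ℕ) + a.2) *
        Real.exp (-(h * u / 4))) := by
  rw [phiLetter]
  split_ifs with hu
  · rw [zero_mul]; positivity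
  have hu' : (0 : ℝ) < u := Nat.cast_pos.2 (Nat.pos_of_ne_zero hu)
  have hx : 0 < h * u := mul_pos hh hu'
  obtain ⟨h0, h1⟩ := exp_neg_mem hx
  have h2 := powSeries_le h0 h1 a.1.natPred
  rw [PNat.natPred_add_one] at h2
  have h3 := div_one_sub_exp_le hh hu
  have h4 := sub_pos.2 h1
  set x := h * u with hxdef
  set Y := Real.exp (-x) with hYdef
  calc x ^ a.2 * (h ^ (a.1 : ℕ) * powSeries a.1.natPred Y) * u ^ (a.1 : ℕ)
      ≤ x ^ a.2 * (h ^ (a.1 : ℕ) * (Y / (1 - Y) ^ (a.1 : ℕ))) * u ^ (a.1 : ℕ) := by gcongr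
    _ = x ^ a.2 * ((h / (1 - Y)) ^ (a.1 : ℕ) * u ^ (a.1 : ℕ)) * Y := by rw [div_pow]; ring
    _ ≤ x ^ a.2 * (((1 + x) / u) ^ (a.1 : ℕ) * u ^ (a.1 : ℕ)) * Y := by gcongr
    _ = x ^ a.2 * (1 + x) ^ (a.1 : ℕ) * Y := by
        rw [← mul_pow, div_mul_cancel₀ _ hu'.ne']
    _ ≤ (x ^ e * (1 + x) ^ a.2) * (1 + x) ^ (a.1 : ℕ) * Y := by
        gcongr
        obtain ⟨c, hc⟩ := Nat.exists_eq_add_of_le he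
        rw [hc, pow_add x]
        gcongr
        · exact (pow_le_pow_left₀ hx.le (by linarith) c).trans
            (pow_le_pow_right₀ (by linarith) (by omega))
    _ = x ^ e * ((1 + x) ^ ((a.1 : ℕ) + a.2) * Y) := by rw [pow_add]; ring
    _ ≤ _ := mul_le_mul_of_nonneg_left (one_add_pow_le _ hx.le) (pow_nonneg hx.le _)

theorem letterConst_ge (a : Letter) :
    (2 * ((a.1 : ℕ) + a.2 : ℕ) : ℝ) ^ ((a.1 : ℕ) + a.2) ≤ letterConst a :=
  le_mul_of_one_le_left (by positivity) (Nat.one_le_cast.2 a.1.pos)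

/-- The common form of the letter bounds. -/
theorem phiLetter_mul_pow_le' {h : ℝ} (hh : 0 < h) (a : Letter) (u : ℕ) (e m : ℕ) (he : e ≤ a.2)
    (hm : m + 1 ≤ (a.1 : ℕ)) :
    phiLetter h a u * u ^ m ≤ (h * u) ^ e * (letterConst a * letterWeight h u) := by
  rcases Nat.eq_zero_or_pos u with rfl | hu
  · simp [phiLetter, letterWeight]
  have hu' : (0 : ℝ) < u := Nat.cast_pos.2 hu
  have hu1 : (1 : ℝ) ≤ u := Nat.one_le_cast.2 hu
  have h0 : 0 ≤ phiLetter h a u := (chiLetter_nonneg hh a u).trans (chiLetter_le_phiLetter hh a u)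
  have h1 := phiLetter_mul_pow_le hh a u e he
  rw [letterWeight, mul_div_assoc', mul_div_assoc', le_div_iff₀ hu', mul_assoc, ← pow_succ]
  calc phiLetter h a u * u ^ (m + 1) ≤ phiLetter h a u * u ^ (a.1 : ℕ) := by
        gcongr
    _ ≤ _ := h1
    _ ≤ _ := by
        gcongr
        exact letterConst_ge a

theorem phiLetter_le {h : ℝ} (hh : 0 < h) (a : Letter) (u : ℕ) :
    phiLetter h a u ≤ letterConst a * letterWeight h u := by
  have := phiLetter_mul_pow_le' hh a u 0 0 (Nat.zero_le _) a.1.pos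
  simpa using this

theorem phiLetter_le_of_pos {h : ℝ} (hh : 0 < h) (a : Letter) (u : ℕ) (ha : a.2 ≠ 0) :
    phiLetter h a u ≤ h * u * (letterConst a * letterWeight h u) := by
  have := phiLetter_mul_pow_le' hh a u 1 0 (Nat.pos_of_ne_zero ha) a.1.pos
  simpa using this

theorem two_le_of_ne_one {k : ℕ+} (hk : k ≠ 1) : 2 ≤ (k : ℕ) := by
  have := k.pos
  have : (k : ℕ) ≠ 1 := fun h => hk (PNat.coe_injective h)
  omega

theorem mul_phiLetter_le {h : ℝ} (hh : 0 < h) (a : Letter) (u : ℕ) (ha : a.1 ≠ 1) :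
    u * phiLetter h a u ≤ letterConst a * letterWeight h u := by
  have := phiLetter_mul_pow_le' hh a u 0 1 (Nat.zero_le _) (two_le_of_ne_one ha)
  simpa [mul_comm] using this

theorem phiLetter_le_mul {h : ℝ} (hh : 0 < h) (a : Letter) (u : ℕ) (ha : a.1 ≠ 1)
    (ha2 : a.2 ≠ 0) : phiLetter h a u ≤ h * (letterConst a * letterWeight h u) := by
  rcases Nat.eq_zero_or_pos u with rfl | hu
  · simp [phiLetter, letterWeight]
  have hu' : (0 : ℝ) < u := Nat.cast_pos.2 hu
  have := phiLetter_mul_pow_le' hh a u 1 1 (Nat.pos_of_ne_zero ha2) (two_le_of_ne_one ha)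
  rw [pow_one, pow_one, mul_right_comm] at this
  exact le_of_mul_le_mul_right this hu'

/-- By `powSeries_sub_le` the difference has only `k - 1` factors `1 / (1 - Y)`, each compensated by
one of the `k` factors `h`; one factor `h` is left over. -/
theorem phiLetter_sub_le {h : ℝ} (hh : 0 < h) (a : Letter) (u : ℕ) :
    phiLetter h a u - chiLetter h a u ≤ h * (letterConst a * letterWeight h u) := by
  rw [phiLetter, chiLetter]
  split_ifs with hu
  · simp [hu, letterWeight]
  have hu' : (0 : ℝ) < u := Nat.cast_pos.2 (Nat.pos_of_ne_zero hu)
  have hu1 : (1 : ℝ) ≤ u := Nat.one_le_cast.2 (Nat.pos_of_ne_zero hu)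
  have hx : 0 < h * u := mul_pos hh hu'
  obtain ⟨h0, h1⟩ := exp_neg_mem hx
  have h2 := powSeries_sub_le h0 h1 a.1.natPred
  have h3 := div_one_sub_exp_le hh hu
  have h4 := sub_pos.2 h1
  have hk : (a.1 : ℕ) = a.1.natPred + 1 := (PNat.natPred_add_one _).symm
  have hw : 0 ≤ letterWeight h u := by rw [letterWeight]; positivity
  rw [← mul_sub, mul_pow h (_ / _), ← mul_sub]
  set j := a.1.natPred with hj
  -- For `k = 1` the difference is not positive. The main estimate needs `j ≥ 1`, because it spends
  -- one factor `1 / u` on the weight function.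
  rcases Nat.eq_zero_or_pos j with hj0 | hj0
  · rw [hk]
    rw [hj0] at h2 ⊢
    rw [Nat.cast_zero, zero_mul] at h2
    exact (mul_nonpos_of_nonneg_of_nonpos (by positivity)
      (mul_nonpos_of_nonneg_of_nonpos (by positivity) h2)).trans
        (mul_nonneg hh.le (mul_nonneg (letterConst_nonneg a) hw))
  set x := h * u with hxdef
  set Y := Real.exp (-x) with hYdef
  set n := (a.1 : ℕ) + a.2 with hn
  have h5 : x ^ a.2 * (((1 + x) / u) ^ j) * Y ≤ ((1 + x) ^ n * Y) / u := by
    rw [div_pow, mul_div_assoc', div_mul_eq_mul_div]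
    have e1 : x ^ a.2 * (1 + x) ^ j ≤ (1 + x) ^ n := by
      calc x ^ a.2 * (1 + x) ^ j ≤ (1 + x) ^ a.2 * (1 + x) ^ j := by
            gcongr
            linarith
        _ = (1 + x) ^ (a.2 + j) := (pow_add _ _ _).symm
        _ ≤ (1 + x) ^ n := pow_le_pow_right₀ (by linarith) (by omega)
    gcongr
    exact le_self_pow₀ hu1 (by omega)
  calc x ^ a.2 * (h ^ (a.1 : ℕ) * (powSeries j Y - (Y / (1 - Y)) ^ (a.1 : ℕ)))
      ≤ x ^ a.2 * (h ^ (j + 1) * (j * (Y / (1 - Y) ^ j))) := by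
        rw [hk]
        gcongr
    _ = h * j * (x ^ a.2 * ((h / (1 - Y)) ^ j) * Y) := by rw [div_pow, pow_succ]; ring
    _ ≤ h * j * (x ^ a.2 * (((1 + x) / u) ^ j) * Y) := by gcongr
    _ ≤ h * j * (((1 + x) ^ n * Y) / u) := by gcongr
    _ ≤ h * j * (((2 * n : ℝ) ^ n * Real.exp (-(x / 4))) / u) := by
        exact mul_le_mul_of_nonneg_left (div_le_div_of_nonneg_right (one_add_pow_le n hx.le) hu'.le)
          (by positivity)
    _ = h * (j * (2 * n : ℝ) ^ n * letterWeight h u) := by rw [letterWeight]; ring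
    _ ≤ _ := by
        rw [letterConst, ← hn]
        gcongr
        omega

/-- The weights are the terms of the logarithm series at `exp(-h/4)`, the one at `u = 0` being zero
by division by zero. The bound follows from `1 / (1 - exp(-h/4)) ≤ (4 + h) / h ≤ 5 / h`, where `h ≤
1` enters. -/
theorem sum_letterWeight_le {h : ℝ} (hh : 0 < h) (h1 : h ≤ 1) (M : ℕ) :
    ∑ u ∈ Finset.range M, letterWeight h u ≤ Real.log (5 / h) := by
  have h2 : 0 < h / 4 := by positivity
  obtain ⟨e0, e1⟩ := exp_neg_mem h2
  have h3 := Real.hasSum_pow_div_log_of_abs_lt_one (x := Real.exp (-(h / 4)))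
    (by rwa [abs_of_nonneg e0])
  have h4 : ∀ u : ℕ, letterWeight h (u + 1) = Real.exp (-(h / 4)) ^ (u + 1) / (u + 1) := by
    intro u
    rw [letterWeight, ← Real.exp_nat_mul]
    push_cast
    congr 2
    ring
  calc ∑ u ∈ Finset.range M, letterWeight h u
      ≤ ∑ u ∈ Finset.range (M + 1), letterWeight h u :=
        Finset.sum_le_sum_of_subset_of_nonneg (Finset.range_mono (Nat.le_succ M))
          fun u _ _ => by rw [letterWeight]; positivity
    _ = ∑ u ∈ Finset.range M, Real.exp (-(h / 4)) ^ (u + 1) / (u + 1) := by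
        rw [Finset.sum_range_succ', Finset.sum_congr rfl fun u _ => h4 u]
        simp [letterWeight]
    _ ≤ -Real.log (1 - Real.exp (-(h / 4))) :=
        sum_le_hasSum _ (fun u _ => by positivity) h3
    _ = Real.log (1 - Real.exp (-(h / 4)))⁻¹ := (Real.log_inv _).symm
    _ ≤ Real.log (5 / h) := by
        have h5 := div_one_sub_exp_le (h := h / 4) h2 one_ne_zero
        rw [Nat.cast_one, mul_one, div_one] at h5
        refine Real.log_le_log (inv_pos.2 (sub_pos.2 e1)) ?_
        rw [inv_eq_one_div, div_le_div_iff₀ (sub_pos.2 e1) hh]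
        rw [div_le_iff₀ (sub_pos.2 e1)] at h5
        have := sub_pos.2 e1
        nlinarith

/-! ### Conjugation of partitions -/

theorem pairing_replicate (s : ℚ) (p : List (ℚ × ℚ)) :
    pairing s p (List.replicate p.length (s, 0)) = 0 := by
  induction p with
  | nil => rfl
  | cons a p ih => simp [List.replicate_succ, pairing, ih]

theorem pairing_injective (p q : List (ℚ × ℚ)) (hpq : p.length = q.length)
    (h : ∀ s P, P.length = p.length → pairing s p P = pairing s q P) : p = q := by
  induction p generalizing q with
  | nil => exact (List.length_eq_zero_iff.1 hpq.symm).symm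
  | cons a p ih =>
    match q, hpq with
    | b :: q, hpq =>
      have hl : p.length = q.length := by simpa using hpq
      obtain ⟨u, v⟩ := a
      obtain ⟨u', v'⟩ := b
      have h0 : ∀ S, pairing S q (List.replicate p.length (S, 0)) = 0 := fun S => by
        rw [hl, pairing_replicate]
      -- These two test lists isolate `v` and `u` of the first point: constant partial sums and zero
      -- `X` make the later points invisible.
      have h1 := h 0 ((0, 1) :: List.replicate p.length (0, 0)) (by simp)
      have h2 := h 0 ((1, 0) :: List.replicate p.length (1, 0)) (by simp)
      simp only [pairing, pairing_replicate, h0] at h1 h2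
      norm_num at h1 h2
      rw [h1, h2, ih q hl fun s P hP => ?_]
      have h3 := h s ((s, 0) :: P) (by simp [hP])
      simpa [pairing] using h3

/-- Conjugation is adjoint to the involution `revSwap` under a pairing that determines its first
argument, hence it is an involution. -/
theorem conj_conj (p : List (ℚ × ℚ)) : conj (conj p) = p := by
  have h0 : ∀ P : List (ℚ × ℚ), P.length = p.length → pairing 0 (conj (conj p)) P = pairing 0 p P :=
    fun P hP => by
      rw [pairing_conj _ _ (by rw [length_conj, hP]),
        pairing_conj _ _ (by rw [length_revSwap, hP]), revSwap_revSwap]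
  refine pairing_injective _ _ (by rw [length_conj, length_conj]) fun s P hP => ?_
  rw [length_conj, length_conj] at hP
  have h1 : ∀ (q P : List (ℚ × ℚ)) (s : ℚ), pairing s q P =
      pairing 0 q (P.map fun a => (a.1 - s, a.2)) := by
    intro q P s
    have : ∀ (q P : List (ℚ × ℚ)) (t : ℚ), pairing t q P =
        pairing (t - s) q (P.map fun a => (a.1 - s, a.2)) := by
      intro q
      induction q with
      | nil => intro P t; simp [pairing]
      | cons a q ih =>
        intro P t
        match P with
        | [] => simp [pairing]
        | b :: P =>
          simp only [List.map_cons, pairing]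
          rw [ih P b.1, sub_sub_sub_cancel_right]
    rw [this q P s, sub_self]
  rw [h1, h1 p, h0 _ (by rw [List.length_map, hP])]

/-- Partitions with `r` different parts `u₁ > ⋯ > u_r` and multiplicities `v₁, …, v_r`. -/
def IsPart (p : List (ℕ × ℕ)) : Prop :=
  p.Pairwise (fun a b => b.1 < a.1) ∧ ∀ a ∈ p, 0 < a.1 ∧ 0 < a.2

/-- The largest part. -/
def hdPart : List (ℕ × ℕ) → ℕ
  | [] => 0
  | (u, _) :: _ => u

/-- Partial sums of the multiplicities, and differences of the parts. -/
def conjPartAux (c : ℕ) : List (ℕ × ℕ) → List (ℕ × ℕ)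
  | [] => []
  | (u, v) :: p => (c + v, u - hdPart p) :: conjPartAux (c + v) p

/-- The conjugate partition. -/
def conjPart (p : List (ℕ × ℕ)) : List (ℕ × ℕ) := (conjPartAux 0 p).reverse

/-- The points of a partition, scaled by `h`. -/
def scale (h : ℚ) (p : List (ℕ × ℕ)) : List (ℚ × ℚ) :=
  p.map fun a => (h * a.1, h * a.2)

theorem IsPart.tail {a : ℕ × ℕ} {p : List (ℕ × ℕ)} (h : IsPart (a :: p)) : IsPart p :=
  ⟨(List.pairwise_cons.1 h.1).2, fun b hb => h.2 b (List.mem_cons_of_mem _ hb)⟩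

theorem IsPart.hdPart_lt {a : ℕ × ℕ} {p : List (ℕ × ℕ)} (h : IsPart (a :: p)) :
    hdPart p < a.1 := by
  match p with
  | [] => exact (h.2 a List.mem_cons_self).1
  | b :: p => exact (List.pairwise_cons.1 h.1).1 b List.mem_cons_self

theorem hdU_scale (h : ℚ) (p : List (ℕ × ℕ)) : hdU (scale h p) = h * hdPart p := by
  match p with
  | [] => simp [scale, hdU, hdPart]
  | a :: p => rfl

theorem scale_conjPartAux (h : ℚ) (c : ℕ) (p : List (ℕ × ℕ)) (hp : IsPart p) :
    scale h (conjPartAux c p) = conjAux (h * c) (scale h p) := by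
  induction p generalizing c with
  | nil => rfl
  | cons a p ih =>
    obtain ⟨u, v⟩ := a
    have h1 := ih (c + v) hp.tail
    -- The parts decrease, so the subtraction of natural numbers agrees with the rational one.
    have h2 : (hdPart p : ℕ) ≤ u := hp.hdPart_lt.le
    rw [conjPartAux, scale, List.map_cons, ← scale, h1]
    change _ = (h * c + h * v, h * u - hdU (scale h p)) :: conjAux (h * c + h * v) (scale h p)
    rw [hdU_scale]
    push_cast [h2]
    rw [mul_add, mul_sub]

theorem scale_conjPart (h : ℚ) (p : List (ℕ × ℕ)) (hp : IsPart p) :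
    scale h (conjPart p) = conj (scale h p) := by
  rw [conjPart, conj, scale, List.map_reverse, ← scale, scale_conjPartAux h 0 p hp, Nat.cast_zero,
    mul_zero]

theorem isPart_conjPartAux (c : ℕ) (p : List (ℕ × ℕ)) (hp : IsPart p) :
    (conjPartAux c p).Pairwise (fun a b => a.1 < b.1) ∧
      ∀ a ∈ conjPartAux c p, c < a.1 ∧ 0 < a.2 := by
  induction p generalizing c with
  | nil => simp [conjPartAux]
  | cons a p ih =>
    obtain ⟨h1, h2⟩ := ih (c + a.2) hp.tail
    have h3 := hp.hdPart_lt
    have h4 := (hp.2 a List.mem_cons_self).2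
    obtain ⟨u, v⟩ := a
    simp only at h1 h2 h3 h4
    refine ⟨List.pairwise_cons.2 ⟨fun b hb => (h2 b hb).1, h1⟩, fun b hb => ?_⟩
    rcases List.mem_cons.1 hb with rfl | hb
    · exact ⟨by simp only; omega, by simp only; omega⟩
    · have := h2 b hb
      exact ⟨by omega, this.2⟩

theorem isPart_conjPart (p : List (ℕ × ℕ)) (hp : IsPart p) : IsPart (conjPart p) := by
  obtain ⟨h1, h2⟩ := isPart_conjPartAux 0 p hp
  exact ⟨List.pairwise_reverse.2 h1, fun a ha => h2 a (List.mem_reverse.1 ha)⟩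

theorem scale_one_injective : Function.Injective (scale 1) := by
  refine List.map_injective_iff.2 fun a b hab => ?_
  simp only [one_mul, Prod.mk.injEq, Nat.cast_inj] at hab
  exact Prod.ext hab.1 hab.2

theorem conjPart_conjPart (p : List (ℕ × ℕ)) (hp : IsPart p) : conjPart (conjPart p) = p := by
  refine scale_one_injective ?_
  rw [scale_conjPart _ _ (isPart_conjPart p hp), scale_conjPart _ _ hp, conj_conj]

/-- The size of a partition. -/
def partSize (p : List (ℕ × ℕ)) : ℕ := (p.map fun a => a.1 * a.2).sum

theorem dotSum_scale_one (p : List (ℕ × ℕ)) : dotSum (scale 1 p) = partSize p := by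
  induction p with
  | nil => simp [dotSum, scale, partSize]
  | cons a p ih =>
    have h1 : dotSum (scale 1 (a :: p)) = (1 * a.1) * (1 * a.2) + dotSum (scale 1 p) := List.sum_cons
    have h2 : partSize (a :: p) = a.1 * a.2 + partSize p := List.sum_cons
    rw [h1, h2, ih]
    push_cast
    ring

theorem partSize_conjPart (p : List (ℕ × ℕ)) (hp : IsPart p) :
    partSize (conjPart p) = partSize p := by
  have : (partSize (conjPart p) : ℚ) = partSize p := by
    rw [← dotSum_scale_one, scale_conjPart _ _ hp, dotSum_conj, dotSum_scale_one]
  exact_mod_cast this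

/-- Conjugation as a permutation of the partitions. -/
def conjPartEquiv : {p : List (ℕ × ℕ) // IsPart p} ≃ {p : List (ℕ × ℕ) // IsPart p} where
  toFun p := ⟨conjPart p.1, isPart_conjPart p.1 p.2⟩
  invFun p := ⟨conjPart p.1, isPart_conjPart p.1 p.2⟩
  left_inv p := Subtype.ext (conjPart_conjPart p.1 p.2)
  right_inv p := Subtype.ext (conjPart_conjPart p.1 p.2)

/-- The contribution of a partition. -/
noncomputable def partTerm (h : ℚ) (x : QA) (p : List (ℕ × ℕ)) : ℝ :=
  (h : ℝ) ^ p.length * (evalAt (scale h p) x : ℚ) * Real.exp (-(h * partSize p))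

theorem partTerm_add (h : ℚ) (x y : QA) (p : List (ℕ × ℕ)) :
    partTerm h (x + y) p = partTerm h x p + partTerm h y p := by
  simp only [partTerm, map_add]
  push_cast
  ring

theorem partTerm_smul (h c : ℚ) (x : QA) (p : List (ℕ × ℕ)) :
    partTerm h (c • x) p = c * partTerm h x p := by
  simp only [partTerm, map_smul, smul_eq_mul]
  push_cast
  ring

/-- The evaluation is moved to the conjugate partition, while the size and the number of distinct
parts do not change. -/
theorem partTerm_swap (h : ℚ) (x : QA) (p : List (ℕ × ℕ)) (hp : IsPart p) :
    partTerm h (swap x) p = partTerm h x (conjPart p) := by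
  have hl : (conjPart p).length = p.length := by
    have := congrArg List.length (scale_conjPart 1 p hp)
    rwa [length_conj, scale, scale, List.length_map, List.length_map] at this
  rw [partTerm, partTerm, evalAt_swap, scale_conjPart _ _ hp, partSize_conjPart _ hp, hl]

/-! ### The sum over all partitions -/

open ENNReal in
theorem tsum_list_eq {α : Type*} (F : List α → ℝ≥0∞) (h : F [] = 0) :
    ∑' p, F p = ∑' (a : α) (p : List α), F (a :: p) := by
  rw [← ENNReal.tsum_prod (f := fun a p => F (a :: p))]
  refine (Function.Injective.tsum_eq (g := fun x : α × List α => x.1 :: x.2) ?_ ?_).symm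
  · rintro ⟨a, p⟩ ⟨b, q⟩ h
    simpa using h
  · intro p hp
    match p with
    | [] => exact absurd h hp
    | a :: p => exact ⟨(a, p), rfl⟩

/-- The contribution of one part. -/
noncomputable def partFactor (h : ℚ) (a : Letter) (u v : ℕ) : ℝ :=
  h * ((h * u) ^ a.2 * (h * v) ^ a.1.natPred / (a.1.natPred.factorial : ℝ)) *
    Real.exp (-(h * (u * v)))

theorem partFactor_nonneg {h : ℚ} (hh : 0 < h) (a : Letter) (u v : ℕ) : 0 ≤ partFactor h a u v := by
  have : (0 : ℝ) < h := Rat.cast_pos.2 hh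
  rw [partFactor]
  positivity

theorem partTerm_cons (h : ℚ) (a : Letter) (w : Word) (b : ℕ × ℕ) (p : List (ℕ × ℕ)) :
    partTerm h (word (a :: w)) (b :: p) = partFactor h a b.1 b.2 * partTerm h (word w) p := by
  have h1 : scale h (b :: p) = (h * b.1, h * b.2) :: scale h p := rfl
  have h2 : partSize (b :: p) = b.1 * b.2 + partSize p := List.sum_cons
  rw [partTerm, partTerm, partFactor, h1, h2, word_cons_eq_catL, evalAt_catL, List.length_cons]
  push_cast
  rw [mul_add, neg_add, Real.exp_add]
  ring

theorem evalAt_scale_nonneg {h : ℚ} (hh : 0 < h) (p : List (ℕ × ℕ)) (w : Word) :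
    0 ≤ evalAt (scale h p) (word w) := by
  induction w generalizing p with
  | nil =>
    match p with
    | [] => rw [word_nil]; simp [scale, evalAt_nil_one]
    | a :: p => exact (evalAt_of_length_ne _ _ (by simp [scale])).ge
  | cons a w ih =>
    match p with
    | [] => exact (evalAt_of_length_ne _ _ (by simp [scale])).ge
    | b :: p =>
      have h1 : scale h (b :: p) = (h * b.1, h * b.2) :: scale h p := rfl
      rw [h1, word_cons_eq_catL, evalAt_catL]
      have := ih p
      positivity

theorem partTerm_nonneg {h : ℚ} (hh : 0 < h) (p : List (ℕ × ℕ)) (w : Word) :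
    0 ≤ partTerm h (word w) p := by
  have h1 : (0 : ℝ) < h := Rat.cast_pos.2 hh
  have h2 : (0 : ℝ) ≤ (evalAt (scale h p) (word w) : ℚ) :=
    Rat.cast_nonneg.2 (evalAt_scale_nonneg hh p w)
  rw [partTerm]
  positivity

theorem partTerm_word_nil_cons (h : ℚ) (b : ℕ × ℕ) (p : List (ℕ × ℕ)) :
    partTerm h (word []) (b :: p) = 0 := by
  rw [partTerm, evalAt_of_length_ne _ _ (by simp [scale])]
  simp

theorem partTerm_cons_nil (h : ℚ) (a : Letter) (w : Word) : partTerm h (word (a :: w)) [] = 0 := by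
  rw [partTerm, evalAt_of_length_ne _ _ (by simp [scale])]
  simp

theorem tsum_partFactor {h : ℚ} (hh : 0 < h) (a : Letter) (u : ℕ) (hu : 0 < u) :
    ∑' v, (if 0 < v then ENNReal.ofReal (partFactor h a u v) else 0) =
      ENNReal.ofReal (phiLetter h a u) := by
  have hh' : (0 : ℝ) < h := Rat.cast_pos.2 hh
  have hx : (0 : ℝ) < h * u := mul_pos hh' (Nat.cast_pos.2 hu)
  obtain ⟨h0, h1⟩ := exp_neg_mem hx
  have hs := summable_powSeries h0 h1 a.1.natPred
  have h2 : ∀ m : ℕ, partFactor h a u (m + 1) = ((h * u) ^ a.2 * (h : ℝ) ^ (a.1 : ℕ)) *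
      (((m : ℝ) + 1) ^ a.1.natPred / (a.1.natPred.factorial : ℝ) *
        Real.exp (-(h * u)) ^ (m + 1)) := by
    intro m
    have e1 : (h : ℝ) ^ (a.1 : ℕ) = h ^ a.1.natPred * h := by
      rw [← pow_succ, PNat.natPred_add_one]
    rw [partFactor, ← Real.exp_nat_mul, e1]
    push_cast
    rw [mul_pow (h : ℝ) (m + 1 : ℝ), show -((h : ℝ) * (u * (m + 1))) = (m + 1) * -(h * u) by ring]
    ring
  rw [tsum_eq_zero_add' ENNReal.summable]
  simp only [lt_irrefl, if_false, zero_add, Nat.succ_pos, if_true, h2]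
  rw [← ENNReal.ofReal_tsum_of_nonneg (fun m => by positivity) (hs.mul_left _), tsum_mul_left,
    phiLetter, if_neg hu.ne', powSeries, mul_assoc]

open Classical in
/-- The sum over the partitions whose parts satisfy `Q`. -/
noncomputable def partSum (h : ℚ) (Q : ℕ → Prop) (w : Word) : ENNReal :=
  ∑' p : List (ℕ × ℕ), if IsPart p ∧ ∀ a ∈ p, Q a.1 then
    ENNReal.ofReal (partTerm h (word w) p) else 0

theorem isPart_cons_iff (Q : ℕ → Prop) (hQ : ∀ m n, m < n → Q n → Q m) (u v : ℕ)
    (p : List (ℕ × ℕ)) : (IsPart ((u, v) :: p) ∧ ∀ a ∈ (u, v) :: p, Q a.1) ↔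
      (Q u ∧ 0 < u ∧ 0 < v) ∧ (IsPart p ∧ ∀ a ∈ p, a.1 < u) := by
  simp only [IsPart, List.pairwise_cons, List.mem_cons, forall_eq_or_imp]
  constructor
  · rintro ⟨⟨⟨h1, h2⟩, h3, h4⟩, h5, h6⟩
    exact ⟨⟨h5, h3⟩, ⟨h2, h4⟩, h1⟩
  · rintro ⟨⟨h5, h3⟩, ⟨h2, h4⟩, h1⟩
    exact ⟨⟨⟨h1, h2⟩, h3, h4⟩, h5, fun a ha => hQ _ _ (h1 a ha) h5⟩

-- Partitions are sorted by their largest part `u` and its multiplicity `v`; the rest is a partition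
-- with parts below `u`, and the sum over `v` is the letter function. Extended nonnegative reals
-- allow the rearrangement before convergence is known.
open Classical in
theorem partSum_cons {h : ℚ} (hh : 0 < h) (Q : ℕ → Prop) (hQ : ∀ m n, m < n → Q n → Q m)
    (a : Letter) (w : Word) : partSum h Q (a :: w) =
      ∑' u, if Q u then ENNReal.ofReal (phiLetter h a u) * partSum h (· < u) w else 0 := by
  rw [partSum, tsum_list_eq _ (by simp [partTerm_cons_nil]),
    ENNReal.tsum_prod (f := fun u v => ∑' p : List (ℕ × ℕ),
      if IsPart ((u, v) :: p) ∧ ∀ b ∈ (u, v) :: p, Q b.1 then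
        ENNReal.ofReal (partTerm h (word (a :: w)) ((u, v) :: p)) else 0)]
  refine tsum_congr fun u => ?_
  have h1 : ∀ v, (∑' p : List (ℕ × ℕ), if IsPart ((u, v) :: p) ∧ ∀ b ∈ (u, v) :: p, Q b.1 then
        ENNReal.ofReal (partTerm h (word (a :: w)) ((u, v) :: p)) else 0) =
      (if Q u ∧ 0 < u then (if 0 < v then ENNReal.ofReal (partFactor h a u v) else 0) else 0) *
        partSum h (· < u) w := by
    intro v
    rw [partSum, ← ENNReal.tsum_mul_left]
    refine tsum_congr fun p => ?_
    rw [if_congr (isPart_cons_iff Q hQ u v p) rfl rfl, partTerm_cons,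
      ENNReal.ofReal_mul (partFactor_nonneg hh a u v)]
    by_cases h1 : Q u <;> by_cases h2 : 0 < u <;> by_cases h3 : 0 < v <;> simp [h1, h2, h3]
  simp only [h1]
  rw [ENNReal.tsum_mul_right]
  by_cases hq : Q u
  · rcases Nat.eq_zero_or_pos u with rfl | hu
    · simp [phiLetter]
    · simp only [hq, hu, and_self, if_true]
      rw [tsum_partFactor hh a u hu]
  · simp [hq]

theorem phiLetter_nonneg {h : ℝ} (hh : 0 < h) (a : Letter) (u : ℕ) : 0 ≤ phiLetter h a u :=
  (chiLetter_nonneg hh a u).trans (chiLetter_le_phiLetter hh a u)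

theorem partSum_nil (h : ℚ) (Q : ℕ → Prop) : partSum h Q [] = 1 := by
  rw [partSum, tsum_eq_single []]
  · rw [if_pos ⟨⟨List.Pairwise.nil, by simp⟩, by simp⟩, partTerm, word_nil]
    simp [scale, evalAt_nil_one, partSize]
  · intro p hp
    match p with
    | b :: p => rw [partTerm_word_nil_cons]; simp

theorem partSum_lt {h : ℚ} (hh : 0 < h) (w : Word) (M : ℕ) :
    partSum h (· < M) w = ENNReal.ofReal (nested (phiLetter h) w M) := by
  have hh' : (0 : ℝ) < h := Rat.cast_pos.2 hh
  induction w generalizing M with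
  | nil => rw [partSum_nil, nested, ENNReal.ofReal_one]
  | cons a w ih =>
    rw [partSum_cons hh _ fun m n h1 h2 => h1.trans h2, nested,
      ENNReal.ofReal_sum_of_nonneg fun u _ => mul_nonneg (phiLetter_nonneg hh' a u)
        (nested_nonneg (phiLetter_nonneg hh') w u), tsum_eq_sum (s := Finset.range M)]
    · refine Finset.sum_congr rfl fun u hu => ?_
      rw [if_pos (Finset.mem_range.1 hu), ih, ENNReal.ofReal_mul (phiLetter_nonneg hh' a u)]
    · exact fun u hu => if_neg fun h' => hu (Finset.mem_range.2 h')

theorem partSum_true {h : ℚ} (hh : 0 < h)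
    (hb : ∀ w, BddAbove (Set.range (nested (phiLetter h) w))) (w : Word) :
    partSum h (fun _ => True) w = ENNReal.ofReal (nestedLim (phiLetter h) (word w)) := by
  have hh' : (0 : ℝ) < h := Rat.cast_pos.2 hh
  match w with
  | [] =>
    rw [partSum_nil, nestedLim, ofWords_word]
    simp [nested]
  | a :: w =>
    have h0 : ∀ u, 0 ≤ phiLetter h a u * nested (phiLetter h) w u := fun u =>
      mul_nonneg (phiLetter_nonneg hh' a u) (nested_nonneg (phiLetter_nonneg hh') w u)
    have h1 : Summable fun u => phiLetter h a u * nested (phiLetter h) w u := by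
      obtain ⟨C, hC⟩ := hb (a :: w)
      exact summable_of_sum_range_le h0 fun M => hC ⟨M, rfl⟩
    have h2 : nestedLim (phiLetter h) (word (a :: w)) =
        ∑' u, phiLetter h a u * nested (phiLetter h) w u := by
      refine tendsto_nhds_unique (tendsto_nested (phiLetter_nonneg hh') hb _) ?_
      simp only [nestedQA, ofWords_word]
      exact h1.hasSum.tendsto_sum_nat
    rw [partSum_cons hh _ fun _ _ _ h => h, h2, ENNReal.ofReal_tsum_of_nonneg h0 h1]
    refine tsum_congr fun u => ?_
    rw [if_pos trivial, partSum_lt hh, ENNReal.ofReal_mul (phiLetter_nonneg hh' a u)]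

/-- For words all terms are nonnegative, and the boundedness hypothesis makes the total finite;
general elements follow by linearity, where absolute convergence is no longer automatic from signs.
-/
theorem hasSum_partTerm {h : ℚ} (hh : 0 < h)
    (hb : ∀ w, BddAbove (Set.range (nested (phiLetter h) w))) (x : QA) :
    HasSum (fun p : {p : List (ℕ × ℕ) // IsPart p} => partTerm h x p.1)
      (nestedLim (phiLetter h) x) := by
  have hh' : (0 : ℝ) < h := Rat.cast_pos.2 hh
  induction x using QA.induction_word with
  | hw w =>
    have h1 := partSum_true hh hb w
    rw [partSum] at h1
    have h2 := ENNReal.hasSum_toReal (h1.trans_ne ENNReal.ofReal_ne_top)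
    have h4 : 0 ≤ nestedLim (phiLetter h) (word w) := by
      rw [nestedLim, ofWords_word]
      exact Real.iSup_nonneg fun M => nested_nonneg (phiLetter_nonneg hh') w M
    rw [← ENNReal.tsum_toReal_eq (fun p => by split_ifs <;> simp), h1, ENNReal.toReal_ofReal h4] at h2
    refine (hasSum_subtype_iff_indicator (s := {p | IsPart p})
      (f := partTerm h (word w))).2 ?_
    convert h2 using 1
    funext p
    by_cases hp : IsPart p
    · rw [Set.indicator_of_mem (show p ∈ {p | IsPart p} from hp), if_pos ⟨hp, by simp⟩,
        ENNReal.toReal_ofReal (partTerm_nonneg hh p w)]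
    · rw [Set.indicator_of_notMem (show p ∉ {p | IsPart p} from hp), if_neg fun h' => hp h'.1,
        ENNReal.toReal_zero]
  | h0 => simp [partTerm]
  | hadd x y hx hy => simpa only [map_add, partTerm_add] using hx.add hy
  | hsmul c x hx =>
    have h1 : nestedLim (phiLetter h) (c • x) = c * nestedLim (phiLetter h) x := by
      rw [map_smul, Rat.smul_def]
    simpa only [h1, partTerm_smul] using hx.mul_left (c : ℝ)

/-- Conjugation permutes the partitions, and carries the contributions to `x` into those to `swap
x`. -/
theorem nestedLim_swap {h : ℚ} (hh : 0 < h)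
    (hb : ∀ w, BddAbove (Set.range (nested (phiLetter h) w))) (x : QA) :
    nestedLim (phiLetter h) (swap x) = nestedLim (phiLetter h) x := by
  refine (hasSum_partTerm hh hb (swap x)).unique ?_
  have h1 := (conjPartEquiv.hasSum_iff).2 (hasSum_partTerm hh hb x)
  convert h1 using 1
  funext p
  exact partTerm_swap h x p.1 p.2

/-! ### Degeneration of the realizations -/

/-- The logarithmic scale. -/
noncomputable def logScale (n : ℕ) : ℝ := Real.log (5 * n)

theorem one_le_logScale {n : ℕ} (hn : 0 < n) : 1 ≤ logScale n := by
  have h1 : (1 : ℝ) ≤ n := Nat.one_le_cast.2 hn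
  rw [logScale, Real.le_log_iff_exp_le (by positivity)]
  have := Real.exp_one_lt_d9
  linarith

/-- The scale `1 / n`. -/
noncomputable def invScale (n : ℕ) : ℚ := 1 / n

theorem invScale_pos {n : ℕ} (hn : 0 < n) : 0 < invScale n :=
  one_div_pos.2 (Nat.cast_pos.2 hn)

theorem invScale_cast_pos {n : ℕ} (hn : 0 < n) : (0 : ℝ) < invScale n :=
  Rat.cast_pos.2 (invScale_pos hn)

theorem invScale_le_one {n : ℕ} (hn : 0 < n) : (invScale n : ℝ) ≤ 1 := by
  rw [invScale]
  push_cast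
  rw [div_le_one (Nat.cast_pos.2 hn)]
  exact Nat.one_le_cast.2 hn

theorem sum_letterWeight_le_logScale {n : ℕ} (hn : 0 < n) (M : ℕ) :
    ∑ u ∈ Finset.range M, letterWeight (invScale n) u ≤ logScale n := by
  refine (sum_letterWeight_le (invScale_cast_pos hn) (invScale_le_one hn) M).trans (le_of_eq ?_)
  rw [logScale, invScale]
  push_cast
  rw [div_div_eq_mul_div, div_one]

/-- The multiplicative realization. -/
noncomputable def chi (n : ℕ) : QA →ₗ[ℚ] ℝ := nestedLim (chiLetter (invScale n))

/-- The swap-invariant realization. -/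
noncomputable def phi (n : ℕ) : QA →ₗ[ℚ] ℝ := nestedLim (phiLetter (invScale n))

/-- The constant in the bound for a word. -/
noncomputable def wordConst (w : Word) : ℝ := (w.map letterConst).prod

theorem wordConst_nonneg (w : Word) : 0 ≤ wordConst w :=
  List.prod_nonneg fun c hc => by
    obtain ⟨b, -, rfl⟩ := List.mem_map.1 hc
    exact letterConst_nonneg b

theorem nested_phi_le {n : ℕ} (hn : 0 < n) (w : Word) (M : ℕ) :
    nested (phiLetter (invScale n)) w M ≤ wordConst w * logScale n ^ w.length :=
  nested_le (phiLetter_nonneg (invScale_cast_pos hn)) (sum_letterWeight_le_logScale hn)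
    letterConst_nonneg (zero_le_one.trans (one_le_logScale hn))
    (phiLetter_le (invScale_cast_pos hn)) w M

theorem bddAbove_phi {n : ℕ} (hn : 0 < n) (w : Word) :
    BddAbove (Set.range (nested (phiLetter (invScale n)) w)) :=
  ⟨_, by rintro _ ⟨M, rfl⟩; exact nested_phi_le hn w M⟩

theorem nested_chi_le_phi {n : ℕ} (hn : 0 < n) (w : Word) (M : ℕ) :
    nested (chiLetter (invScale n)) w M ≤ nested (phiLetter (invScale n)) w M :=
  nested_mono_fun (chiLetter_nonneg (invScale_cast_pos hn))
    (chiLetter_le_phiLetter (invScale_cast_pos hn)) w M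

theorem bddAbove_chi {n : ℕ} (hn : 0 < n) (w : Word) :
    BddAbove (Set.range (nested (chiLetter (invScale n)) w)) :=
  ⟨_, by rintro _ ⟨M, rfl⟩; exact (nested_chi_le_phi hn w M).trans (nested_phi_le hn w M)⟩

theorem chi_mul {n : ℕ} (hn : 0 < n) (x y : QA) : chi n (x * y) = chi n x * chi n y :=
  nestedLim_mul (chiLetter_nonneg (invScale_cast_pos hn)) (bddAbove_chi hn) (chiLetter_add _) x y

theorem tendsto_chi {n : ℕ} (hn : 0 < n) (w : Word) :
    Filter.Tendsto (nested (chiLetter (invScale n)) w) Filter.atTop (nhds (chi n (word w))) := by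
  have := tendsto_nested (chiLetter_nonneg (invScale_cast_pos hn)) (bddAbove_chi hn) (word w)
  simp only [nestedQA, ofWords_word] at this
  exact this

theorem tendsto_phi {n : ℕ} (hn : 0 < n) (w : Word) :
    Filter.Tendsto (nested (phiLetter (invScale n)) w) Filter.atTop (nhds (phi n (word w))) := by
  have := tendsto_nested (phiLetter_nonneg (invScale_cast_pos hn)) (bddAbove_phi hn) (word w)
  simp only [nestedQA, ofWords_word] at this
  exact this

theorem chi_word_nonneg {n : ℕ} (hn : 0 < n) (w : Word) : 0 ≤ chi n (word w) :=
  ge_of_tendsto' (tendsto_chi hn w) fun M =>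
    nested_nonneg (chiLetter_nonneg (invScale_cast_pos hn)) w M

/-- Functions of logarithmic growth. -/
def IsModerate (g : ℕ → ℝ) : Prop :=
  ∃ C m, 0 ≤ C ∧ ∀ n, 0 < n → |g n| ≤ C * logScale n ^ (m : ℕ)

/-- Functions that tend to zero almost as fast as `1 / n`. -/
def IsNegligible (g : ℕ → ℝ) : Prop :=
  ∃ C m, 0 ≤ C ∧ ∀ n, 0 < n → |g n| ≤ invScale n * (C * logScale n ^ (m : ℕ))

theorem add_logScale_le {n : ℕ} (hn : 0 < n) {C C' : ℝ} (hC : 0 ≤ C) (hC' : 0 ≤ C') (m m' : ℕ) :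
    C * logScale n ^ m + C' * logScale n ^ m' ≤ (C + C') * logScale n ^ (m + m') := by
  have hL := one_le_logScale hn
  rw [add_mul]
  gcongr
  · omega
  · omega

theorem IsModerate.add {f g : ℕ → ℝ} (hf : IsModerate f) (hg : IsModerate g) :
    IsModerate fun n => f n + g n := by
  obtain ⟨C, m, hC, hf⟩ := hf
  obtain ⟨C', m', hC', hg⟩ := hg
  exact ⟨C + C', m + m', add_nonneg hC hC', fun n hn => (abs_add_le _ _).trans
    ((add_le_add (hf n hn) (hg n hn)).trans (add_logScale_le hn hC hC' m m'))⟩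

theorem IsNegligible.add {f g : ℕ → ℝ} (hf : IsNegligible f) (hg : IsNegligible g) :
    IsNegligible fun n => f n + g n := by
  obtain ⟨C, m, hC, hf⟩ := hf
  obtain ⟨C', m', hC', hg⟩ := hg
  refine ⟨C + C', m + m', add_nonneg hC hC', fun n hn => (abs_add_le _ _).trans
    ((add_le_add (hf n hn) (hg n hn)).trans ?_)⟩
  rw [← mul_add]
  exact mul_le_mul_of_nonneg_left (add_logScale_le hn hC hC' m m') (invScale_cast_pos hn).le

theorem IsModerate.const_mul {f : ℕ → ℝ} (hf : IsModerate f) (c : ℝ) :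
    IsModerate fun n => c * f n := by
  obtain ⟨C, m, hC, hf⟩ := hf
  refine ⟨|c| * C, m, by positivity, fun n hn => ?_⟩
  rw [abs_mul, mul_assoc]
  exact mul_le_mul_of_nonneg_left (hf n hn) (abs_nonneg c)

theorem IsNegligible.const_mul {f : ℕ → ℝ} (hf : IsNegligible f) (c : ℝ) :
    IsNegligible fun n => c * f n := by
  obtain ⟨C, m, hC, hf⟩ := hf
  refine ⟨|c| * C, m, by positivity, fun n hn => ?_⟩
  rw [abs_mul, mul_assoc, mul_left_comm]
  exact mul_le_mul_of_nonneg_left (hf n hn) (abs_nonneg c)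

theorem IsNegligible.moderate_mul {f g : ℕ → ℝ} (hf : IsModerate f) (hg : IsNegligible g) :
    IsNegligible fun n => f n * g n := by
  obtain ⟨C, m, hC, hf⟩ := hf
  obtain ⟨C', m', hC', hg⟩ := hg
  refine ⟨C * C', m + m', by positivity, fun n hn => ?_⟩
  have hL := zero_le_one.trans (one_le_logScale hn)
  rw [abs_mul]
  refine (mul_le_mul (hf n hn) (hg n hn) (abs_nonneg _) (by positivity)).trans (le_of_eq ?_)
  rw [pow_add]
  ring

theorem IsNegligible.congr {f g : ℕ → ℝ} (hf : IsNegligible f) (h : ∀ n, 0 < n → f n = g n) :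
    IsNegligible g := by
  obtain ⟨C, m, hC, hf⟩ := hf
  exact ⟨C, m, hC, fun n hn => by rw [← h n hn]; exact hf n hn⟩

theorem isNegligible_zero : IsNegligible fun _ => 0 :=
  ⟨0, 0, le_rfl, fun n _ => by simp⟩

theorem isModerate_chi (x : QA) : IsModerate fun n => chi n x := by
  induction x using QA.induction_word with
  | hw w =>
    refine ⟨wordConst w, w.length, wordConst_nonneg w, fun n hn => ?_⟩
    rw [abs_of_nonneg (chi_word_nonneg hn w)]
    exact le_of_tendsto' (tendsto_chi hn w) fun M =>
      (nested_chi_le_phi hn w M).trans (nested_phi_le hn w M)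
  | h0 => exact ⟨0, 0, le_rfl, fun n _ => by simp⟩
  | hadd x y hx hy => simpa only [map_add] using hx.add hy
  | hsmul c x hx => simpa only [map_smul, Rat.smul_def] using hx.const_mul (c : ℝ)

theorem isNegligible_phi_sub_chi (x : QA) : IsNegligible fun n => phi n x - chi n x := by
  induction x using QA.induction_word with
  | hw w =>
    refine ⟨w.length * wordConst w, w.length, mul_nonneg (Nat.cast_nonneg _) (wordConst_nonneg w),
      fun n hn => ?_⟩
    have hh := invScale_cast_pos hn
    have ht := (tendsto_phi hn w).sub (tendsto_chi hn w)
    rw [abs_of_nonneg (ge_of_tendsto' ht fun M => sub_nonneg.2 (nested_chi_le_phi hn w M))]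
    refine le_of_tendsto' ht fun M => (nested_sub_le (chiLetter_nonneg hh)
      (chiLetter_le_phiLetter hh) (sum_letterWeight_le_logScale hn) letterConst_nonneg
      (zero_le_one.trans (one_le_logScale hn)) hh.le (phiLetter_le hh) (phiLetter_sub_le hh)
      w M).trans (le_of_eq ?_)
    rw [wordConst]
    ring
  | h0 => simpa using isNegligible_zero
  | hadd x y hx hy =>
    refine (hx.add hy).congr fun n _ => ?_
    rw [map_add, map_add]
    ring
  | hsmul c x hx =>
    refine (hx.const_mul (c : ℝ)).congr fun n _ => ?_
    rw [map_smul, map_smul, Rat.smul_def, Rat.smul_def]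
    ring

/-- The ideal of the elements with negligible realization. -/
noncomputable def negligibleIdeal : Ideal QA where
  carrier := {x | IsNegligible fun n => chi n x}
  add_mem' := fun {x y} hx hy => by
    simpa only [Set.mem_ofPred_eq, map_add] using IsNegligible.add hx hy
  zero_mem' := by simpa using isNegligible_zero
  smul_mem' := fun a x hx =>
    (IsNegligible.moderate_mul (isModerate_chi a) hx).congr fun n hn => (chi_mul hn a x).symm

/-- Since `phi` is swap invariant, `chi (swap x) - chi x` equals the difference of `phi - chi` at
`x` and at `swap x`, and both are negligible. -/
theorem swap_sub_mem_negligibleIdeal (x : QA) : swap x - x ∈ negligibleIdeal := by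
  refine IsNegligible.congr ((isNegligible_phi_sub_chi x).add
    ((isNegligible_phi_sub_chi (swap x)).const_mul (-1))) fun n hn => ?_
  have h1 : phi n (swap x) = phi n x := nestedLim_swap (invScale_pos hn) (bddAbove_phi hn) x
  rw [h1, map_sub]
  ring

theorem word_mem_negligibleIdeal (w : Word) (hw : ¬ IsSplitWord w) : word w ∈ negligibleIdeal := by
  refine ⟨wordConst w, w.length, wordConst_nonneg w, fun n hn => ?_⟩
  have hh := invScale_cast_pos hn
  have hle : ∀ a u, chiLetter (invScale n) a u ≤ phiLetter (invScale n) a u :=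
    chiLetter_le_phiLetter hh
  rw [abs_of_nonneg (chi_word_nonneg hn w)]
  refine le_of_tendsto' (tendsto_chi hn w) fun M => nested_le_of_not_isSplitWord
    (chiLetter_nonneg hh) (sum_letterWeight_le_logScale hn) letterConst_nonneg
    (zero_le_one.trans (one_le_logScale hn)) hh.le (fun a u => (hle a u).trans (phiLetter_le hh a u))
    (fun a u ha => (hle a u).trans (phiLetter_le_of_pos hh a u ha))
    (fun a u ha => (mul_le_mul_of_nonneg_left (hle a u) (Nat.cast_nonneg u)).trans
      (mul_phiLetter_le hh a u ha))
    (fun a u ha ha' => (hle a u).trans (phiLetter_le_mul hh a u ha ha')) w hw M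

/-- The generators of `swapIdeal` and lifts of the generators of `idealN` are negligible, and
negligible elements form an ideal because `chi` is multiplicative of logarithmic growth. The
induction quantifies over all lifts, since membership upstairs must not depend on the chosen one. -/
theorem mem_negligibleIdeal_of_cls_mem {x : QA} (hx : cls x ∈ idealN) : x ∈ negligibleIdeal := by
  have h1 : swapIdeal ≤ negligibleIdeal := Ideal.span_le.2 (by
    rintro _ ⟨x, rfl⟩
    exact swap_sub_mem_negligibleIdeal x)
  have h2 : ∀ y ∈ idealN, ∀ x, cls x = y → x ∈ negligibleIdeal := by
    intro y hy
    induction hy using Submodule.span_induction with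
    | mem y hy =>
      obtain ⟨w, hw, rfl⟩ := hy
      intro x hx
      have : x - word w ∈ negligibleIdeal := h1 (cls_eq_zero_iff.1 (by
        rw [map_sub, hx, G, sub_self]))
      simpa using add_mem this (word_mem_negligibleIdeal w hw)
    | zero => exact fun x hx => h1 (cls_eq_zero_iff.1 hx)
    | add y z _ _ hy hz =>
      intro x hx
      obtain ⟨y', rfl⟩ := cls_surjective y
      have := hz (x - y') (by rw [map_sub, hx, add_sub_cancel_left])
      simpa using add_mem (hy y' rfl) this
    | smul a y _ hy =>
      intro x hx
      obtain ⟨y', rfl⟩ := cls_surjective y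
      obtain ⟨a', rfl⟩ := cls_surjective a
      have : x - a' * y' ∈ negligibleIdeal := h1 (cls_eq_zero_iff.1 (by
        rw [map_sub, hx, map_mul, smul_eq_mul, sub_self]))
      simpa using add_mem this (Ideal.mul_mem_left _ a' (hy y' rfl))
  exact h2 _ hx x rfl

/-- The summand `u = 1` suffices: `1 - exp(-h) ≤ h` gives `h exp(-h) / (1 - exp(-h)) ≥ exp(-h) ≥
exp(-1)`. -/
theorem le_chi_two {n : ℕ} (hn : 0 < n) : Real.exp (-1) ^ 2 ≤ chi n (word [(2, 0)]) := by
  have hh := invScale_cast_pos hn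
  have h1 := invScale_le_one hn
  set h : ℝ := ((invScale n : ℚ) : ℝ)
  have hmono := nested_mono (chiLetter_nonneg hh) [(2, 0)]
  refine le_trans ?_ (hmono.ge_of_tendsto (tendsto_chi hn _) 2)
  have h2 : nested (chiLetter h) [(2, 0)] 2 = (h * (Real.exp (-h) / (1 - Real.exp (-h)))) ^ 2 := by
    simp [nested, Finset.sum_range_succ, chiLetter]
  obtain ⟨e0, e1⟩ := exp_neg_mem hh
  have e2 := sub_pos.2 e1
  have e3 : 1 - Real.exp (-h) ≤ h := by linarith [Real.add_one_le_exp (-h)]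
  change _ ≤ nested (chiLetter h) [(2, 0)] 2
  rw [h2]
  refine pow_le_pow_left₀ (Real.exp_pos _).le ?_ 2
  calc Real.exp (-1) ≤ Real.exp (-h) := Real.exp_le_exp.2 (by linarith)
    _ ≤ _ := by
      rw [mul_div_assoc', le_div_iff₀ e2, mul_comm]
      exact mul_le_mul_of_nonneg_right e3 e0

theorem tendsto_invScale_mul_logScale (C : ℝ) (m : ℕ) :
    Filter.Tendsto (fun n => (invScale n : ℝ) * (C * logScale n ^ m)) Filter.atTop (nhds 0) := by
  have h1 := (Real.isLittleO_pow_log_id_atTop (n := m)).tendsto_div_nhds_zero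
  have h2 : Filter.Tendsto (fun n : ℕ => 5 * (n : ℝ)) Filter.atTop Filter.atTop :=
    tendsto_natCast_atTop_atTop.const_mul_atTop (by norm_num)
  have h3 := (h1.comp h2).const_mul (5 * C)
  rw [mul_zero] at h3
  refine h3.congr fun n => ?_
  simp only [Function.comp_apply, id, invScale, logScale]
  push_cast
  rcases Nat.eq_zero_or_pos n with rfl | hn
  · simp
  · have : (n : ℝ) ≠ 0 := Nat.cast_ne_zero.2 hn.ne'
    field_simp

theorem chi_pow {n : ℕ} (hn : 0 < n) (x : QA) (N : ℕ) : chi n (x ^ N) = chi n x ^ N := by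
  induction N with
  | zero =>
    rw [pow_zero, pow_zero, ← word_nil, chi, nestedLim, ofWords_word]
    simp [nested]
  | succ N ih => rw [pow_succ, pow_succ, chi_mul hn, ih]

/-- If the power vanished, `chi` of the `N`-th stuffle power of `(2,0)` would tend to zero, although
multiplicativity bounds it below by `exp(-2N)`. -/
theorem proj_two_pow_ne_zero (N : ℕ) : proj (evenEis 0) ^ N ≠ 0 := by
  intro h0
  have h1 : evenEis 0 = cls (word [(2, 0)]) := (eisG_eq_gEis 2).symm
  rw [h1, ← map_pow, ← map_pow] at h0
  have h2 : cls (word [(2, 0)] ^ N) ∈ idealN := Ideal.Quotient.eq_zero_iff_mem.1 h0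
  obtain ⟨C, m, -, h3⟩ := mem_negligibleIdeal_of_cls_mem h2
  have h4 : (Real.exp (-1) ^ 2) ^ N ≤ 0 := by
    refine ge_of_tendsto (tendsto_invScale_mul_logScale C m) ?_
    filter_upwards [Filter.eventually_gt_atTop 0] with n hn
    refine le_trans ?_ ((le_abs_self _).trans (h3 n hn))
    change _ ≤ chi n (word [(2, 0)] ^ N)
    rw [chi_pow hn]
    exact pow_le_pow_left₀ (by positivity) (le_chi_two hn) N
  exact absurd h4 (not_le.2 (by positivity))

/-! ### The derivations and `π` on formal Eisenstein series and quasimodular forms -/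

theorem gEis_eq_G (n : ℕ) : gEis n = G [(n.succPNat, 0)] := by
  have := eisG_eq_gEis n.succPNat
  rw [Nat.natPred_succPNat] at this
  exact this.symm

section Derivations

variable {D W δ : Derivation ℚ FMES FMES}

theorem delta_gEis (hδ : IsInducedBy δ wordDelta) (n : ℕ) :
    δ (gEis n) = if n = 1 then (-(1 / 2) : ℚ) • 1 else 0 := by
  rw [gEis_eq_G, hδ]
  have h2 : n.succPNat = 2 ↔ n = 1 := by
    rw [← PNat.coe_inj]
    simp
  have h : wordDelta [(n.succPNat, 0)] = if n = 1 then (-(1 / 2) : ℚ) • 1 else 0 := by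
    simp only [wordDelta, wordDelta1, wordDelta2, wordDelta3, wordDelta4, wordDelta5, splitSum,
      List.cons.injEq, Prod.mk.injEq, and_true, h2, Nat.cast_zero, zero_smul,
      word_nil, reduceCtorEq, and_false, if_false]
    split_ifs <;> simp
  rw [h]
  split_ifs <;> simp

theorem delta_evenEis_zero (hδ : IsInducedBy δ wordDelta) : δ (evenEis 0) = (-(1 / 2) : ℚ) • 1 :=
  delta_gEis hδ 1

theorem delta_evenEis_succ (hδ : IsInducedBy δ wordDelta) (m : ℕ) : δ (evenEis (m + 1)) = 0 := by
  rw [evenEis, delta_gEis hδ, if_neg (by omega)]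

theorem weight_evenEis (hW : IsInducedBy W wordW) (m : ℕ) :
    W (evenEis m) = (2 * (m + 1 : ℕ) : ℚ) • evenEis m := by
  rw [evenEis, gEis_eq_G, hW, wordW, map_smul]
  simp only [wt, List.map_cons, List.map_nil, List.sum_cons, List.sum_nil, Nat.succPNat_coe]
  rw [G]
  congr 1
  push_cast
  ring

/-- `D` produces a single letter whose upper index exceeds 1 and whose lower index is 1; such a word
generates part of the ideal. -/
theorem proj_derivation_gEis (hD : IsInducedBy D wordD) (n : ℕ) : proj (D (gEis (n + 1))) = 0 := by
  rw [gEis_eq_G, hD]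
  have h : wordD [((n + 1).succPNat, 0)] = (n + 2 : ℚ) • word [((n + 2).succPNat, 1)] := by
    have h : (n + 1).succPNat + 1 = (n + 2).succPNat := PNat.coe_injective (by simp)
    simp only [wordD, splitSum, h, map_zero, add_zero, Nat.succPNat_coe, zero_add]
    push_cast
    ring_nf
  rw [h, map_smul, map_smul]
  refine (congrArg _ ?_).trans (smul_zero _)
  refine Ideal.Quotient.eq_zero_iff_mem.2 (Ideal.subset_span ⟨_, ?_, rfl⟩)
  rintro ⟨u, v, huv, hu, hv⟩
  rcases u with - | ⟨a, u⟩
  · rw [List.nil_append] at huv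
    have := hv _ (huv ▸ List.mem_singleton_self _)
    simp at this
  · rw [List.cons_append, List.cons.injEq] at huv
    have := hu a (by simp)
    rw [← huv.1, ← PNat.coe_inj] at this
    simp at this

theorem cls_ofWords {Θ : Derivation ℚ FMES FMES} {θ : Word → QA} (h : IsInducedBy Θ θ) (x : QA) :
    Θ (cls x) = cls (ofWords θ x) := by
  have key : (Θ : FMES →ₗ[ℚ] FMES) ∘ₗ cls.toLinearMap = cls.toLinearMap ∘ₗ ofWords θ :=
    hom_ext fun w => (h w).trans (congrArg cls (ofWords_word _ _).symm)
  exact LinearMap.congr_fun key x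

/-- After projection the derivative in `derivation_evenEis` disappears, which leaves an Euler-type
recursion for even zeta values. -/
theorem proj_evenEis_succ (hD : IsInducedBy D wordD) (m : ℕ) :
    proj (evenEis (m + 1)) =
      (2 / (2 * m + 5) : ℚ) • ∑ i ∈ antidiagonal m, proj (evenEis i.1) * proj (evenEis i.2) := by
  have h := congrArg proj (derivation_evenEis D (cls_ofWords hD) m)
  rw [evenEis, proj_derivation_gEis hD, map_sub, map_smul, map_smul, map_sum] at h
  simp only [map_mul] at h
  have h1 : (m + 1 : ℚ) ≠ 0 := by positivity
  have h2 : (2 * m + 5 : ℚ) ≠ 0 := by positivity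
  linear_combination (norm := skip) (-1 / ((m + 1) * (2 * m + 5)) : ℚ) • h
  match_scalars <;> field_simp <;> ring

/-- The recursion has positive coefficients only, so no cancellation can make the constant vanish.
-/
theorem exists_proj_evenEis (hD : IsInducedBy D wordD) (m : ℕ) :
    ∃ c : ℚ, 0 < c ∧ proj (evenEis m) = c • proj (evenEis 0) ^ (m + 1) := by
  induction m using Nat.strong_induction_on with
  | _ m ih =>
    rcases m with - | m
    · exact ⟨1, one_pos, by rw [one_smul, zero_add, pow_one]⟩
    · have h : ∀ i : ℕ, ∃ c : ℚ, i < m + 1 →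
          0 < c ∧ proj (evenEis i) = c • proj (evenEis 0) ^ (i + 1) := fun i => by
        by_cases hi : i < m + 1
        · obtain ⟨c, hc⟩ := ih i hi
          exact ⟨c, fun _ => hc⟩
        · exact ⟨0, fun h => absurd h hi⟩
      choose c hc using h
      have hlt : ∀ i ∈ antidiagonal m, i.1 < m + 1 ∧ i.2 < m + 1 := fun i hi => by
        have := Finset.HasAntidiagonal.mem_antidiagonal.1 hi
        omega
      refine ⟨2 / (2 * m + 5) * ∑ i ∈ antidiagonal m, c i.1 * c i.2,
        mul_pos (by positivity) (Finset.sum_pos (fun i hi => ?_) ⟨(0, m), by simp⟩), ?_⟩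
      · exact mul_pos (hc _ (hlt i hi).1).1 (hc _ (hlt i hi).2).1
      · rw [proj_evenEis_succ hD, mul_smul, Finset.sum_smul]
        congr 1
        refine Finset.sum_congr rfl fun i hi => ?_
        have := Finset.HasAntidiagonal.mem_antidiagonal.1 hi
        rw [(hc _ (hlt i hi).1).2, (hc _ (hlt i hi).2).2, smul_mul_smul_comm, ← pow_add]
        congr 2
        omega

theorem proj_evenEis_ne_zero (hD : IsInducedBy D wordD) (m : ℕ) : proj (evenEis m) ≠ 0 := by
  obtain ⟨c, hc, h⟩ := exists_proj_evenEis hD m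
  rw [h]
  exact smul_ne_zero hc.ne' (proj_two_pow_ne_zero _)

theorem derivation_mem_adjoin {R A : Type*} [CommRing R] [CommRing A] [Algebra R A]
    (Θ : Derivation R A A) {s : Set A} (h : ∀ x ∈ s, Θ x ∈ Algebra.adjoin R s) {x : A}
    (hx : x ∈ Algebra.adjoin R s) : Θ x ∈ Algebra.adjoin R s := by
  induction hx using Algebra.adjoin_induction with
  | mem x hx => exact h x hx
  | algebraMap r => rw [Θ.map_algebraMap]; exact zero_mem _
  | add x y _ _ hx hy => rw [map_add]; exact add_mem hx hy
  | mul x y hx' hy' hx hy =>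
    rw [Θ.leibniz]
    exact add_mem (mul_mem hx' hy) (mul_mem hy' hx)

/-- The algebra of even Eisenstein series is stable by the explicit formulas. Conversely,
`derivation_evenEis` has nonzero coefficient `(m+1)(2m+5)` at `G(2m+4)`, so it produces each
generator from a derivative and products of earlier ones. -/
theorem quasimodularForms_eq_adjoin (hD : IsInducedBy D wordD) (hW : IsInducedBy W wordW)
    (hδ : IsInducedBy δ wordDelta) :
    quasimodularForms D W δ = Algebra.adjoin ℚ (Set.range evenEis) := by
  apply le_antisymm
  · refine sInf_le ⟨?_, fun x hx => ⟨derivation_mem_adjoin D ?_ hx,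
      derivation_mem_adjoin W ?_ hx, derivation_mem_adjoin δ ?_ hx⟩⟩
    · exact Algebra.subset_adjoin ⟨0, (eisG_eq_gEis 2).symm⟩
    all_goals
      have hE := fun m => Algebra.subset_adjoin (R := ℚ) (Set.mem_range_self (f := evenEis) m)
      rintro _ ⟨m, rfl⟩
    · rw [derivation_evenEis D (cls_ofWords hD)]
      exact sub_mem (Subalgebra.smul_mem _ (hE _) _) (Subalgebra.smul_mem _
        (Subalgebra.sum_mem _ fun i _ => mul_mem (hE _) (hE _)) _)
    · rw [weight_evenEis hW]
      exact Subalgebra.smul_mem _ (hE _) _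
    · rcases m with - | m
      · rw [delta_evenEis_zero hδ]
        exact Subalgebra.smul_mem _ (one_mem _) _
      · rw [delta_evenEis_succ hδ]
        exact zero_mem _
  · refine le_sInf fun S ⟨h2, hS⟩ => Algebra.adjoin_le ?_
    rintro _ ⟨m, rfl⟩
    rw [SetLike.mem_coe]
    induction m using Nat.strong_induction_on with
    | _ m ih =>
      rcases m with - | m
      · exact Set.mem_of_eq_of_mem (eisG_eq_gEis 2).symm h2
      · have h := derivation_evenEis D (cls_ofWords hD) m
        have h1 : ((m + 1) * (2 * m + 5) : ℚ) ≠ 0 := by positivity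
        have h3 : evenEis (m + 1) = ((m + 1) * (2 * m + 5) : ℚ)⁻¹ • (D (evenEis m) +
            (2 * (m + 1) : ℚ) • ∑ i ∈ antidiagonal m, evenEis i.1 * evenEis i.2) := by
          rw [h, sub_add_cancel, inv_smul_smul₀ h1]
        rw [h3]
        refine Subalgebra.smul_mem _ (add_mem (hS _ (ih m (by omega))).1 (Subalgebra.smul_mem _
          (Subalgebra.sum_mem _ fun i hi => ?_) _)) _
        have := Finset.HasAntidiagonal.mem_antidiagonal.1 hi
        exact mul_mem (ih _ (by omega)) (ih _ (by omega))

/-- The elements of weight `2 m` whose projection is a multiple of that of `G(2) ^ m`. -/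
noncomputable def projLine (W : Derivation ℚ FMES FMES) (m : ℕ) : Submodule ℚ FMES :=
  Module.End.eigenspace (W : FMES →ₗ[ℚ] FMES) (2 * m : ℚ) ⊓
    (Submodule.span ℚ {proj (evenEis 0) ^ m}).comap proj.toLinearMap

theorem mem_projLine {m : ℕ} {x : FMES} : x ∈ projLine W m ↔
    W x = (2 * m : ℚ) • x ∧ ∃ c : ℚ, c • proj (evenEis 0) ^ m = proj x := by
  rw [projLine, Submodule.mem_inf, Module.End.mem_eigenspace_iff, Submodule.mem_comap,
    Submodule.mem_span_singleton]
  rfl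

theorem mul_mem_projLine {m n : ℕ} {x y : FMES} (hx : x ∈ projLine W m) (hy : y ∈ projLine W n) :
    x * y ∈ projLine W (m + n) := by
  obtain ⟨hx, c, hc⟩ := mem_projLine.1 hx
  obtain ⟨hy, d, hd⟩ := mem_projLine.1 hy
  refine mem_projLine.2 ⟨?_, c * d, ?_⟩
  · rw [W.leibniz, hx, hy, smul_eq_mul, smul_eq_mul, mul_smul_comm, mul_smul_comm, mul_comm y x,
      ← add_smul]
    congr 1
    push_cast
    ring
  · rw [map_mul, ← hc, ← hd, smul_mul_smul_comm, pow_add]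

theorem evenEis_mem_projLine (hD : IsInducedBy D wordD) (hW : IsInducedBy W wordW) (m : ℕ) :
    evenEis m ∈ projLine W (m + 1) := by
  obtain ⟨c, -, h⟩ := exists_proj_evenEis hD m
  exact mem_projLine.2 ⟨weight_evenEis hW m, c, h.symm⟩

/-- The lines are multiplicative in `m` and contain the generators, so their sum contains the
algebra generated. -/
theorem mem_iSup_projLine (hD : IsInducedBy D wordD) (hW : IsInducedBy W wordW)
    {x : FMES} (hx : x ∈ Algebra.adjoin ℚ (Set.range evenEis)) : x ∈ ⨆ m, projLine W m := by
  have h1 : (1 : FMES) ∈ projLine W 0 := mem_projLine.2 ⟨by simp, 1, by simp⟩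
  induction hx using Algebra.adjoin_induction with
  | mem x hx =>
    obtain ⟨m, rfl⟩ := hx
    exact Submodule.mem_iSup_of_mem _ (evenEis_mem_projLine hD hW m)
  | algebraMap r =>
    rw [Algebra.algebraMap_eq_smul_one]
    exact Submodule.smul_mem _ _ (Submodule.mem_iSup_of_mem 0 h1)
  | add x y _ _ hx hy => exact add_mem hx hy
  | mul x y hx' hy' hx hy =>
    clear hx' hy'
    induction hx using Submodule.iSup_induction' with
    | zero => rw [zero_mul]; exact zero_mem _
    | add a b _ _ ha hb => rw [add_mul]; exact add_mem ha hb
    | mem m a ha =>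
      induction hy using Submodule.iSup_induction' with
      | zero => rw [mul_zero]; exact zero_mem _
      | add c d _ _ hc hd => rw [mul_add]; exact add_mem hc hd
      | mem n b hb => exact Submodule.mem_iSup_of_mem _ (mul_mem_projLine ha hb)

/-- Eigenspaces of `W` for distinct eigenvalues are independent, so the components of `x` outside
weight `2k` add up to zero. -/
theorem mem_projLine_of_weight {x : FMES} (hx : x ∈ ⨆ m, projLine W m) {k : ℕ}
    (hk : W x = (2 * k : ℚ) • x) : x ∈ projLine W k := by
  classical
  obtain ⟨f, hf, rfl⟩ := (Submodule.mem_iSup_iff_exists_finsupp _ _).1 hx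
  have hind := (Module.End.eigenspaces_iSupIndep (W : FMES →ₗ[ℚ] FMES)).comp
    (f := fun m : ℕ => (2 * m : ℚ)) fun a b h => by simpa using h
  have hrest : (f.sum fun _ y => y) - f k ∈
      ⨆ m, ⨆ (_ : m ≠ k), Module.End.eigenspace (W : FMES →ₗ[ℚ] FMES) (2 * m : ℚ) := by
    rw [← Finsupp.add_sum_erase' f k (fun _ y => y) (fun _ => rfl), add_sub_cancel_left]
    refine Submodule.sum_mem _ fun m hm => ?_
    have hmk : m ≠ k := by
      rintro rfl
      simp at hm
    rw [Finsupp.erase_ne hmk]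
    exact Submodule.mem_iSup_of_mem m (Submodule.mem_iSup_of_mem hmk (hf m).1)
  have h0 := Submodule.disjoint_def.1 (hind k) _
    (sub_mem (Module.End.mem_eigenspace_iff.2 hk) (hf k).1) hrest
  rw [sub_eq_zero.1 h0]
  exact hf k

theorem weight_eq_of_mem_weightSpace (hW : IsInducedBy W wordW) {k : ℕ} {x : FMES}
    (hx : x ∈ weightSpace k) : W x = (k : ℚ) • x := by
  have : weightSpace k ≤ Module.End.eigenspace (W : FMES →ₗ[ℚ] FMES) (k : ℚ) := by
    refine Submodule.span_le.2 ?_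
    rintro _ ⟨w, rfl, rfl⟩
    refine Module.End.mem_eigenspace_iff.2 ((hW w).trans ?_)
    rw [wordW, map_smul, G]
  exact Module.End.mem_eigenspace_iff.1 (this hx)

end Derivations

/-! ### The weight grading -/

/-- The span of the words of weight `k`. -/
noncomputable def wordSpace (k : ℕ) : Submodule ℚ QA :=
  Submodule.span ℚ {x | ∃ w : Word, wt w = k ∧ word w = x}

theorem word_mem_wordSpace (w : Word) : word w ∈ wordSpace (wt w) :=
  Submodule.subset_span ⟨w, rfl, rfl⟩

theorem cons_mem_wordSpace (a : Letter) {k : ℕ} {x : QA} (hx : x ∈ wordSpace k) :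
    cons a x ∈ wordSpace (a.1 + a.2 + k) := by
  have : wordSpace k ≤ (wordSpace (a.1 + a.2 + k)).comap (cons a) := by
    refine Submodule.span_le.2 ?_
    rintro _ ⟨w, rfl, rfl⟩
    rw [SetLike.mem_coe, Submodule.mem_comap, cons_word]
    exact Submodule.subset_span ⟨_, rfl, rfl⟩
  exact this hx

theorem stuffle_mem_wordSpace (w v : Word) : stuffle w v ∈ wordSpace (wt w + wt v) := by
  induction w, v using stuffle.induct with
  | case1 v =>
    rw [stuffle]
    simpa [wt] using word_mem_wordSpace v
  | case2 a w =>
    rw [stuffle]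
    exact word_mem_wordSpace (a :: w)
  | case3 a w b v h1 h2 h3 =>
    rw [stuffle]
    have e1 : wt (a :: w) = a.1 + a.2 + wt w := rfl
    have e2 : wt (b :: v) = b.1 + b.2 + wt v := rfl
    refine add_mem (add_mem ?_ ?_) ?_
    · convert cons_mem_wordSpace a h1 using 2; omega
    · convert cons_mem_wordSpace b h2 using 2; omega
    · convert cons_mem_wordSpace (a + b) h3 using 2
      simp only [Prod.fst_add, Prod.snd_add, PNat.add_coe]; omega

theorem mul_mem_weightSpace {k l : ℕ} {x y : FMES} (hx : x ∈ weightSpace k)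
    (hy : y ∈ weightSpace l) : x * y ∈ weightSpace (k + l) := by
  have h : wordSpace (k + l) ≤ (weightSpace (k + l)).comap cls.toLinearMap := by
    refine Submodule.span_le.2 ?_
    rintro _ ⟨w, hw, rfl⟩
    exact Submodule.subset_span ⟨w, hw, rfl⟩
  refine Submodule.span_induction₂ (p := fun x y _ _ => x * y ∈ weightSpace (k + l))
    ?_ ?_ ?_ ?_ ?_ ?_ ?_ hx hy
  · rintro _ _ ⟨w, rfl, rfl⟩ ⟨v, rfl, rfl⟩
    rw [G, G, ← map_mul, word_mul_word]
    exact h (stuffle_mem_wordSpace w v)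
  · intro y _; rw [zero_mul]; exact zero_mem _
  · intro y _; rw [mul_zero]; exact zero_mem _
  · intro a b c _ _ _ ha hb; rw [add_mul]; exact add_mem ha hb
  · intro a b c _ _ _ ha hb; rw [mul_add]; exact add_mem ha hb
  · intro r a b _ _ hab; rw [smul_mul_assoc]; exact Submodule.smul_mem _ _ hab
  · intro r a b _ _ hab; rw [mul_smul_comm]; exact Submodule.smul_mem _ _ hab

theorem pow_mem_weightSpace {k : ℕ} {x : FMES} (hx : x ∈ weightSpace k) (n : ℕ) :
    x ^ n ∈ weightSpace (n * k) := by
  induction n with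
  | zero => rw [zero_mul, pow_zero]; exact Submodule.subset_span ⟨[], rfl, rfl⟩
  | succ n ih =>
    rw [pow_succ, Nat.succ_mul]
    exact mul_mem_weightSpace ih hx

theorem eisG_mem_weightSpace (k : ℕ+) : eisG k ∈ weightSpace k :=
  Submodule.subset_span ⟨_, by simp [wt], rfl⟩

/-! ### Decomposition of modular forms, and the cusp form `Δ` -/

variable {D W δ : Derivation ℚ FMES FMES}

theorem eisG_eq_evenEis {k : ℕ+} {m : ℕ} (h : (k : ℕ) = 2 * m + 2) : eisG k = evenEis m := by
  rw [eisG_eq_gEis, evenEis, PNat.natPred, h]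
  rfl

theorem evenEis_mem_quasimodularForms (hD : IsInducedBy D wordD) (hW : IsInducedBy W wordW)
    (hδ : IsInducedBy δ wordDelta) (m : ℕ) : evenEis m ∈ quasimodularForms D W δ := by
  rw [quasimodularForms_eq_adjoin hD hW hδ]
  exact Algebra.subset_adjoin (Set.mem_range_self m)

/-- Projections of quasimodular forms of weight `k` lie in one line, spanned by the nonzero image of
the modular form `G(k)`. Only this one form in the kernel of `δ` is needed; the full kernel is never
determined. -/
theorem modularFormsOfWeight_decomposition (hD : IsInducedBy D wordD) (hW : IsInducedBy W wordW)
    (hδ : IsInducedBy δ wordDelta) (k : ℕ+) (hk : 4 ≤ k) (he : Even (k : ℕ)) :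
    eisG k ≠ 0 ∧ Disjoint (Submodule.span ℚ {eisG k}) (cuspFormsOfWeight D W δ (k : ℕ)) ∧
      Submodule.span ℚ {eisG k} ⊔ cuspFormsOfWeight D W δ (k : ℕ) =
        modularFormsOfWeight D W δ (k : ℕ) := by
  -- Writing the index as `m + 1` excludes `G(2)`, the only even Eisenstein series not killed by
  -- `δ`.
  obtain ⟨m, hm⟩ : ∃ m, (k : ℕ) = 2 * (m + 1) + 2 := by
    obtain ⟨l, hl⟩ := he
    have : 4 ≤ (k : ℕ) := hk
    exact ⟨l - 2, by omega⟩
  have hG := eisG_eq_evenEis hm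
  have hne : proj (eisG k) ≠ 0 := hG ▸ proj_evenEis_ne_zero hD (m + 1)
  have hmod : eisG k ∈ modularFormsOfWeight D W δ (k : ℕ) := by
    refine ⟨⟨?_, ?_⟩, eisG_mem_weightSpace k⟩
    · rw [hG]
      exact evenEis_mem_quasimodularForms hD hW hδ _
    · rw [hG]
      exact LinearMap.mem_ker.2 (delta_evenEis_succ hδ m)
  refine ⟨fun h => hne (by rw [h, map_zero]), ?_, le_antisymm (sup_le ?_ ?_) ?_⟩
  · rw [Submodule.disjoint_def]
    intro x hx hx'
    obtain ⟨c, rfl⟩ := Submodule.mem_span_singleton.1 hx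
    have h0 : proj (c • eisG k) = 0 := hx'.1.2
    rw [map_smul, smul_eq_zero, or_iff_left hne] at h0
    rw [h0, zero_smul]
  · rw [Submodule.span_singleton_le_iff_mem]
    exact hmod
  · exact inf_le_inf_right _ inf_le_left
  · intro x hx
    have hq : x ∈ quasimodularForms D W δ := hx.1.1
    rw [quasimodularForms_eq_adjoin hD hW hδ] at hq
    have hw := weight_eq_of_mem_weightSpace hW hx.2
    rw [hm] at hw
    obtain ⟨-, c, hc⟩ := mem_projLine.1 (mem_projLine_of_weight (mem_iSup_projLine hD hW hq)
      (k := m + 2) (hw.trans (by push_cast; ring_nf)))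
    obtain ⟨b, hb, hb'⟩ := exists_proj_evenEis hD (m + 1)
    -- Here `c` and `b` are the coefficients of `π x` and `π G(k)` along the same power of
    -- `π(G(2))`.
    refine Submodule.mem_sup.2 ⟨(c / b) • eisG k, Submodule.mem_span_singleton.2 ⟨_, rfl⟩,
      x - (c / b) • eisG k, ?_, add_sub_cancel _ _⟩
    have hx' := sub_mem hx (Submodule.smul_mem _ (c / b) hmod)
    refine ⟨⟨hx'.1, ?_⟩, hx'.2⟩
    change proj (x - (c / b) • eisG k) = 0
    rw [map_sub, map_smul, ← hc, hG, hb', smul_smul, div_mul_cancel₀ _ hb.ne', sub_self]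

theorem eis_two : eis 2 = (-24 : ℚ) • evenEis 0 := by
  rw [eis, eisG_eq_evenEis (m := 0) rfl]
  congr 1
  norm_num [bernoulli_eq_bernoulli'_of_ne_one, Nat.factorial]

theorem bernoulli_four : bernoulli 4 = -1 / 30 := by
  rw [bernoulli_eq_bernoulli'_of_ne_one (by norm_num), bernoulli'_four]

theorem bernoulli_six : bernoulli 6 = 1 / 42 := by
  have h5 : bernoulli' 5 = 0 := bernoulli'_eq_zero_of_odd (by decide) (by norm_num)
  rw [bernoulli_eq_bernoulli'_of_ne_one (by norm_num), bernoulli'_def]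
  norm_num [Finset.sum_range_succ, h5, Nat.choose]

theorem eis_four : eis 4 = (1440 : ℚ) • evenEis 1 := by
  rw [eis, eisG_eq_evenEis (m := 1) rfl]
  congr 1
  norm_num [bernoulli_four, Nat.factorial]

theorem eis_six : eis 6 = (-60480 : ℚ) • evenEis 2 := by
  rw [eis, eisG_eq_evenEis (m := 2) rfl]
  congr 1
  norm_num [bernoulli_six, Nat.factorial]

theorem derivation_evenEis_one (hD : IsInducedBy D wordD) :
    D (evenEis 1) = (14 : ℚ) • evenEis 2 - (8 : ℚ) • (evenEis 0 * evenEis 1) := by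
  rw [derivation_evenEis D (cls_ofWords hD)]
  have hs : ∑ i ∈ antidiagonal 1, evenEis i.1 * evenEis i.2 =
      evenEis 0 * evenEis 1 + evenEis 1 * evenEis 0 := by
    simp [Finset.Nat.antidiagonal_succ]
  rw [hs, mul_comm (evenEis 1)]
  norm_num
  module

/-- The general formula contains `G(8)`, which `evenEis_three` replaces by `G(4)²`; this closes the
system of Ramanujan's equations on `G(2)`, `G(4)`, `G(6)`. -/
theorem derivation_evenEis_two (hD : IsInducedBy D wordD) :
    D (evenEis 2) = (120 / 7 : ℚ) • evenEis 1 ^ 2 - (12 : ℚ) • (evenEis 0 * evenEis 2) := by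
  rw [derivation_evenEis D (cls_ofWords hD), evenEis_three]
  have hs : ∑ i ∈ antidiagonal 2, evenEis i.1 * evenEis i.2 =
      evenEis 0 * evenEis 2 + (evenEis 1 ^ 2 + evenEis 2 * evenEis 0) := by
    simp [Finset.Nat.antidiagonal_succ, pow_two]
  rw [hs, mul_comm (evenEis 2)]
  norm_num
  module

theorem formalDelta_eq : formalDelta =
    (1728000 : ℚ) • evenEis 1 ^ 3 - (2116800 : ℚ) • evenEis 2 ^ 2 := by
  rw [formalDelta, eis_four, eis_six, smul_pow, smul_pow, smul_sub, smul_smul, smul_smul]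
  norm_num

/-- The two contributions to `G(4)² G(6)` cancel, and the terms with `G(2)` combine to `-24 G(2)`
times the form. -/
theorem derivation_formalDelta (hD : IsInducedBy D wordD) :
    D formalDelta = eis 2 * formalDelta := by
  rw [formalDelta_eq, eis_two, map_sub, D.map_smul, D.map_smul, D.leibniz_pow, D.leibniz_pow,
    derivation_evenEis_one hD, derivation_evenEis_two hD]
  simp only [smul_eq_mul, nsmul_eq_mul]
  push_cast
  algebra

/-- The recursion gives `2/5` and `8/35` for the constants of `G(4)` and `G(6)`, and with these both
summands become `110592` times the sixth power of the projection of `G(2)`. -/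
theorem proj_formalDelta (hD : IsInducedBy D wordD) : proj formalDelta = 0 := by
  have h1 : proj (evenEis 1) = (2 / 5 : ℚ) • proj (evenEis 0) ^ 2 := by
    rw [proj_evenEis_succ hD 0]
    simp [pow_two]
  have h2 : proj (evenEis 2) = (8 / 35 : ℚ) • proj (evenEis 0) ^ 3 := by
    have hs : ∑ i ∈ antidiagonal 1, proj (evenEis i.1) * proj (evenEis i.2) =
        proj (evenEis 0) * proj (evenEis 1) + proj (evenEis 1) * proj (evenEis 0) := by
      simp [Finset.Nat.antidiagonal_succ]
    rw [proj_evenEis_succ hD 1, hs, mul_comm (proj (evenEis 1)), h1, mul_smul_comm, ← pow_succ']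
    norm_num
    module
  rw [formalDelta_eq, map_sub, map_smul, map_smul, map_pow, map_pow, h1, h2, smul_pow, smul_pow,
    ← pow_mul, ← pow_mul, smul_smul, smul_smul, sub_eq_zero]
  norm_num

theorem formalDelta_mem (hD : IsInducedBy D wordD) (hW : IsInducedBy W wordW)
    (hδ : IsInducedBy δ wordDelta) : formalDelta ∈ cuspFormsOfWeight D W δ 12 := by
  have hE := evenEis_mem_quasimodularForms hD hW hδ
  refine ⟨⟨⟨?_, ?_⟩, proj_formalDelta hD⟩, ?_⟩
  · rw [formalDelta_eq]
    exact sub_mem (Subalgebra.smul_mem _ (pow_mem (hE 1) 3) _)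
      (Subalgebra.smul_mem _ (pow_mem (hE 2) 2) _)
  · change δ formalDelta = 0
    rw [formalDelta_eq, map_sub, δ.map_smul, δ.map_smul, δ.leibniz_pow, δ.leibniz_pow,
      delta_evenEis_succ hδ, delta_evenEis_succ hδ]
    simp
  · exact Submodule.smul_mem _ _ (sub_mem
      (pow_mem_weightSpace (Submodule.smul_mem _ _ (eisG_mem_weightSpace 4)) 3)
      (pow_mem_weightSpace (Submodule.smul_mem _ _ (eisG_mem_weightSpace 6)) 2))

end FormalMES

theorem mainTheorem11 :
    ∃ D W δ : Derivation ℚ FormalMES.FMES FormalMES.FMES,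
      FormalMES.IsInducedBy D FormalMES.wordD ∧
      FormalMES.IsInducedBy W FormalMES.wordW ∧
      FormalMES.IsInducedBy δ FormalMES.wordDelta ∧
      (FormalMES.formalDelta ∈ FormalMES.cuspFormsOfWeight D W δ 12 ∧
        D FormalMES.formalDelta = FormalMES.eis 2 * FormalMES.formalDelta) ∧
      ∀ k : ℕ+, 4 ≤ k → Even (k : ℕ) →
        FormalMES.eisG k ≠ 0 ∧
        Disjoint (Submodule.span ℚ {FormalMES.eisG k})
          (FormalMES.cuspFormsOfWeight D W δ (k : ℕ)) ∧
        Submodule.span ℚ {FormalMES.eisG k} ⊔ FormalMES.cuspFormsOfWeight D W δ (k : ℕ) =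
          FormalMES.modularFormsOfWeight D W δ (k : ℕ) := by
  obtain ⟨D, W, δ, hD, hW, hδ⟩ := FormalMES.exists_induced_derivations
  have hD' : FormalMES.IsInducedBy D FormalMES.wordD := fun w =>
    (hD _).trans (by rw [FormalMES.QA.ofWords_word])
  have hW' : FormalMES.IsInducedBy W FormalMES.wordW := fun w =>
    (hW _).trans (by rw [FormalMES.QA.ofWords_word])
  have hδ' : FormalMES.IsInducedBy δ FormalMES.wordDelta := fun w =>
    (hδ _).trans (by rw [FormalMES.deltaQA, FormalMES.QA.ofWords_word])
  exact ⟨D, W, δ, hD', hW', hδ',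
    ⟨FormalMES.formalDelta_mem hD' hW' hδ', FormalMES.derivation_formalDelta hD'⟩,
    fun k hk he => FormalMES.modularFormsOfWeight_decomposition hD' hW' hδ' k hk he⟩
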